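/- Let $n\ge 2$ and let $(M,\omega)$ be a $2n$-dimensional symplectic manifold with a symplectic connection $\nabla^M$ (torsion-free, $\nabla^M\omega=0$) of Ricci type: with $R(X,Y)=[\nabla^M_X,\nabla^M_Y]-\nabla^M_{[X,Y]}$, $\mathrm{Ric}(X,Z)=\mathrm{tr}(Y\mapsto R(X,Y)Z)$, $\mathrm{Ric}(X,Y)=\omega(X,\varrho Y)$ and $X^\flat=\omega(X,\cdot)$, $$R(X,Y)=-\tfrac{1}{2(n+1)}\big(-2\omega(X,Y)\varrho-\varrho Y\otimes X^\flat+\varrho X\otimes Y^\flat-X\otimes(\varrho Y)^\flat+Y\otimes(\varrho X)^\flat\big).$$ Let $\mathsf U$ and $\mathsf f$ be the vector field and the function on $M$ determined by $\nabla^M_X\varrho=-\frac1{2n+1}(X\otimes\mathsf U^\flat+\mathsf U\otimes X^\flat)$ and $\nabla^M_X\mathsf U=-\frac{2n+1}{2(n+1)}\varrho^2X+\mathsf fX$, and put $t=\frac1{n+1}\mathrm{Ric}$, $\tau=\frac1{n+1}\varrho$, $\mathsf V=\frac{2}{(n+1)(2n+1)}\mathsf U$, $\phi=\frac{4}{(n+1)(2n+1)}\mathsf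 f$. Let $\pi:\Sigma\to M$ be a surjective submersion from a $(2n+1)$-dimensional manifold with a contact form $\alpha$ such that $\pi^*\omega=d\alpha$, the Reeb field $Z$ is complete, and the fibres of $\pi$ are the orbits of its flow. Let $P=\Sigma\times\mathbb R$ with projections $\mathrm{pr}_1:P\to\Sigma$ and $\mathrm{pr}=\pi\circ\mathrm{pr}_1:P\to M$, coordinate $s$ on $\mathbb R$, embedding $\iota:\Sigma\to P$, $q\mapsto(q,0)$, $S=\partial_s$, $H=e^s$, symplectic form $\mu=d(e^s\mathrm{pr}_1^*\alpha)$, and Hamiltonian vector field $X_H$ of $H$ (minus the lift of $Z$). Let $X^{\mathrm{hor}}$ be the lift to $P$ of a vector field $X$ on $M$ annihilated by $\mathrm{pr}_1^*\alpha$ and $ds$, and let $\nabla$ be the connection on $P$ with $\nabla_{X^{\mathrm{hor}}}Y^{\mathrm{hor}}=(\nabla^M_XY)^{\mathrm{hor}}+\frac12\mathrm{pr}^*(\omega(X,Y))X_H+\mathrm{pr}^*(t(X,Y))S$, $\nabla_{X^{\mathrm{hor}}}X_H=\nabla_{X_H}X^{\mathrm{hor}}=(\tau X)^{\mathrm{hor}}-\mathrm{pr}^*(\omega(X,\mathsf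 V))S$, $\nabla_{X^{\mathrm{hor}}}S=\nabla_SX^{\mathrm{hor}}=\frac12X^{\mathrm{hor}}$, $\nabla_{X_H}X_H=\mathrm{pr}^*\phi\,S-\mathsf V^{\mathrm{hor}}$, $\nabla_{X_H}S=\nabla_SX_H=\frac12X_H$ and $\nabla_SS=\frac12S$. For a manifold with a symplectic form and a symplectic connection, let $\Lambda$ be the Poisson tensor ($\Lambda(df,dg)=X_f(g)$ where $i_{X_f}$ of the form is $df$) and let $\mathsf D$ be the symmetrized covariant derivative $(\mathsf D\gamma)(X_1,\dots,X_{k+1})=\sum_\ell(\nabla_{X_\ell}\gamma)(X_1,\dots,\widehat{X_\ell},\dots,X_{k+1})$. Functions are smooth and complex-valued. On $C^\infty(P)[[\nu]]$ let $$f\star g=\sum_{r\ge0}\tfrac1{r!}\left(\tfrac\nu2\right)^r\big\langle\Lambda_P^{\otimes r},\tfrac1{r!}\mathsf D^rf\otimes\tfrac1{r!}\mathsf D^rg\big\rangle,$$ where the pairing contracts the $k$-th copy of $\Lambda_P$ with the $k$-th slots of both tensors. Let $hf=(f-\mathrm{pr}_1^*\iota^*f)/(H-1)$ off $\iota(\Sigma)$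 and $hf=\mathcal L_Sf$ on $\iota(\Sigma)$, let $\partial f=f(H-1)$ and $\boldsymbol\partial f=f\star(H-1)$, and let $\boldsymbol\iota^*=\iota^*(\mathrm{id}+(\boldsymbol\partial-\partial)h)^{-1}$, the inverse being the geometric series. The reduced star product on $C^\infty(M)[[\nu]]$ is determined by $\pi^*(u\star_{\mathrm{red}}v)=\boldsymbol\iota^*(\mathrm{pr}^*u\star\mathrm{pr}^*v)$, and its cochains, extended $\mathbb C[[\nu]]$-bilinearly, by $u\star_{\mathrm{red}}v=\sum_r\frac1{r!}(\frac\nu2)^rC_r^{\mathrm{red}}(u,v)$. Then, for all $u,v\in C^\infty(M)[[\nu]]$, $$C_2^{\mathrm{red}}(u,v)=\big\langle\Lambda_M\otimes\Lambda_M,\tfrac12\mathsf D_M^2u\otimes\tfrac12\mathsf D_M^2v\big\rangle+\tfrac2{n+1}\big\langle\mathrm{Ric}^\sharp,du\otimes dv\big\rangle,$$ where $(\mathrm{Ric}^\sharp)^{ij}=\Lambda_M^{ik}\Lambda_M^{jl}\mathrm{Ric}_{kl}$; here the coefficients of $\nu^k$, $k\le2$, of $\boldsymbol\iota^*(\mathrm{pr}^*u\star\mathrm{pr}^*v)$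 are indeed pullbacks under $\pi$ for $u,v\in C^\infty(M)$. Consequently, the symplectic connection determined by $\star_{\mathrm{red}}$ is $\nabla^M$: one has $C_0^{\mathrm{red}}(u,v)=uv$, $C_1^{\mathrm{red}}(u,v)=\{u,v\}$, and $\nabla^M$ is the unique symplectic connection $\nabla'$ on $(M,\omega)$ such that $C_2^{\mathrm{red}}(u,v)-\langle\Lambda_M\otimes\Lambda_M,\frac12\mathsf D_{\nabla'}^2u\otimes\frac12\mathsf D_{\nabla'}^2v\rangle$ is a bidifferential operator of order at most one in each argument. -/

import Mathlib

open scoped Manifold ContDiff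

noncomputable section

/-! ## Multilinear algebra on a real vector space with a bilinear form -/

section LinearAlgebra

variable {V : Type*} [AddCommGroup V] [Module ℝ V]

/-- The musical isomorphism: `sharp β a` is the vector `X` with `i_X β = a`. -/
def sharp (β : V → V → ℝ) (a : Module.Dual ℝ V) : V :=
  Classical.epsilon fun X => ∀ w, β X w = a w

/-- The Poisson tensor `Λ` of `β`: `Λ(a, b) = b(a^♯)`, so that `Λ(df, dg) = X_f(g)` where
`i_{X_f} β = df`. -/
def poissonTensor (β : V → V → ℝ) (a b : Module.Dual ℝ V) : ℝ := b (sharp β a)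

variable [Module.Finite ℝ V]

/-- The pairing `⟨Λ ⊗ ⋯ ⊗ Λ, A ⊗ B⟩` "over cross" of `r` copies of the Poisson tensor of `β`
with two `r`-linear forms:
`∑ Λ^{i₁j₁} ⋯ Λ^{i_r j_r} A(e_{i₁}, …, e_{i_r}) B(e_{j₁}, …, e_{j_r})` in a basis `e`. -/
def crossPairing (β : V → V → ℝ) (r : ℕ) (A B : (Fin r → V) → ℂ) : ℂ :=
  let e := Module.finBasis ℝ V
  ∑ i : Fin r → Fin (Module.finrank ℝ V), ∑ j : Fin r → Fin (Module.finrank ℝ V),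
    (∏ k, ((poissonTensor β (e.coord (i k)) (e.coord (j k)) : ℝ) : ℂ)) *
      A (fun k => e (i k)) * B (fun k => e (j k))

/-- The pairing `⟨T^♯, a ⊗ b⟩`, where `T^♯` is the contravariant tensor obtained from the bilinear
form `T` with the musical isomorphism of `β`, i.e. `(T^♯)^{ij} = Λ^{ik} Λ^{jl} T_{kl}`. -/
def sharpPairing (β T : V → V → ℝ) (a b : V → ℂ) : ℂ :=
  let e := Module.finBasis ℝ V
  ∑ i, ∑ j, ((T (sharp β (e.coord i)) (sharp β (e.coord j)) : ℝ) : ℂ) * a (e i) * b (e j)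

end LinearAlgebra

/-! ## Forms, connections and tensors on a manifold -/

section Manifold

variable {E : Type*} [NormedAddCommGroup E] [NormedSpace ℝ E]
  {H : Type*} [TopologicalSpace H] (I : ModelWithCorners ℝ E H)
  {N : Type*} [TopologicalSpace N] [ChartedSpace H N]

instance [FiniteDimensional ℝ E] (x : N) : Module.Finite ℝ (TangentSpace I x) :=
  inferInstanceAs (FiniteDimensional ℝ E)

/-- Smooth complex-valued functions. -/
def IsSmoothFun (u : N → ℂ) : Prop := ContMDiff I 𝓘(ℝ, ℂ) ∞ u

/-- Formal power series of smooth functions, the elements of `C^∞(N)[[ν]]`. -/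
def IsSmoothSeries (u : PowerSeries (N → ℂ)) : Prop :=
  ∀ k, IsSmoothFun I (PowerSeries.coeff k u)

variable [IsManifold I ∞ N]

/-- The exterior derivative of a one-form,
`dα(X, Y) = X(α(Y)) - Y(α(X)) - α([X, Y])`; the tangent vectors are extended to
vector fields that are constant in a trivialization of the tangent bundle. -/
def extDerivOne (α : ∀ x : N, TangentSpace I x →L[ℝ] ℝ) (x : N) (v w : TangentSpace I x) : ℝ :=
  let X : ∀ y : N, TangentSpace I y := FiberBundle.extend E v
  let Y : ∀ y : N, TangentSpace I y := FiberBundle.extend E w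
  mvfderiv I (fun y => α y (Y y)) x v - mvfderiv I (fun y => α y (X y)) x w
    - α x (VectorField.mlieBracket I X Y x)

/-- The exterior derivative of a two-form. -/
def extDerivTwo (Ω : ∀ x : N, TangentSpace I x →L[ℝ] TangentSpace I x →L[ℝ] ℝ) (x : N)
    (u v w : TangentSpace I x) : ℝ :=
  let X : ∀ y : N, TangentSpace I y := FiberBundle.extend E u
  let Y : ∀ y : N, TangentSpace I y := FiberBundle.extend E v
  let Z : ∀ y : N, TangentSpace I y := FiberBundle.extend E w
  mvfderiv I (fun y => Ω y (Y y) (Z y)) x u + mvfderiv I (fun y => Ω y (Z y) (X y)) x v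
    + mvfderiv I (fun y => Ω y (X y) (Y y)) x w
    - Ω x (VectorField.mlieBracket I X Y x) w - Ω x (VectorField.mlieBracket I Y Z x) u
    - Ω x (VectorField.mlieBracket I Z X x) v

/-- Symplectic forms: smooth, alternating, nondegenerate, closed two-forms. -/
structure IsSymplecticForm (Ω : ∀ x : N, TangentSpace I x →L[ℝ] TangentSpace I x →L[ℝ] ℝ) :
    Prop where
  smooth : ContMDiff I (I.prod 𝓘(ℝ, E →L[ℝ] E →L[ℝ] ℝ)) ∞
    (fun x => Bundle.TotalSpace.mk' (E →L[ℝ] E →L[ℝ] ℝ) x (Ω x))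
  alternating : ∀ x v, Ω x v v = 0
  nondegenerate : ∀ x v, (∀ w, Ω x v w = 0) → v = 0
  closed : ∀ x u v w, extDerivTwo I Ω x u v w = 0

/-- Symplectic connections: smooth torsion-free connections on the tangent bundle for which `Ω` is
parallel. (In Mathlib, `∇ Y x v` stands for `(∇_v Y)(x)`.) -/
structure IsSymplecticConnection [FiniteDimensional ℝ E]
    (Ω : ∀ x : N, TangentSpace I x →L[ℝ] TangentSpace I x →L[ℝ] ℝ)
    (cov : CovariantDerivative I E (TangentSpace I : N → Type _)) : Prop where
  smooth : haveI : IsManifold I 1 N := IsManifold.of_le (n := ∞) (by simp)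
    CovariantDerivative.ContMDiffCovariantDerivative cov ∞
  torsionFree : ∀ (X Y : ∀ x : N, TangentSpace I x) (x : N),
    MDifferentiableAt I I.tangent (fun y => Bundle.TotalSpace.mk' E y (X y)) x →
    MDifferentiableAt I I.tangent (fun y => Bundle.TotalSpace.mk' E y (Y y)) x →
    cov Y x (X x) - cov X x (Y x) = VectorField.mlieBracket I X Y x
  parallel : ∀ (Y Z : ∀ x : N, TangentSpace I x) (x : N) (v : TangentSpace I x),
    MDifferentiableAt I I.tangent (fun y => Bundle.TotalSpace.mk' E y (Y y)) x →
    MDifferentiableAt I I.tangent (fun y => Bundle.TotalSpace.mk' E y (Z y)) x →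
    mvfderiv I (fun y => Ω y (Y y) (Z y)) x v = Ω x (cov Y x v) (Z x) + Ω x (Y x) (cov Z x v)

/-! ### Covariant derivatives of covariant tensors -/

variable {I}

/-- The covariant derivative `(∇_v γ)(w₁, …, w_k)` of a covariant `k`-tensor field. Here `D Y x v`
stands for `∇_v Y` at `x`. -/
def covDerivTensor
    (D : (∀ x : N, TangentSpace I x) → ∀ x : N, TangentSpace I x → TangentSpace I x) {k : ℕ}
    (γ : ∀ x : N, (Fin k → TangentSpace I x) → ℂ) (x : N) (v : TangentSpace I x)
    (w : Fin k → TangentSpace I x) : ℂ :=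
  mvfderiv I (fun y => γ y (fun j => (FiberBundle.extend E (w j) y : TangentSpace I y))) x v
    - ∑ j, γ x (Function.update w j (D (FiberBundle.extend E (w j)) x v))

/-- The symmetrized covariant derivative
`(𝖣γ)(X₁, …, X_{k+1}) = ∑_ℓ (∇_{X_ℓ} γ)(X₁, …, X̂_ℓ, …, X_{k+1})`. -/
def symD
    (D : (∀ x : N, TangentSpace I x) → ∀ x : N, TangentSpace I x → TangentSpace I x) {k : ℕ}
    (γ : ∀ x : N, (Fin k → TangentSpace I x) → ℂ) (x : N) (w : Fin (k + 1) → TangentSpace I x) :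
    ℂ :=
  ∑ l : Fin (k + 1), covDerivTensor D γ x (w l) (fun j => w (l.succAbove j))

/-- The iterated symmetrized covariant derivative `𝖣^r f` of a function. -/
def symDPow
    (D : (∀ x : N, TangentSpace I x) → ∀ x : N, TangentSpace I x → TangentSpace I x)
    (f : N → ℂ) : ∀ (r : ℕ) (x : N), (Fin r → TangentSpace I x) → ℂ
  | 0 => fun x _ => f x
  | r + 1 => symD D (symDPow D f r)

/-- `C_r(f, g) = ⟨Λ ⊗ ⋯ ⊗ Λ, (1/r!) 𝖣^r f ⊗ (1/r!) 𝖣^r g⟩`, with `Λ` the Poisson tensor of `β`. -/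
def weylCochain [FiniteDimensional ℝ E] (β : ∀ x : N, TangentSpace I x → TangentSpace I x → ℝ)
    (D : (∀ x : N, TangentSpace I x) → ∀ x : N, TangentSpace I x → TangentSpace I x)
    (r : ℕ) (f g : N → ℂ) (x : N) : ℂ :=
  crossPairing (β x) r
    (fun w => (1 / (r.factorial : ℂ)) * symDPow D f r x w)
    (fun w => (1 / (r.factorial : ℂ)) * symDPow D g r x w)

variable (I) in
/-- The Poisson bracket `{f, g} = ⟨Λ, df ⊗ dg⟩`. -/
def poissonBracket [FiniteDimensional ℝ E]
    (β : ∀ x : N, TangentSpace I x → TangentSpace I x → ℝ) (f g : N → ℂ) (x : N) : ℂ :=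
  crossPairing (β x) 1 (fun w => mvfderiv I f x (w 0)) (fun w => mvfderiv I g x (w 0))

/-! ### Curvature, Ricci tensor, connections of Ricci type -/

/-- The curvature `R(X, Y)Z = ∇_X ∇_Y Z - ∇_Y ∇_X Z - ∇_{[X, Y]} Z`. -/
def curvatureTensor (cov : CovariantDerivative I E (TangentSpace I : N → Type _)) (x : N)
    (u v w : TangentSpace I x) : TangentSpace I x :=
  let X : ∀ y : N, TangentSpace I y := FiberBundle.extend E u
  let Y : ∀ y : N, TangentSpace I y := FiberBundle.extend E v
  let Z : ∀ y : N, TangentSpace I y := FiberBundle.extend E w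
  cov (fun y => cov Z y (Y y)) x u - cov (fun y => cov Z y (X y)) x v
    - cov Z x (VectorField.mlieBracket I X Y x)

/-- The Ricci tensor `Ric(X, Z) = tr (Y ↦ R(X, Y)Z)`. -/
def ricciTensor [FiniteDimensional ℝ E]
    (cov : CovariantDerivative I E (TangentSpace I : N → Type _)) (x : N)
    (u w : TangentSpace I x) : ℝ :=
  let e := Module.finBasis ℝ (TangentSpace I x)
  ∑ i, e.coord i (curvatureTensor cov x u (e i) w)

section

variable [FiniteDimensional ℝ E]
  (Ω : ∀ x : N, TangentSpace I x →L[ℝ] TangentSpace I x →L[ℝ] ℝ)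
  (cov : CovariantDerivative I E (TangentSpace I : N → Type _))

/-- The Ricci endomorphism `ϱ`, determined by `Ric(X, Y) = Ω(X, ϱ(Y))`. -/
def ricciEndo (x : N) (v : TangentSpace I x) : TangentSpace I x :=
  Classical.epsilon fun z => ∀ w, ricciTensor cov x w v = Ω x w z

/-- The connection `∇` on a `2n`-dimensional symplectic manifold is of Ricci type: the curvature is
the part determined by the Ricci tensor. -/
def IsRicciType (n : ℕ) : Prop :=
  ∀ (x : N) (X Y Z : TangentSpace I x),
    curvatureTensor cov x X Y Z = (-(1 / (2 * ((n : ℝ) + 1)))) •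
      (-(2 * Ω x X Y) • ricciEndo Ω cov x Z
        - Ω x X Z • ricciEndo Ω cov x Y + Ω x Y Z • ricciEndo Ω cov x X
        - Ω x (ricciEndo Ω cov x Y) Z • X + Ω x (ricciEndo Ω cov x X) Z • Y)

/-- The vector field `𝖴` of a Ricci type connection, determined by
`∇_X ϱ = -(1/(2n+1)) (X ⊗ 𝖴^♭ + 𝖴 ⊗ X^♭)`. -/
def ricciVector (n : ℕ) : ∀ x : N, TangentSpace I x :=
  Classical.epsilon fun U : ∀ x : N, TangentSpace I x =>
    ContMDiff I I.tangent ∞ (fun x => Bundle.TotalSpace.mk' E x (U x)) ∧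
    ∀ (x : N) (X Y : TangentSpace I x),
      cov (fun y => ricciEndo Ω cov y (FiberBundle.extend E Y y)) x X
          - ricciEndo Ω cov x (cov (FiberBundle.extend E Y) x X)
        = (-(1 / (2 * (n : ℝ) + 1))) • (Ω x (U x) Y • X + Ω x X Y • U x)

/-- The function `𝖿` of a Ricci type connection, determined by
`∇_X 𝖴 = -((2n+1)/(2(n+1))) ϱ² X + 𝖿 X`. -/
def ricciFunction (n : ℕ) : N → ℝ :=
  Classical.epsilon fun f : N → ℝ =>
    ContMDiff I 𝓘(ℝ, ℝ) ∞ f ∧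
    ∀ (x : N) (X : TangentSpace I x),
      cov (ricciVector Ω cov n) x X
        = (-((2 * (n : ℝ) + 1) / (2 * ((n : ℝ) + 1)))) •
            ricciEndo Ω cov x (ricciEndo Ω cov x X) + f x • X

end

/-! ### Differential operators -/

variable (I)

/-- `ℂ`-linear operators on `C^∞(N)`. -/
structure IsSmoothLinear (D : (N → ℂ) → N → ℂ) : Prop where
  smooth : ∀ u, IsSmoothFun I u → IsSmoothFun I (D u)
  add : ∀ u v, IsSmoothFun I u → IsSmoothFun I v → D (u + v) = D u + D v
  smul : ∀ (c : ℂ) u, IsSmoothFun I u → D (c • u) = c • D u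

/-- Differential operators of order at most `k` on `C^∞(N)`: linear operators all of whose
`(k+1)`-fold commutators with multiplications by smooth functions vanish. -/
def IsDiffOp : ℕ → ((N → ℂ) → N → ℂ) → Prop
  | 0, D => IsSmoothLinear I D ∧
      ∀ f u, IsSmoothFun I f → IsSmoothFun I u → D (f * u) = f * D u
  | k + 1, D => IsSmoothLinear I D ∧
      ∀ f, IsSmoothFun I f → IsDiffOp k (fun u => D (f * u) - f * D u)

/-- Bidifferential operators of order at most `k` in each argument. -/
def IsBidiffOp (k : ℕ) (B : (N → ℂ) → (N → ℂ) → N → ℂ) : Prop :=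
  (∀ v, IsSmoothFun I v → IsDiffOp I k (fun u => B u v)) ∧
  (∀ u, IsSmoothFun I u → IsDiffOp I k (fun v => B u v))

/-- The symplectic connection `∇` is determined by the star product
`u ⋆ v = ∑ (1/r!) (ν/2)^r C_r(u, v)` with `C_0(u, v) = u v` and `C_1(u, v) = {u, v}`:
the second cochain agrees with `⟨Λ ⊗ Λ, ½𝖣²u ⊗ ½𝖣²v⟩` up to a bidifferential operator of order at
most one in each argument. -/
structure IsConnectionOfStarProduct [FiniteDimensional ℝ E]
    (Ω : ∀ x : N, TangentSpace I x →L[ℝ] TangentSpace I x →L[ℝ] ℝ)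
    (C : ℕ → (N → ℂ) → (N → ℂ) → N → ℂ)
    (cov : CovariantDerivative I E (TangentSpace I : N → Type _)) : Prop where
  symplectic : IsSymplecticConnection I Ω cov
  zeroth : ∀ u v, IsSmoothFun I u → IsSmoothFun I v → C 0 u v = u * v
  first : ∀ u v, IsSmoothFun I u → IsSmoothFun I v →
    C 1 u v = poissonBracket I (fun x v w => Ω x v w) u v
  second : IsBidiffOp I 1 (fun u v =>
    C 2 u v - weylCochain (fun x v w => Ω x v w) (fun Y x v => cov Y x v) 2 u v)

end Manifold

/-! ## Formal power series -/

section Series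

variable {N : Type*}

/-- The `ℂ[[ν]]`-bilinear extension of a bilinear operator on functions to formal series. -/
def seriesExt (B : (N → ℂ) → (N → ℂ) → N → ℂ) (u v : PowerSeries (N → ℂ)) :
    PowerSeries (N → ℂ) :=
  PowerSeries.mk fun k => ∑ ab ∈ Finset.HasAntidiagonal.antidiagonal k,
    B (PowerSeries.coeff ab.1 u) (PowerSeries.coeff ab.2 v)

/-- The product `f ⋆ g = ∑ (1/r!) (ν/2)^r C_r(f, g)` on formal series. -/
def starProduct (C : ℕ → (N → ℂ) → (N → ℂ) → N → ℂ) (f g : PowerSeries (N → ℂ)) :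
    PowerSeries (N → ℂ) :=
  PowerSeries.mk fun k => ∑ rm ∈ Finset.HasAntidiagonal.antidiagonal k,
    ((1 / (rm.1.factorial : ℂ)) * (1 / 2) ^ rm.1) •
      PowerSeries.coeff rm.2 (seriesExt (C rm.1) f g)

/-- A map between function spaces, applied to the coefficients of a formal series. -/
def mapSeries {N' : Type*} (T : (N → ℂ) → N' → ℂ) (f : PowerSeries (N → ℂ)) :
    PowerSeries (N' → ℂ) :=
  PowerSeries.mk fun k => T (PowerSeries.coeff k f)

/-- The geometric series `(id + A)⁻¹ f = ∑_m (-A)^m f`, for an operator `A` that raises the order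
in `ν` by at least one (so that only `m ≤ k` contributes to the coefficient of `ν^k`). -/
def geometricInverse (A : PowerSeries (N → ℂ) → PowerSeries (N → ℂ)) (f : PowerSeries (N → ℂ)) :
    PowerSeries (N → ℂ) :=
  PowerSeries.mk fun k => ∑ m ∈ Finset.range (k + 1),
    PowerSeries.coeff k ((fun g => -A g)^[m] f)

end Series

/-! ## Reduction from `P = S × ℝ` to `M` through the contact manifold `S`

Below, `M` is the symplectic manifold of dimension `2n` with symplectic form `Ω`,
`π : S → M` the projection of the contact manifold with contact form `α`, and `P = S × ℝ`. -/

section Reduction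

variable {n : ℕ}
  {M : Type*} [TopologicalSpace M] [ChartedSpace (EuclideanSpace ℝ (Fin (2 * n))) M]
  [IsManifold (𝓡 (2 * n)) ∞ M]
  {S : Type*} [TopologicalSpace S] [ChartedSpace (EuclideanSpace ℝ (Fin (2 * n + 1))) S]
  [IsManifold (𝓡 (2 * n + 1)) ∞ S]
  (Ω : ∀ x : M, TangentSpace (𝓡 (2 * n)) x →L[ℝ] TangentSpace (𝓡 (2 * n)) x →L[ℝ] ℝ)
  (cov : CovariantDerivative (𝓡 (2 * n)) (EuclideanSpace ℝ (Fin (2 * n)))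
    (TangentSpace (𝓡 (2 * n)) : M → Type _))
  (π : S → M)
  (α : ∀ q : S, TangentSpace (𝓡 (2 * n + 1)) q →L[ℝ] ℝ)

/-- The Reeb vector field `Z`: `α(Z) = 1` and `i_Z dα = 0`. -/
def reebField (q : S) : TangentSpace (𝓡 (2 * n + 1)) q :=
  Classical.epsilon fun z => α q z = 1 ∧ ∀ w, extDerivOne (𝓡 (2 * n + 1)) α q z w = 0

/-- `π : S → M` is a surjective submersion, `α` is a contact form on `S` (i.e. `dα` is
nondegenerate on the hyperplanes `ker α`, equivalently `α ∧ (dα)^n` vanishes nowhere) with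
`π^*Ω = dα`, and `π` is the quotient map onto the space of orbits of the (complete) Reeb flow. -/
structure IsContactReduction : Prop where
  smooth_proj : ContMDiff (𝓡 (2 * n + 1)) (𝓡 (2 * n)) ∞ π
  surjective : Function.Surjective π
  submersion : ∀ q, Function.Surjective (mfderiv (𝓡 (2 * n + 1)) (𝓡 (2 * n)) π q)
  smooth_form : ContMDiff (𝓡 (2 * n + 1))
    ((𝓡 (2 * n + 1)).prod 𝓘(ℝ, EuclideanSpace ℝ (Fin (2 * n + 1)) →L[ℝ] ℝ)) ∞
    (fun q => Bundle.TotalSpace.mk' (EuclideanSpace ℝ (Fin (2 * n + 1)) →L[ℝ] ℝ)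
      (E := fun q : S => TangentSpace (𝓡 (2 * n + 1)) q →L[ℝ] ℝ) q (α q))
  contact_ne_zero : ∀ q, α q ≠ 0
  contact_nondegenerate : ∀ q v, α q v = 0 →
    (∀ w, α q w = 0 → extDerivOne (𝓡 (2 * n + 1)) α q v w = 0) → v = 0
  pullback_eq : ∀ q v w, extDerivOne (𝓡 (2 * n + 1)) α q v w =
    Ω (π q) (mfderiv (𝓡 (2 * n + 1)) (𝓡 (2 * n)) π q v)
      (mfderiv (𝓡 (2 * n + 1)) (𝓡 (2 * n)) π q w)
  orbits : ∀ q, ∃ γ : ℝ → S, γ 0 = q ∧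
    IsMIntegralCurve (I := 𝓡 (2 * n + 1)) γ (reebField α) ∧ Set.range γ = π ⁻¹' {π q}

/-! ### The symplectic manifold `P` -/

variable (n) in
/-- The model with corners of `P = S × ℝ`. -/
abbrev modelP := (𝓡 (2 * n + 1)).prod 𝓘(ℝ, ℝ)

/-- The tangent map of `pr₁ : P → S`. -/
def tangentPrOne (p : S × ℝ) (v : TangentSpace (modelP n) p) :
    TangentSpace (𝓡 (2 * n + 1)) p.1 :=
  mfderiv (modelP n) (𝓡 (2 * n + 1)) (Prod.fst : S × ℝ → S) p v

/-- The one-form `ds` on `P`. -/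
def ds (p : S × ℝ) (v : TangentSpace (modelP n) p) : ℝ :=
  mvfderiv (modelP n) (Prod.snd : S × ℝ → ℝ) p v

/-- The tangent map of `pr = π ∘ pr₁ : P → M`. -/
def tangentPr (p : S × ℝ) (v : TangentSpace (modelP n) p) : TangentSpace (𝓡 (2 * n)) (π p.1) :=
  mfderiv (modelP n) (𝓡 (2 * n)) (fun q : S × ℝ => π q.1) p v

/-- The symplectic form `μ = d(e^s pr₁^*α) = e^s ds ∧ pr₁^*α + e^s d pr₁^*α` on `P`. -/
def muForm (p : S × ℝ) (v w : TangentSpace (modelP n) p) : ℝ :=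
  Real.exp p.2 * (ds p v * α p.1 (tangentPrOne p w) - ds p w * α p.1 (tangentPrOne p v))
    + Real.exp p.2 * extDerivOne (𝓡 (2 * n + 1)) α p.1 (tangentPrOne p v) (tangentPrOne p w)

/-- The canonical lift of tangent vectors of `S` to `P = S × ℝ`. -/
def liftToP (p : S × ℝ) (v : TangentSpace (𝓡 (2 * n + 1)) p.1) : TangentSpace (modelP n) p :=
  mfderiv (𝓡 (2 * n + 1)) (modelP n) (fun q : S => (q, p.2)) p.1 v

/-- The horizontal lift of tangent vectors of `M` to `S`. -/
def horizontalLiftS (q : S) (x : TangentSpace (𝓡 (2 * n)) (π q)) :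
    TangentSpace (𝓡 (2 * n + 1)) q :=
  Classical.epsilon fun w => mfderiv (𝓡 (2 * n + 1)) (𝓡 (2 * n)) π q w = x ∧ α q w = 0

/-- The horizontal lift `X^hor` of tangent vectors of `M` to `P`. -/
def horizontalLift (p : S × ℝ) (x : TangentSpace (𝓡 (2 * n)) (π p.1)) :
    TangentSpace (modelP n) p :=
  liftToP p (horizontalLiftS π α p.1 x)

/-- The vector field `S = ∂/∂s` on `P`. -/
def fieldS (p : S × ℝ) : TangentSpace (modelP n) p :=
  mfderiv 𝓘(ℝ, ℝ) (modelP n) (fun t : ℝ => (p.1, t)) p.2 (1 : ℝ)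

/-- The Hamiltonian vector field `X_H` of `H = e^s`; it is the negative of the lift of the Reeb
vector field. -/
def fieldXH (p : S × ℝ) : TangentSpace (modelP n) p := -liftToP p (reebField α p.1)

/-- The coefficient `-α(v)` of `X_H` in the decomposition `v = x^hor + a S + b X_H`. -/
def coeffXH (p : S × ℝ) (v : TangentSpace (modelP n) p) : ℝ := -α p.1 (tangentPrOne p v)

/-- `t = (1/(n+1)) Ric`. -/
def tTensor (x : M) (v w : TangentSpace (𝓡 (2 * n)) x) : ℝ :=
  (1 / ((n : ℝ) + 1)) * ricciTensor cov x v w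

/-- The endomorphism `τ` with `t(X, Y) = Ω(X, τ(Y))`. -/
def tauEndo (x : M) (v : TangentSpace (𝓡 (2 * n)) x) : TangentSpace (𝓡 (2 * n)) x :=
  (1 / ((n : ℝ) + 1)) • ricciEndo Ω cov x v

/-- The vector field `𝖵 = (2/((n+1)(2n+1))) 𝖴`. -/
def vectorV (x : M) : TangentSpace (𝓡 (2 * n)) x :=
  (2 / (((n : ℝ) + 1) * (2 * n + 1))) • ricciVector Ω cov n x

/-- The function `φ = (4/((n+1)(2n+1))) 𝖿`. -/
def functionPhi (x : M) : ℝ := (4 / (((n : ℝ) + 1) * (2 * n + 1))) * ricciFunction Ω cov n x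

/-- The pullback along `pr` of the connection `∇^M`, acting on sections `s` of `pr^*TM`: in terms
of a frame `e_i` of `TM` that is constant in a trivialization around `pr(p)`, one has
`∇_v (s^i e_i) = v(s^i) e_i + s^i ∇^M_{T pr v} e_i`. -/
def pullbackCov (s : ∀ p : S × ℝ, TangentSpace (𝓡 (2 * n)) (π p.1)) (p : S × ℝ)
    (v : TangentSpace (modelP n) p) : TangentSpace (𝓡 (2 * n)) (π p.1) :=
  let e := trivializationAt (EuclideanSpace ℝ (Fin (2 * n)))
    (TangentSpace (𝓡 (2 * n)) : M → Type _) (π p.1)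
  e.symm (π p.1) (mvfderiv (modelP n) (fun q : S × ℝ =>
      (e (Bundle.TotalSpace.mk' (EuclideanSpace ℝ (Fin (2 * n))) (π q.1) (s q))).2) p v)
    + cov (FiberBundle.extend (EuclideanSpace ℝ (Fin (2 * n))) (s p)) (π p.1) (tangentPr π p v)

/-- The connection `∇` on `P`, determined by
* `∇_{X^hor} Y^hor = (∇^M_X Y)^hor + ½ Ω(X, Y) X_H + t(X, Y) S`,
* `∇_{X^hor} X_H = ∇_{X_H} X^hor = (τ X)^hor - Ω(X, 𝖵) S`,
* `∇_{X^hor} S = ∇_S X^hor = ½ X^hor`,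
* `∇_{X_H} X_H = φ S - 𝖵^hor`,
* `∇_{X_H} S = ∇_S X_H = ½ X_H` and `∇_S S = ½ S`.

It is written out for `v = x^hor + c S + d X_H` and `Y = y^hor + a S + b X_H`, where `y` is a
section of `pr^*TM`; `connP … Y p v` is `(∇_v Y)(p)`. -/
def connP (Y : ∀ p : S × ℝ, TangentSpace (modelP n) p) (p : S × ℝ)
    (v : TangentSpace (modelP n) p) : TangentSpace (modelP n) p :=
  let m : M := π p.1
  let x := tangentPr π p v
  let c := ds p v
  let d := coeffXH α p v
  let y := tangentPr π p (Y p)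
  let a := ds p (Y p)
  let b := coeffXH α p (Y p)
  horizontalLift π α p
      (pullbackCov cov π (fun q => tangentPr π q (Y q)) p v
        + (c / 2) • y + (a / 2) • x + d • tauEndo Ω cov m y + b • tauEndo Ω cov m x
        - (b * d) • vectorV Ω cov m)
    + (mvfderiv (modelP n) (fun q : S × ℝ => ds q (Y q)) p v
        + tTensor cov m x y - d * Ω m y (vectorV Ω cov m) - b * Ω m x (vectorV Ω cov m)
        + b * d * functionPhi Ω cov m + a * c / 2) • fieldS p
    + (mvfderiv (modelP n) (fun q : S × ℝ => coeffXH α q (Y q)) p v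
        + Ω m x y / 2 + (b * c + a * d) / 2) • fieldXH α p

/-! ### The star product on `P` and its reduction -/

/-- The Weyl-Moyal star product `⋆` of `(P, μ, ∇)`. -/
def moyalP (f g : PowerSeries (S × ℝ → ℂ)) : PowerSeries (S × ℝ → ℂ) :=
  starProduct (weylCochain (I := modelP n) (fun p v w => muForm α p v w) (connP Ω cov π α)) f g

/-- The function `H - 1 = e^s - 1` on `P`. -/
def hMinusOne (p : S × ℝ) : ℂ := ((Real.exp p.2 - 1 : ℝ) : ℂ)

/-- The classical homotopy `h`: `hf = (f - pr₁^* ι^* f) / (H - 1)` off `ι(S) = S × {0}`, and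
`hf = L_S f` on `ι(S)`. -/
def classicalHomotopy (f : S × ℝ → ℂ) (p : S × ℝ) : ℂ :=
  if p.2 = 0 then mvfderiv (modelP n) f p (fieldS p)
  else (f p - f (p.1, 0)) / hMinusOne p

/-- The quantum Koszul operator `f ↦ f ⋆ (H - 1)`. -/
def quantumKoszul (f : PowerSeries (S × ℝ → ℂ)) : PowerSeries (S × ℝ → ℂ) :=
  moyalP Ω cov π α f (PowerSeries.C hMinusOne)

/-- The classical Koszul operator `f ↦ f (H - 1)`. -/
def classicalKoszul (f : PowerSeries (S × ℝ → ℂ)) : PowerSeries (S × ℝ → ℂ) :=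
  mapSeries (fun g => g * hMinusOne) f

/-- The quantum restriction map `ι^* (id + (quantumKoszul - classicalKoszul) h)⁻¹`. -/
def quantumRestriction (f : PowerSeries (S × ℝ → ℂ)) : PowerSeries (S → ℂ) :=
  mapSeries (fun g q => g (q, 0))
    (geometricInverse
      (fun g =>
        quantumKoszul Ω cov π α (mapSeries (classicalHomotopy (n := n)) g)
          - classicalKoszul (mapSeries (classicalHomotopy (n := n)) g)) f)

/-- The quantum restriction of `pr^*u ⋆ pr^*v`. -/
def restrictedProduct (u v : PowerSeries (M → ℂ)) : PowerSeries (S → ℂ) :=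
  quantumRestriction Ω cov π α
    (moyalP Ω cov π α (mapSeries (fun f p => f (π p.1)) u) (mapSeries (fun f p => f (π p.1)) v))

/-- The reduced product `⋆_red`, determined by
`π^*(u ⋆_red v) = quantumRestriction (pr^*u ⋆ pr^*v)`. -/
def reducedProduct (u v : PowerSeries (M → ℂ)) : PowerSeries (M → ℂ) :=
  PowerSeries.mk fun k => Classical.epsilon fun w : M → ℂ =>
    w ∘ π = PowerSeries.coeff k (restrictedProduct Ω cov π α u v)

/-- The cochains `C_r^red` in `u ⋆_red v = ∑ (1/r!) (ν/2)^r C_r^red(u, v)`. -/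
def reducedCochain (r : ℕ) (u v : M → ℂ) : M → ℂ :=
  ((r.factorial : ℂ) * 2 ^ r) •
    PowerSeries.coeff r (reducedProduct Ω cov π α (PowerSeries.C u) (PowerSeries.C v))

end Reduction

end

/-!
The proof computes the first three coefficients of `pr^*u ⋆ pr^*v` at the points of `ι(S)` and shows
that the quantum restriction does not change them.

*The star product on `P`.* At a point of `P` the horizontal lifts of a frame of `TM` together with
`S` and `X_H` form a frame of the tangent space, and in it the Poisson tensor of `μ` is `e^{-s}`
times the sum of the horizontal lift of `Λ_M` and of `S ⊗ X_H - X_H ⊗ S`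
(`IsContactReduction.sum_frameP`). Hence `{pr^*u, pr^*v} = e^{-s} pr^*{u, v}`. The defining
equations of `∇` express the Hessian of `pr^*u` through the Hessian of `u`, the halves in
`∇_X S = ½ X`, the endomorphism `τ` and the vector `𝖵` (`IsContactReduction.hess_connP`); the
components of `∇` along `S` and `X_H`, among them `φ`, are killed by `d(pr^*u)`. In the contraction
of two such Hessians the value on `(X_H, X_H)`, the only place where `𝖵` occurs, is multiplied by
the value on `(S, S)`, which vanishes. So, besides the contraction of the Hessians on `M`, only the
terms survive in which one slot carries a horizontal pair and the other one `S` and `X_H`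
(`IsContactReduction.crossPairing_hessFormP`). They amount to two contractions of `τ` with
`du ⊗ dv`, which agree because `Ric` is symmetric and then add up to `(2/(n+1)) ⟨Ric^♯, du ⊗ dv⟩`
(`IsContactReduction.weylCochain_two_pr`).

*The quantum restriction.* The homotopy `h` kills functions that do not depend on `s`, in particular
the coefficient `pr^*(uv)` of order zero. It maps the first coefficient to a multiple of
`e^{-s} pr^*{u, v}`, which is invariant under the flow of `X_H` and so Poisson commutes with
`H - 1`. The deformation of the Koszul operator therefore does not show up before order
three (`coeff_geometricInverse_of_le_two`, `IsContactReduction.coeff_restrictedProduct`).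

*The Ricci tensor.* The curvature is defined by extending tangent vectors to local vector fields.
That it is tensorial in the first two arguments is a direct computation; in the third one it follows
from the first Bianchi identity for vector fields (`curvatureOperator_cyclic`). Hence `Ric` is
bilinear and the Ricci endomorphism exists. For a curvature of Ricci type, the Bianchi identity
reads `∑_cyc (Ric(Z, Y) - Ric(Y, Z)) X = 0`, which makes `Ric` symmetric in dimension at least three
(`IsSymplecticConnection.ricciTensor_symm`); this is where `2 ≤ n` enters.

*Differential operators.* In a local frame the components of the Poisson tensor are the entries of
the inverse of the Gram matrix of the symplectic form, so `{u, v}` and `⟨Ric^♯, du ⊗ dv⟩` are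
smooth. The latter is a biderivation, hence of order at most one in each argument
(`IsSymplecticConnection.isBidiffOp_ricci`).

*Uniqueness.* The operator `v ↦ ⟨Λ ⊗ Λ, ½𝖣²u ⊗ ½𝖣²v⟩` has as its second-order symbol the
symmetrized Hessian of `u` on Hamiltonian vectors (`weylCochain_two_mul`). If two connections give
second cochains differing by an operator of order at most one, then their symmetrized Hessians
agree for all `u`; as the difference of torsion-free connections is symmetric, the connections agree
(`IsConnectionOfStarProduct.unique`).
-/

set_option linter.unusedSectionVars false

noncomputable section

/-! ### Pairings with the Poisson tensor of a symplectic vector space -/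

section SymplecticLinearAlgebra

variable {V : Type*} [AddCommGroup V] [Module ℝ V]

/-- A linear symplectic form, given as a function of two vectors. -/
structure IsLinearSymplectic (β : V → V → ℝ) : Prop where
  bilin : IsBilinearMap ℝ β
  alt : ∀ v, β v v = 0
  nondeg : ∀ v, (∀ w, β v w = 0) → v = 0

namespace IsLinearSymplectic

variable {β : V → V → ℝ} (hβ : IsLinearSymplectic β)
include hβ

theorem swap (v w : V) : β v w = -β w v := by
  have h := hβ.alt (v + w)
  rw [hβ.bilin.add_left, hβ.bilin.add_right, hβ.bilin.add_right, hβ.alt, hβ.alt] at h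
  linarith

theorem eq_of_forall {v v' : V} (h : ∀ w, β v w = β v' w) : v = v' := by
  rw [← sub_eq_zero]
  refine hβ.nondeg _ fun w => ?_
  have : β (v - v') w = β v w - β v' w := map_sub (hβ.bilin.toLinearMap.flip w) v v'
  rw [this, h, sub_self]

theorem eq_of_forall_right {v v' : V} (h : ∀ w, β w v = β w v') : v = v' :=
  hβ.eq_of_forall fun w => by rw [hβ.swap, h, ← hβ.swap]

theorem sharp_eq {a : Module.Dual ℝ V} {X : V} (h : ∀ w, β X w = a w) : sharp β a = X := by
  have hs : ∀ w, β (sharp β a) w = a w :=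
    Classical.epsilon_spec (p := fun X => ∀ w, β X w = a w) ⟨X, h⟩
  exact hβ.eq_of_forall fun w => by rw [hs, h]

variable [Module.Finite ℝ V]

theorem exists_sharp (a : Module.Dual ℝ V) : ∃ X, ∀ w, β X w = a w := by
  have hinj : Function.Injective hβ.bilin.toLinearMap := by
    rw [← LinearMap.ker_eq_bot, LinearMap.ker_eq_bot']
    exact fun v hv => hβ.nondeg v fun w => LinearMap.congr_fun hv w
  have hsurj := (LinearMap.injective_iff_surjective_of_finrank_eq_finrank
    (Subspace.dual_finrank_eq (K := ℝ) (V := V)).symm).1 hinj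
  obtain ⟨X, hX⟩ := hsurj a
  exact ⟨X, fun w => by rw [← hX]; rfl⟩

theorem sharp_apply (a : Module.Dual ℝ V) (w : V) : β (sharp β a) w = a w :=
  Classical.epsilon_spec (hβ.exists_sharp a) w

/-- The musical isomorphism as a linear map. -/
def sharpMap : Module.Dual ℝ V →ₗ[ℝ] V where
  toFun := sharp β
  map_add' a b := hβ.sharp_eq fun w => by
    rw [hβ.bilin.add_left, hβ.sharp_apply, hβ.sharp_apply, LinearMap.add_apply]
  map_smul' r a := hβ.sharp_eq fun w => by
    rw [hβ.bilin.smul_left, hβ.sharp_apply]; rfl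

theorem apply_sharp_swap (a b : Module.Dual ℝ V) : a (sharp β b) = -b (sharp β a) := by
  rw [← hβ.sharp_apply a, ← hβ.sharp_apply b, hβ.swap]

end IsLinearSymplectic

/-- A family of vectors `f` and a family of covectors `c` with `v = ∑ cᵢ(v) fᵢ` for all `v`. -/
def IsCoordFrame {ι : Type*} [Fintype ι] (f : ι → V) (c : ι → Module.Dual ℝ V) : Prop :=
  ∀ v, ∑ i, c i v • f i = v

theorem Module.Basis.isCoordFrame {ι : Type*} [Fintype ι] (b : Module.Basis ι ℝ V) :
    IsCoordFrame b b.coord := fun v => by simp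

namespace IsCoordFrame

variable {ι κ : Type*} [Fintype ι] [Fintype κ] {f : ι → V} {c : ι → Module.Dual ℝ V}
  {g : κ → V} {d : κ → Module.Dual ℝ V}

theorem sum_dual (h : IsCoordFrame f c) (a : Module.Dual ℝ V) : ∑ i, a (f i) • c i = a := by
  ext v
  conv_rhs => rw [← h v]
  simp [mul_comm]

/-- The canonical element `∑ fᵢ ⊗ cᵢ` of `V ⊗ V*` does not depend on the frame. -/
theorem sum_eq (h : IsCoordFrame f c) (h' : IsCoordFrame g d)
    {W : Type*} [AddCommGroup W] [Module ℝ W] (G : V →ₗ[ℝ] Module.Dual ℝ V →ₗ[ℝ] W) :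
    ∑ i, G (f i) (c i) = ∑ j, G (g j) (d j) := by
  calc ∑ i, G (f i) (c i) = ∑ i, ∑ j, d j (f i) • G (g j) (c i) := by
        refine Finset.sum_congr rfl fun i _ => ?_
        conv_lhs => rw [← h' (f i)]
        simp
    _ = ∑ j, G (g j) (∑ i, d j (f i) • c i) := by
        rw [Finset.sum_comm]; simp
    _ = _ := by simp_rw [h.sum_dual]

/-- The trace of an endomorphism, computed in a frame. -/
theorem sum_apply_eq (h : IsCoordFrame f c) (h' : IsCoordFrame g d) (T : V →ₗ[ℝ] V) :
    ∑ i, c i (T (f i)) = ∑ j, d j (T (g j)) :=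
  h.sum_eq h' (LinearMap.flip (LinearMap.lcomp ℝ ℝ T))

end IsCoordFrame

namespace IsLinearSymplectic

variable {β : V → V → ℝ} (hβ : IsLinearSymplectic β) [Module.Finite ℝ V]
  {ι κ : Type*} [Fintype ι] [Fintype κ] {f : ι → V} {c : ι → Module.Dual ℝ V}
  {g : κ → V} {d : κ → Module.Dual ℝ V}
include hβ

/-- The Poisson bivector `∑ fᵢ ⊗ cᵢ^♯` does not depend on the frame. -/
theorem sum_sharp_eq (h : IsCoordFrame f c) (h' : IsCoordFrame g d)
    {W : Type*} [AddCommGroup W] [Module ℝ W] (G : V →ₗ[ℝ] V →ₗ[ℝ] W) :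
    ∑ i, G (f i) (sharp β (c i)) = ∑ j, G (g j) (sharp β (d j)) :=
  h.sum_eq h' (G.compl₂ hβ.sharpMap)

omit hβ [Module.Finite ℝ V] in
theorem sharp_eq_sum (h : IsCoordFrame f c) (a : Module.Dual ℝ V) :
    sharp β a = ∑ j, poissonTensor β a (c j) • f j := (h _).symm

/-- The Poisson bivector `∑ fᵢ ⊗ cᵢ^♯` is antisymmetric. -/
theorem sum_sharp_swap (h : IsCoordFrame f c)
    {W : Type*} [AddCommGroup W] [Module ℝ W] (G : V →ₗ[ℝ] V →ₗ[ℝ] W) :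
    ∑ i, G (sharp β (c i)) (f i) = -∑ i, G (f i) (sharp β (c i)) := by
  simp_rw [sharp_eq_sum h (c _)]
  simp only [map_sum, LinearMap.sum_apply, map_smul, LinearMap.smul_apply]
  rw [Finset.sum_comm, ← Finset.sum_neg_distrib]
  refine Finset.sum_congr rfl fun i _ => ?_
  rw [← Finset.sum_neg_distrib]
  refine Finset.sum_congr rfl fun j _ => ?_
  rw [poissonTensor, poissonTensor, hβ.apply_sharp_swap, neg_smul]

theorem crossPairing_one_eq (h : IsCoordFrame f c) (a b : V →ₗ[ℝ] ℂ) :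
    crossPairing β 1 (fun w => a (w 0)) (fun w => b (w 0)) =
      ∑ i, a (f i) * b (sharp β (c i)) := by
  have key := hβ.sum_sharp_eq (Module.finBasis ℝ V).isCoordFrame h
    ((LinearMap.mul ℝ ℂ).compl₁₂ a b)
  simp only [LinearMap.compl₁₂_apply, LinearMap.mul_apply'] at key
  rw [← key]
  simp only [crossPairing]
  rw [← (Equiv.funUnique (Fin 1) _).symm.sum_comp]
  refine Finset.sum_congr rfl fun i _ => ?_
  rw [← (Equiv.funUnique (Fin 1) _).symm.sum_comp,
    sharp_eq_sum (Module.finBasis ℝ V).isCoordFrame, map_sum, Finset.mul_sum]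
  refine Finset.sum_congr rfl fun j _ => ?_
  simp [Complex.real_smul]
  ring

omit hβ in
/-- In the basis of its definition, the contraction does not need `β` to be symplectic. -/
theorem crossPairing_two_finBasis (A B : V →ₗ[ℝ] V →ₗ[ℝ] ℂ) :
    crossPairing β 2 (fun w => A (w 0) (w 1)) (fun w => B (w 0) (w 1)) =
      ∑ i, ∑ k, A (Module.finBasis ℝ V i) (Module.finBasis ℝ V k) *
        B (sharp β ((Module.finBasis ℝ V).coord i)) (sharp β ((Module.finBasis ℝ V).coord k)) := by
  simp only [crossPairing]
  rw [← (finTwoArrowEquiv _).symm.sum_comp, Fintype.sum_prod_type]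
  refine Finset.sum_congr rfl fun i _ => Finset.sum_congr rfl fun k _ => ?_
  rw [← (finTwoArrowEquiv _).symm.sum_comp, Fintype.sum_prod_type,
    sharp_eq_sum (Module.finBasis ℝ V).isCoordFrame ((Module.finBasis ℝ V).coord i),
    sharp_eq_sum (Module.finBasis ℝ V).isCoordFrame ((Module.finBasis ℝ V).coord k)]
  simp only [map_sum, LinearMap.sum_apply, map_smul, LinearMap.smul_apply, Finset.mul_sum]
  rw [Finset.sum_comm]
  refine Finset.sum_congr rfl fun l _ => ?_
  rw [Finset.smul_sum, Finset.mul_sum]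
  refine Finset.sum_congr rfl fun j _ => ?_
  simp [Complex.real_smul, Fin.prod_univ_two]
  ring

theorem crossPairing_two_eq (h : IsCoordFrame f c) (A B : V →ₗ[ℝ] V →ₗ[ℝ] ℂ) :
    crossPairing β 2 (fun w => A (w 0) (w 1)) (fun w => B (w 0) (w 1)) =
      ∑ i, ∑ k, A (f i) (f k) * B (sharp β (c i)) (sharp β (c k)) := by
  have he := (Module.finBasis ℝ V).isCoordFrame
  have h1 (v w : V) := hβ.sum_sharp_eq he h ((LinearMap.mul ℝ ℂ).compl₁₂ (A v) (B w))
  have h2 (v w : V) := hβ.sum_sharp_eq he h ((LinearMap.mul ℝ ℂ).compl₁₂ (A.flip v) (B.flip w))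
  simp only [LinearMap.compl₁₂_apply, LinearMap.mul_apply', LinearMap.flip_apply] at h1 h2
  rw [crossPairing_two_finBasis]
  simp_rw [h1]
  rw [Finset.sum_comm]
  simp_rw [h2]
  rw [Finset.sum_comm]

/-- The pairing with `T^♯` for `T(v, w) = β(v, ρ w)`; the sign comes from exchanging the two
factors of the antisymmetric bivector. -/
theorem sharpPairing_eq (h : IsCoordFrame f c) {T : V → V → ℝ} (ρ : V →ₗ[ℝ] V)
    (hT : ∀ v w, T v w = β v (ρ w)) (a b : V →ₗ[ℝ] ℂ) :
    sharpPairing β T a b = -∑ i, a (ρ (f i)) * b (sharp β (c i)) := by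
  have he := (Module.finBasis ℝ V).isCoordFrame
  have key := hβ.sum_sharp_eq he h ((LinearMap.mul ℝ ℂ).compl₁₂ (a ∘ₗ ρ) b)
  have key' := hβ.sum_sharp_swap he ((LinearMap.mul ℝ ℂ).compl₁₂ (a ∘ₗ ρ) b)
  simp only [LinearMap.compl₁₂_apply, LinearMap.mul_apply', LinearMap.comp_apply] at key key'
  rw [← key, ← key']
  simp only [sharpPairing]
  rw [Finset.sum_comm]
  refine Finset.sum_congr rfl fun j _ => ?_
  rw [← Finset.sum_mul]
  congr 1
  conv_rhs => rw [← he (ρ (sharp β ((Module.finBasis ℝ V).coord j)))]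
  rw [map_sum]
  refine Finset.sum_congr rfl fun i _ => ?_
  rw [hT, hβ.sharp_apply, map_smul, Complex.real_smul]

/-- For symmetric `T(v, w) = β(v, ρ w)`, the endomorphism `ρ` can be moved to the other argument of
the pairing, at the cost of a sign. -/
theorem sharpPairing_eq_of_symm (h : IsCoordFrame f c) {T : V → V → ℝ} (ρ : V →ₗ[ℝ] V)
    (hT : ∀ v w, T v w = β v (ρ w)) (hsymm : ∀ v w, T v w = T w v) (a b : V →ₗ[ℝ] ℂ) :
    sharpPairing β T a b = ∑ i, a (f i) * b (ρ (sharp β (c i))) := by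
  have he := (Module.finBasis ℝ V).isCoordFrame
  have key := hβ.sum_sharp_eq he h ((LinearMap.mul ℝ ℂ).compl₁₂ a (b ∘ₗ ρ))
  simp only [LinearMap.compl₁₂_apply, LinearMap.mul_apply', LinearMap.comp_apply] at key
  rw [← key]
  simp only [sharpPairing]
  refine Finset.sum_congr rfl fun i _ => ?_
  conv_rhs => rw [← he (ρ (sharp β ((Module.finBasis ℝ V).coord i)))]
  rw [map_sum, Finset.mul_sum]
  refine Finset.sum_congr rfl fun j _ => ?_
  rw [hsymm, hT, hβ.sharp_apply, map_smul, Complex.real_smul]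
  ring

end IsLinearSymplectic

end SymplecticLinearAlgebra

/-! ### Tangent spaces of the contact manifold and of the symplectization -/

section ContactGeometry

variable {n : ℕ}
  {M : Type*} [TopologicalSpace M] [ChartedSpace (EuclideanSpace ℝ (Fin (2 * n))) M]
  [IsManifold (𝓡 (2 * n)) ∞ M]
  {S : Type*} [TopologicalSpace S] [ChartedSpace (EuclideanSpace ℝ (Fin (2 * n + 1))) S]
  [IsManifold (𝓡 (2 * n + 1)) ∞ S]
  {Ω : ∀ x : M, TangentSpace (𝓡 (2 * n)) x →L[ℝ] TangentSpace (𝓡 (2 * n)) x →L[ℝ] ℝ}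
  {π : S → M}
  {α : ∀ q : S, TangentSpace (𝓡 (2 * n + 1)) q →L[ℝ] ℝ}

theorem IsSymplecticForm.isLinearSymplectic {E : Type*} [NormedAddCommGroup E] [NormedSpace ℝ E]
    {H : Type*} [TopologicalSpace H] {I : ModelWithCorners ℝ E H}
    {N : Type*} [TopologicalSpace N] [ChartedSpace H N] [IsManifold I ∞ N]
    {Ω : ∀ x : N, TangentSpace I x →L[ℝ] TangentSpace I x →L[ℝ] ℝ}
    (hΩ : IsSymplecticForm I Ω) (x : N) : IsLinearSymplectic (fun v w => Ω x v w) where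
  bilin := ⟨by simp, by simp, by simp, by simp⟩
  alt := hΩ.alternating x
  nondeg := hΩ.nondegenerate x

namespace IsContactReduction

variable (hπ : IsContactReduction Ω π α)
include hπ

/-- A vector of `ker Tπ ∩ ker α` lies in the kernel of `dα = π^*Ω`, hence vanishes by the contact
condition. -/
theorem eq_zero (q : S) {v : TangentSpace (𝓡 (2 * n + 1)) q}
    (h : mfderiv (𝓡 (2 * n + 1)) (𝓡 (2 * n)) π q v = 0) (h' : α q v = 0) : v = 0 :=
  hπ.contact_nondegenerate q v h' fun w _ => by rw [hπ.pullback_eq, h]; simp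

theorem eq_of_forall (q : S) {v w : TangentSpace (𝓡 (2 * n + 1)) q}
    (h : mfderiv (𝓡 (2 * n + 1)) (𝓡 (2 * n)) π q v = mfderiv (𝓡 (2 * n + 1)) (𝓡 (2 * n)) π q w)
    (h' : α q v = α q w) : v = w :=
  sub_eq_zero.1 <| hπ.eq_zero q (by rw [map_sub, h, sub_self]) (by rw [map_sub, h', sub_self])

/-- The kernel of `Tπ` is a line by a count of dimensions, and `α` does not vanish on it. -/
theorem exists_vertical (q : S) : ∃ z : TangentSpace (𝓡 (2 * n + 1)) q,
    mfderiv (𝓡 (2 * n + 1)) (𝓡 (2 * n)) π q z = 0 ∧ α q z = 1 := by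
  have hlt : Module.finrank ℝ (TangentSpace (𝓡 (2 * n)) (π q)) <
      Module.finrank ℝ (TangentSpace (𝓡 (2 * n + 1)) q) := by
    change Module.finrank ℝ (EuclideanSpace ℝ (Fin (2 * n))) <
      Module.finrank ℝ (EuclideanSpace ℝ (Fin (2 * n + 1)))
    simp
  have hker := LinearMap.ker_ne_bot_of_finrank_lt
    (f := (mfderiv (𝓡 (2 * n + 1)) (𝓡 (2 * n)) π q).toLinearMap) hlt
  obtain ⟨z, hz, hz0⟩ := (Submodule.ne_bot_iff _).1 hker
  have hz' : mfderiv (𝓡 (2 * n + 1)) (𝓡 (2 * n)) π q z = 0 := hz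
  have hα : α q z ≠ 0 := fun h => hz0 (hπ.eq_zero q hz' h)
  exact ⟨(α q z)⁻¹ • z, by rw [map_smul, hz', smul_zero], by
    rw [map_smul, smul_eq_mul, inv_mul_cancel₀ hα]⟩

variable (hΩ : IsSymplecticForm (𝓡 (2 * n)) Ω)

theorem reebField_spec (q : S) :
    α q (reebField α q) = 1 ∧
      ∀ w, extDerivOne (𝓡 (2 * n + 1)) α q (reebField α q) w = 0 := by
  obtain ⟨z, hz, hz'⟩ := hπ.exists_vertical q
  exact Classical.epsilon_spec
    (p := fun z => α q z = 1 ∧ ∀ w, extDerivOne (𝓡 (2 * n + 1)) α q z w = 0)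
    ⟨z, hz', fun w => by rw [hπ.pullback_eq, hz]; simp⟩

theorem contact_reebField (q : S) : α q (reebField α q) = 1 := (hπ.reebField_spec q).1

include hΩ in
theorem mfderiv_reebField (q : S) :
    mfderiv (𝓡 (2 * n + 1)) (𝓡 (2 * n)) π q (reebField α q) = 0 := by
  refine hΩ.nondegenerate _ _ fun w => ?_
  obtain ⟨w, rfl⟩ := hπ.submersion q w
  rw [← hπ.pullback_eq]
  exact (hπ.reebField_spec q).2 w

include hΩ in
theorem horizontalLiftS_spec (q : S) (x : TangentSpace (𝓡 (2 * n)) (π q)) :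
    mfderiv (𝓡 (2 * n + 1)) (𝓡 (2 * n)) π q (horizontalLiftS π α q x) = x ∧
      α q (horizontalLiftS π α q x) = 0 := by
  refine Classical.epsilon_spec
    (p := fun w => mfderiv (𝓡 (2 * n + 1)) (𝓡 (2 * n)) π q w = x ∧ α q w = 0) ?_
  obtain ⟨w, rfl⟩ := hπ.submersion q x
  refine ⟨w - α q w • reebField α q, ?_, ?_⟩
  · rw [map_sub, map_smul, hπ.mfderiv_reebField hΩ, smul_zero, sub_zero]
  · rw [map_sub, map_smul, hπ.contact_reebField, smul_eq_mul, mul_one, sub_self]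

end IsContactReduction

/-! ### The tangent maps of the projections of the symplectization -/

theorem tangentPrOne_add (p : S × ℝ) (v w : TangentSpace (modelP n) p) :
    tangentPrOne p (v + w) = tangentPrOne p v + tangentPrOne p w := map_add _ _ _

theorem tangentPrOne_smul (p : S × ℝ) (r : ℝ) (v : TangentSpace (modelP n) p) :
    tangentPrOne p (r • v) = r • tangentPrOne p v := map_smul _ _ _

theorem tangentPrOne_neg (p : S × ℝ) (v : TangentSpace (modelP n) p) :
    tangentPrOne p (-v) = -tangentPrOne p v := map_neg _ _

theorem ds_add (p : S × ℝ) (v w : TangentSpace (modelP n) p) :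
    ds p (v + w) = ds p v + ds p w := map_add _ _ _

theorem ds_smul (p : S × ℝ) (r : ℝ) (v : TangentSpace (modelP n) p) :
    ds p (r • v) = r * ds p v := map_smul _ _ _

theorem ds_neg (p : S × ℝ) (v : TangentSpace (modelP n) p) :
    ds p (-v) = -ds p v := map_neg _ _

theorem tangentPrOne_eq (p : S × ℝ) (v : TangentSpace (modelP n) p) :
    tangentPrOne p v = (v : EuclideanSpace ℝ (Fin (2 * n + 1)) × ℝ).1 := by
  rw [tangentPrOne, mfderiv_fst]; rfl

theorem ds_eq (p : S × ℝ) (v : TangentSpace (modelP n) p) :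
    ds p v = (v : EuclideanSpace ℝ (Fin (2 * n + 1)) × ℝ).2 := by
  rw [ds, mvfderiv, mfderiv_snd]; rfl

theorem liftToP_eq (p : S × ℝ) (v : TangentSpace (𝓡 (2 * n + 1)) p.1) :
    liftToP p v = ((v, 0) : EuclideanSpace ℝ (Fin (2 * n + 1)) × ℝ) := by
  rw [liftToP, mfderiv_prod_left]; rfl

theorem fieldS_eq (p : S × ℝ) :
    fieldS (n := n) p = ((0, 1) : EuclideanSpace ℝ (Fin (2 * n + 1)) × ℝ) := by
  rw [fieldS, mfderiv_prod_right]; rfl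

theorem tangentPrOne_liftToP (p : S × ℝ) (v : TangentSpace (𝓡 (2 * n + 1)) p.1) :
    tangentPrOne p (liftToP p v) = v := by rw [tangentPrOne_eq, liftToP_eq]

theorem ds_liftToP (p : S × ℝ) (v : TangentSpace (𝓡 (2 * n + 1)) p.1) :
    ds p (liftToP p v) = 0 := by rw [ds_eq, liftToP_eq]

theorem tangentPrOne_fieldS (p : S × ℝ) : tangentPrOne p (fieldS (n := n) p) = 0 := by
  rw [tangentPrOne_eq, fieldS_eq]; rfl

theorem ds_fieldS (p : S × ℝ) : ds p (fieldS (n := n) p) = 1 := by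
  rw [ds_eq, fieldS_eq]

theorem tangentP_ext (p : S × ℝ) {v w : TangentSpace (modelP n) p}
    (h : tangentPrOne p v = tangentPrOne p w) (h' : ds p v = ds p w) : v = w := by
  rw [tangentPrOne_eq, tangentPrOne_eq] at h
  rw [ds_eq, ds_eq] at h'
  exact Prod.ext h h'

theorem IsContactReduction.tangentPr_eq (hπ : IsContactReduction Ω π α) (p : S × ℝ)
    (v : TangentSpace (modelP n) p) :
    tangentPr π p v = mfderiv (𝓡 (2 * n + 1)) (𝓡 (2 * n)) π p.1 (tangentPrOne p v) := by
  have h1 : MDifferentiableAt (𝓡 (2 * n + 1)) (𝓡 (2 * n)) π p.1 :=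
    (hπ.smooth_proj p.1).mdifferentiableAt (by simp)
  exact mfderiv_comp_apply (I := modelP n) (I' := 𝓡 (2 * n + 1)) (I'' := 𝓡 (2 * n)) p
    (g := π) (f := (Prod.fst : S × ℝ → S)) h1 mdifferentiableAt_fst v

theorem tangentPr_add (p : S × ℝ) (v w : TangentSpace (modelP n) p) :
    tangentPr π p (v + w) = tangentPr π p v + tangentPr π p w := map_add _ _ _

theorem tangentPr_smul (p : S × ℝ) (r : ℝ) (v : TangentSpace (modelP n) p) :
    tangentPr π p (r • v) = r • tangentPr π p v := map_smul _ _ _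

theorem coeffXH_add (p : S × ℝ) (v w : TangentSpace (modelP n) p) :
    coeffXH α p (v + w) = coeffXH α p v + coeffXH α p w := by
  rw [coeffXH, tangentPrOne_add, map_add, coeffXH, coeffXH, neg_add]

theorem coeffXH_smul (p : S × ℝ) (r : ℝ) (v : TangentSpace (modelP n) p) :
    coeffXH α p (r • v) = r * coeffXH α p v := by
  rw [coeffXH, tangentPrOne_smul, map_smul, coeffXH, smul_eq_mul, mul_neg]

variable (π α) in
/-- The tangent map of `pr : P → M` as a linear map. -/
def tangentPrMap (p : S × ℝ) :
    TangentSpace (modelP n) p →ₗ[ℝ] TangentSpace (𝓡 (2 * n)) (π p.1) where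
  toFun := tangentPr π p
  map_add' := tangentPr_add p
  map_smul' := tangentPr_smul p

variable (n) in
/-- The covector `ds`. -/
def dsMap (p : S × ℝ) : Module.Dual ℝ (TangentSpace (modelP n) p) where
  toFun := ds p
  map_add' := ds_add p
  map_smul' := ds_smul p

variable (α) in
/-- The covector `-pr₁^*α`. -/
def coeffXHMap (p : S × ℝ) : Module.Dual ℝ (TangentSpace (modelP n) p) where
  toFun := coeffXH α p
  map_add' := coeffXH_add p
  map_smul' := coeffXH_smul p

namespace IsContactReduction

variable (hπ : IsContactReduction Ω π α) (hΩ : IsSymplecticForm (𝓡 (2 * n)) Ω)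
include hπ hΩ

theorem tangentPr_horizontalLift (p : S × ℝ) (x : TangentSpace (𝓡 (2 * n)) (π p.1)) :
    tangentPr π p (horizontalLift π α p x) = x := by
  rw [hπ.tangentPr_eq, horizontalLift, tangentPrOne_liftToP, (hπ.horizontalLiftS_spec hΩ _ _).1]

omit hπ hΩ in
theorem ds_horizontalLift (p : S × ℝ) (x : TangentSpace (𝓡 (2 * n)) (π p.1)) :
    ds p (horizontalLift π α p x) = 0 := ds_liftToP _ _

theorem coeffXH_horizontalLift (p : S × ℝ) (x : TangentSpace (𝓡 (2 * n)) (π p.1)) :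
    coeffXH α p (horizontalLift π α p x) = 0 := by
  rw [coeffXH, horizontalLift, tangentPrOne_liftToP, (hπ.horizontalLiftS_spec hΩ _ _).2, neg_zero]

omit hΩ in
theorem tangentPr_fieldS (p : S × ℝ) : tangentPr π p (fieldS (n := n) p) = 0 := by
  rw [hπ.tangentPr_eq, tangentPrOne_fieldS, map_zero]

omit hπ hΩ in
theorem coeffXH_fieldS (p : S × ℝ) : coeffXH α p (fieldS (n := n) p) = 0 := by
  rw [coeffXH, tangentPrOne_fieldS, map_zero, neg_zero]

theorem tangentPr_fieldXH (p : S × ℝ) : tangentPr π p (fieldXH α p) = 0 := by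
  rw [hπ.tangentPr_eq, fieldXH, tangentPrOne_neg, tangentPrOne_liftToP, map_neg,
    hπ.mfderiv_reebField hΩ, neg_zero]

omit hπ hΩ in
theorem ds_fieldXH (p : S × ℝ) : ds p (fieldXH α p) = 0 := by
  rw [fieldXH, ds_neg, ds_liftToP, neg_zero]

omit hΩ in
theorem coeffXH_fieldXH (p : S × ℝ) : coeffXH α p (fieldXH α p) = 1 := by
  rw [coeffXH, fieldXH, tangentPrOne_neg, tangentPrOne_liftToP, map_neg, neg_neg,
    hπ.contact_reebField]

omit hΩ in
theorem tangentP_ext (p : S × ℝ) {v w : TangentSpace (modelP n) p}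
    (h : tangentPr π p v = tangentPr π p w) (h' : ds p v = ds p w)
    (h'' : coeffXH α p v = coeffXH α p w) : v = w := by
  refine _root_.tangentP_ext p (hπ.eq_of_forall p.1 ?_ (neg_injective h'')) h'
  rw [← hπ.tangentPr_eq, ← hπ.tangentPr_eq, h]

omit hΩ in
theorem muForm_eq (p : S × ℝ) (v w : TangentSpace (modelP n) p) :
    muForm α p v w = Real.exp p.2 * (coeffXH α p v * ds p w - ds p v * coeffXH α p w
      + Ω (π p.1) (tangentPr π p v) (tangentPr π p w)) := by
  rw [muForm, hπ.pullback_eq, ← hπ.tangentPr_eq, ← hπ.tangentPr_eq, coeffXH, coeffXH]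
  ring

/-- `μ` is nondegenerate: it is the orthogonal sum of `e^s pr^*Ω` on the horizontal vectors and of
a symplectic form on the plane spanned by `S` and `X_H`. -/
theorem isLinearSymplectic_muForm (p : S × ℝ) :
    IsLinearSymplectic (fun v w : TangentSpace (modelP n) p => muForm α p v w) where
  bilin := by
    constructor <;> intros <;>
      simp only [hπ.muForm_eq, tangentPr_add, tangentPr_smul, ds_add, ds_smul, coeffXH_add,
        coeffXH_smul, map_add, map_smul, add_apply,
        smul_apply, smul_eq_mul] <;> ring
  alt v := by rw [hπ.muForm_eq, hΩ.alternating]; ring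
  nondeg v hv := by
    have he := (Real.exp_pos p.2).ne'
    have h1 := hv (fieldS p)
    have h2 := hv (fieldXH α p)
    rw [hπ.muForm_eq, ds_fieldS, coeffXH_fieldS, hπ.tangentPr_fieldS] at h1
    rw [hπ.muForm_eq, ds_fieldXH, hπ.coeffXH_fieldXH, hπ.tangentPr_fieldXH hΩ] at h2
    have hx : tangentPr π p v = 0 := hΩ.nondegenerate _ _ fun w => by
      have h3 := hv (horizontalLift π α p w)
      rw [hπ.muForm_eq, ds_horizontalLift, hπ.coeffXH_horizontalLift hΩ,
        hπ.tangentPr_horizontalLift hΩ] at h3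
      simpa [he] using h3
    refine hπ.tangentP_ext p ?_ ?_ ?_
    · rw [hx]; exact (map_zero (tangentPrMap π p)).symm
    · rw [show ds p (0 : TangentSpace (modelP n) p) = 0 from map_zero (dsMap n p)]
      simpa [he] using h2
    · rw [show coeffXH α p (0 : TangentSpace (modelP n) p) = 0 from map_zero (coeffXHMap α p)]
      simpa [he] using h1

omit hπ hΩ in
variable (π α) in
/-- The frame of `T_pP` consisting of the horizontal lifts of a frame of `TM`, of `S` and of
`X_H`. -/
def frameP (p : S × ℝ) {ι : Type*} (f : ι → TangentSpace (𝓡 (2 * n)) (π p.1)) :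
    ι ⊕ Fin 2 → TangentSpace (modelP n) p :=
  Sum.elim (fun i => horizontalLift π α p (f i)) ![fieldS p, fieldXH α p]

omit hπ hΩ in
variable (α) in
/-- The coordinates in the frame `frameP`. -/
def coframeP (p : S × ℝ) {ι : Type*}
    (c : ι → Module.Dual ℝ (TangentSpace (𝓡 (2 * n)) (π p.1))) :
    ι ⊕ Fin 2 → Module.Dual ℝ (TangentSpace (modelP n) p) :=
  Sum.elim (fun i => c i ∘ₗ tangentPrMap π p) ![dsMap n p, coeffXHMap α p]

variable {ι : Type*} [Fintype ι]

theorem isCoordFrame_frameP (p : S × ℝ) {f : ι → TangentSpace (𝓡 (2 * n)) (π p.1)}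
    {c : ι → Module.Dual ℝ (TangentSpace (𝓡 (2 * n)) (π p.1))} (h : IsCoordFrame f c) :
    IsCoordFrame (frameP π α p f) (coframeP α p c) := by
  intro v
  simp only [frameP, coframeP, Fintype.sum_sum_type, Sum.elim_inl, Sum.elim_inr,
    Fin.sum_univ_two, Matrix.cons_val_zero, Matrix.cons_val_one]
  have e1 (w : TangentSpace (modelP n) p) : dsMap n p w = ds p w := rfl
  have e2 (w : TangentSpace (modelP n) p) : coeffXHMap α p w = coeffXH α p w := rfl
  have e3 (w : TangentSpace (modelP n) p) : tangentPrMap π p w = tangentPr π p w := rfl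
  refine hπ.tangentP_ext p ?_ ?_ ?_
  · simp only [← e3, map_add, map_sum, map_smul]
    simp only [e3, hπ.tangentPr_horizontalLift hΩ, hπ.tangentPr_fieldS, hπ.tangentPr_fieldXH hΩ,
      smul_zero, add_zero, LinearMap.comp_apply]
    exact h _
  · simp only [← e1, map_add, map_sum, map_smul]
    simp [e1, ds_horizontalLift, ds_fieldS, ds_fieldXH]
  · simp only [← e2, map_add, map_sum, map_smul]
    simp [e2, hπ.coeffXH_horizontalLift hΩ, coeffXH_fieldS, hπ.coeffXH_fieldXH]

theorem sharp_comp_tangentPr (p : S × ℝ)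
    (a : Module.Dual ℝ (TangentSpace (𝓡 (2 * n)) (π p.1))) :
    sharp (fun v w => muForm α p v w) (a ∘ₗ tangentPrMap π p) =
      Real.exp (-p.2) • horizontalLift π α p (sharp (fun v w => Ω (π p.1) v w) a) := by
  refine (hπ.isLinearSymplectic_muForm hΩ p).sharp_eq fun w => ?_
  have e3 (w : TangentSpace (modelP n) p) : tangentPrMap π p w = tangentPr π p w := rfl
  rw [hπ.muForm_eq, coeffXH_smul, ds_smul, tangentPr_smul, ds_horizontalLift,
    hπ.coeffXH_horizontalLift hΩ, hπ.tangentPr_horizontalLift hΩ, map_smul,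
    smul_apply, (hΩ.isLinearSymplectic _).sharp_apply, LinearMap.comp_apply, e3,
    Real.exp_neg, smul_eq_mul]
  field_simp [(Real.exp_pos p.2).ne']
  ring

/-- The Hamiltonian vector field of the function `s` is `e^{-s} X_H`. -/
theorem sharp_ds (p : S × ℝ) :
    sharp (fun v w => muForm α p v w) (dsMap n p) = Real.exp (-p.2) • fieldXH α p := by
  refine (hπ.isLinearSymplectic_muForm hΩ p).sharp_eq fun w => ?_
  rw [hπ.muForm_eq, coeffXH_smul, ds_smul, tangentPr_smul, ds_fieldXH,
    hπ.coeffXH_fieldXH, hπ.tangentPr_fieldXH hΩ, Real.exp_neg]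
  change _ = ds p w
  simp

theorem sharp_coeffXH (p : S × ℝ) :
    sharp (fun v w => muForm α p v w) (coeffXHMap α p) = -(Real.exp (-p.2) • fieldS p) := by
  refine (hπ.isLinearSymplectic_muForm hΩ p).sharp_eq fun w => ?_
  rw [← neg_smul, hπ.muForm_eq, coeffXH_smul, ds_smul, tangentPr_smul, ds_fieldS,
    coeffXH_fieldS, hπ.tangentPr_fieldS, Real.exp_neg]
  change _ = coeffXH α p w
  simp

end IsContactReduction

end ContactGeometry

/-! ### Hessians and the cochains of low order -/

section Hessian

variable {E : Type*} [NormedAddCommGroup E] [NormedSpace ℝ E]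
  {H : Type*} [TopologicalSpace H] {I : ModelWithCorners ℝ E H}
  {N : Type*} [TopologicalSpace N] [ChartedSpace H N] [IsManifold I ∞ N]

/-- The derivative of a smooth function along a smooth vector field is smooth. -/
theorem contMDiffAt_mvfderiv_apply {F : Type*} [NormedAddCommGroup F] [NormedSpace ℝ F]
    {f : N → F} (hf : ContMDiff I 𝓘(ℝ, F) ∞ f)
    {X : ∀ y : N, TangentSpace I y} {x : N}
    (hX : ContMDiffAt I I.tangent ∞ (fun y => Bundle.TotalSpace.mk' E y (X y)) x) :
    ContMDiffAt I 𝓘(ℝ, F) ∞ (fun y => mvfderiv I f y (X y)) x := by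
  have h1 : ContMDiff I.tangent 𝓘(ℝ, F).tangent ∞ (tangentMap I 𝓘(ℝ, F) f) :=
    hf.contMDiff_tangentMap (by simp)
  have h2 := (contMDiff_snd_tangentBundle_modelSpace F 𝓘(ℝ, F) (n := ∞)).contMDiffAt.comp x
    (h1.contMDiffAt.comp x hX)
  exact h2

theorem mdifferentiableAt_mvfderiv_apply {F : Type*} [NormedAddCommGroup F] [NormedSpace ℝ F]
    {f : N → F} (hf : ContMDiff I 𝓘(ℝ, F) ∞ f)
    {X : ∀ y : N, TangentSpace I y} {x : N}
    (hX : MDifferentiableAt I I.tangent (fun y => Bundle.TotalSpace.mk' E y (X y)) x) :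
    MDifferentiableAt I 𝓘(ℝ, F) (fun y => mvfderiv I f y (X y)) x := by
  have h1 : ContMDiff I.tangent 𝓘(ℝ, F).tangent ∞ (tangentMap I 𝓘(ℝ, F) f) :=
    hf.contMDiff_tangentMap (by simp)
  have h2 := ((contMDiff_snd_tangentBundle_modelSpace F 𝓘(ℝ, F) (n := ∞)).mdifferentiable
    (by simp) _).comp x (((h1.mdifferentiable (by simp)) _).comp x hX)
  exact h2

/-- The second covariant derivative of a function, before symmetrization. -/
def hess (D : (∀ x : N, TangentSpace I x) → ∀ x : N, TangentSpace I x → TangentSpace I x)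
    (f : N → ℂ) (x : N) (v w : TangentSpace I x) : ℂ :=
  mvfderiv I (fun y => mvfderiv I f y (FiberBundle.extend E w y)) x v
    - mvfderiv I f x (D (FiberBundle.extend E w) x v)

variable {D : (∀ x : N, TangentSpace I x) → ∀ x : N, TangentSpace I x → TangentSpace I x}

theorem symDPow_one (f : N → ℂ) (x : N) (w : Fin 1 → TangentSpace I x) :
    symDPow D f 1 x w = mvfderiv I f x (w 0) := by
  simp [symDPow, symD, covDerivTensor]

theorem symDPow_two (f : N → ℂ) (x : N) (w : Fin 2 → TangentSpace I x) :
    symDPow D f 2 x w = hess D f x (w 0) (w 1) + hess D f x (w 1) (w 0) := by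
  have h (f : N → ℂ) : symDPow D f 1 = fun x w => mvfderiv I f x (w 0) := by
    ext x w; exact symDPow_one f x w
  rw [symDPow, h]
  simp [symD, covDerivTensor, hess]
  ring

theorem symDPow_zero_fun (r : ℕ) (x : N) (w : Fin r → TangentSpace I x) :
    symDPow D (0 : N → ℂ) r x w = 0 := by
  induction r generalizing x with
  | zero => rfl
  | succ r ih =>
    have h : symDPow D (0 : N → ℂ) r = fun x w => 0 := by ext x w; exact ih x w
    rw [symDPow, h]
    simp [symD, covDerivTensor, mvfderiv_const]

variable [FiniteDimensional ℝ E] {β : ∀ x : N, TangentSpace I x → TangentSpace I x → ℝ}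

theorem weylCochain_zero (f g : N → ℂ) : weylCochain β D 0 f g = f * g := by
  ext x
  simp [weylCochain, crossPairing, symDPow]

theorem weylCochain_one (f g : N → ℂ) : weylCochain β D 1 f g = poissonBracket I β f g := by
  ext x
  simp [weylCochain, poissonBracket, symDPow_one]

theorem weylCochain_two (f g : N → ℂ) (x : N) :
    weylCochain β D 2 f g x = crossPairing (β x) 2
      (fun w => (1 / 2) * (hess D f x (w 0) (w 1) + hess D f x (w 1) (w 0)))
      (fun w => (1 / 2) * (hess D g x (w 0) (w 1) + hess D g x (w 1) (w 0))) := by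
  simp [weylCochain, symDPow_two]

theorem weylCochain_zero_left (r : ℕ) (g : N → ℂ) : weylCochain β D r 0 g = 0 := by
  ext x
  simp [weylCochain, symDPow_zero_fun, crossPairing]

theorem weylCochain_zero_right (r : ℕ) (f : N → ℂ) : weylCochain β D r f 0 = 0 := by
  ext x
  simp [weylCochain, symDPow_zero_fun, crossPairing]

/-- The Hessian depends on its second argument only through the value of the vector field at the
point. -/
theorem tensorialAt_hess (cov : CovariantDerivative I E (TangentSpace I : N → Type _))
    {f : N → ℂ} (hf : IsSmoothFun I f) (x : N) (v : TangentSpace I x) :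
    TensorialAt I E (fun X : ∀ y : N, TangentSpace I y =>
      mvfderiv I (fun y => mvfderiv I f y (X y)) x v - mvfderiv I f x (cov X x v)) x where
  smul {g X} hg hX := by
    have hd := mdifferentiableAt_mvfderiv_apply hf hX
    rw [cov.isCovariantDerivativeOnUniv.leibniz hX hg]
    simp only [Pi.smul_apply', map_smul]
    rw [mvfderiv_fun_smul hg hd]
    simp only [add_apply, smul_apply, map_add, map_smul, ContinuousLinearMap.smulRight_apply,
      smul_sub]
    ring
  add {X Y} hX hY := by
    have hd := mdifferentiableAt_mvfderiv_apply hf hX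
    have hd' := mdifferentiableAt_mvfderiv_apply hf hY
    rw [cov.isCovariantDerivativeOnUniv.add hX hY]
    simp only [Pi.add_apply, map_add]
    rw [mvfderiv_fun_add hd hd']
    simp only [add_apply, map_add]
    ring

/-- The Hessian of a smooth function is bilinear. -/
theorem isBilinearMap_hess (cov : CovariantDerivative I E (TangentSpace I : N → Type _))
    {f : N → ℂ} (hf : IsSmoothFun I f) (x : N) :
    IsBilinearMap ℝ (hess (fun Y x v => cov Y x v) f x) where
  add_left v v' w := by simp only [hess, map_add]; ring
  smul_left r v w := by simp only [hess, map_smul, smul_sub]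
  add_right v := map_add (TensorialAt.mkHom _ x (tensorialAt_hess cov hf x v))
  smul_right r v := map_smul (TensorialAt.mkHom _ x (tensorialAt_hess cov hf x v)) r

end Hessian

/-! ### Hessians of pulled back functions -/

section PullbackHessian

open Filter Topology

variable {E : Type*} [NormedAddCommGroup E] [NormedSpace ℝ E]
  {H : Type*} [TopologicalSpace H] {I : ModelWithCorners ℝ E H}
  {N : Type*} [TopologicalSpace N] [ChartedSpace H N]

theorem mvfderiv_congr {F : Type*} [NormedAddCommGroup F] [NormedSpace ℝ F] {f g : N → F} {x : N}
    (h : f =ᶠ[𝓝 x] g) : mvfderiv I f x = mvfderiv I g x := by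
  ext v
  have := h.mfderiv_eq (I := I) (I' := 𝓘(ℝ, F))
  exact congr($this v)

theorem mvfderiv_clm_comp {F F' : Type*} [NormedAddCommGroup F] [NormedSpace ℝ F]
    [NormedAddCommGroup F'] [NormedSpace ℝ F'] (L : F →L[ℝ] F') {f : N → F} {x : N}
    (hf : MDifferentiableAt I 𝓘(ℝ, F) f x) (v : TangentSpace I x) :
    mvfderiv I (fun y => L (f y)) x v = L (mvfderiv I f x v) := by
  have h := (L.hasMFDerivAt (x := f x)).comp x hf.hasMFDerivAt
  exact congr($(h.mfderiv) v)

theorem mvfderiv_comp_eq {F : Type*} [NormedAddCommGroup F] [NormedSpace ℝ F]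
    {E' : Type*} [NormedAddCommGroup E'] [NormedSpace ℝ E']
    {H' : Type*} [TopologicalSpace H'] {J : ModelWithCorners ℝ E' H'}
    {P : Type*} [TopologicalSpace P] [ChartedSpace H' P] {f : N → F} {g : P → N} {p : P}
    (hf : MDifferentiableAt I 𝓘(ℝ, F) f (g p)) (hg : MDifferentiableAt J I g p)
    (v : TangentSpace J p) :
    mvfderiv J (fun q => f (g q)) p v = mvfderiv I f (g p) (mfderiv J I g p v) :=
  mfderiv_comp_apply p hf hg v

theorem mdifferentiableAt_sum {F : Type*} [NormedAddCommGroup F] [NormedSpace ℝ F]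
    {ι : Type*} (s : Finset ι) {f : ι → N → F} {x : N}
    (hf : ∀ i ∈ s, MDifferentiableAt I 𝓘(ℝ, F) (f i) x) :
    MDifferentiableAt I 𝓘(ℝ, F) (fun y => ∑ i ∈ s, f i y) x ∧
      mvfderiv I (fun y => ∑ i ∈ s, f i y) x = ∑ i ∈ s, mvfderiv I (f i) x := by
  classical
  induction s using Finset.induction_on with
  | empty => simp [mvfderiv_const, mdifferentiableAt_const]
  | insert a s ha ih =>
    have h1 := hf a (by simp)
    have h2 := ih fun i hi => hf i (by simp [hi])
    simp only [Finset.sum_insert ha]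
    refine ⟨h1.add h2.1, ?_⟩
    rw [mvfderiv_fun_add h1 h2.1, h2.2]

variable [IsManifold I ∞ N] [FiniteDimensional ℝ E]
    {E' : Type*} [NormedAddCommGroup E'] [NormedSpace ℝ E']
    {H' : Type*} [TopologicalSpace H'] {J : ModelWithCorners ℝ E' H'}
    {P : Type*} [TopologicalSpace P] [ChartedSpace H' P]

theorem extend_eq_symmₗ {x : N} (v : TangentSpace I x) {y : N}
    (hy : y ∈ (trivializationAt E (TangentSpace I : N → Type _) x).baseSet) :
    FiberBundle.extend E v y = (trivializationAt E (TangentSpace I : N → Type _) x).symmₗ ℝ y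
      (trivializationAt E (TangentSpace I : N → Type _) x ⟨x, v⟩).2 := by
  rw [Bundle.Trivialization.symmₗ_apply _ hy]; rfl

/-- Derivative of `q ↦ du(s(q))` for a section `s` of the pullback of the tangent bundle: the
components of `s` in a local frame and the frame itself are differentiated separately. -/
theorem mvfderiv_pullback_section {u : N → ℂ} (hu : IsSmoothFun I u) {pr : P → N} {p : P}
    (s : ∀ q : P, TangentSpace I (pr q))
    (hpr : MDifferentiableAt J I pr p)
    (hs : MDifferentiableAt J I.tangent
      (fun q => Bundle.TotalSpace.mk' E (E := TangentSpace I) (pr q) (s q)) p)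
    (v : TangentSpace J p) :
    mvfderiv J (fun q => mvfderiv I u (pr q) (s q)) p v =
      mvfderiv I u (pr p) ((trivializationAt E (TangentSpace I : N → Type _) (pr p)).symm (pr p)
        (mvfderiv J (fun q => (trivializationAt E (TangentSpace I : N → Type _) (pr p)
          (Bundle.TotalSpace.mk' E (pr q) (s q))).2) p v)) +
      mvfderiv I (fun y => mvfderiv I u y (FiberBundle.extend E (s p) y)) (pr p)
        (mfderiv J I pr p v) := by
  set e := trivializationAt E (TangentSpace I : N → Type _) (pr p) with he
  have hx : pr p ∈ e.baseSet := FiberBundle.mem_baseSet_trivializationAt' (pr p)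
  let b := Module.finBasis ℝ E
  let L (i) : E →L[ℝ] ℝ := (b.coord i).toContinuousLinearMap
  let F (i) : ∀ y : N, TangentSpace I y := FiberBundle.extend E (e.symmₗ ℝ (pr p) (b i))
  let σ : P → E := fun q => (e (Bundle.TotalSpace.mk' E (pr q) (s q))).2
  have hσ : MDifferentiableAt J 𝓘(ℝ, E) σ p := ((mdifferentiableAt_totalSpace I _).1 hs).2
  have hF (i) {y : N} (hy : y ∈ e.baseSet) : F i y = e.symmₗ ℝ y (b i) := by
    rw [show F i y = _ from extend_eq_symmₗ _ hy]
    congr 1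
    rw [Bundle.Trivialization.symmₗ_apply _ hx, Bundle.Trivialization.apply_mk_symm _ hx]
  have hsum (z : E) {y : N} (hy : y ∈ e.baseSet) : e.symmₗ ℝ y z = ∑ i, L i z • F i y := by
    conv_lhs => rw [← b.sum_repr z]
    rw [map_sum]
    exact Finset.sum_congr rfl fun i _ => by rw [map_smul, hF i hy]; rfl
  have hg (i) : MDifferentiableAt I 𝓘(ℝ, ℂ) (fun y => mvfderiv I u y (F i y)) (pr p) :=
    mdifferentiableAt_mvfderiv_apply hu (FiberBundle.mdifferentiableAt_extend I E _)
  have hLσ (i) : MDifferentiableAt J 𝓘(ℝ, ℝ) (fun q => L i (σ q)) p :=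
    (L i).mdifferentiableAt.comp p hσ
  have hgp (i) : MDifferentiableAt J 𝓘(ℝ, ℂ) (fun q => mvfderiv I u (pr q) (F i (pr q))) p :=
    (hg i).comp p hpr
  -- the function `du(s)` in terms of the frame
  have h1 : (fun q => mvfderiv I u (pr q) (s q)) =ᶠ[𝓝 p]
      fun q => ∑ i, L i (σ q) • mvfderiv I u (pr q) (F i (pr q)) := by
    filter_upwards [hpr.continuousAt.preimage_mem_nhds (e.open_baseSet.mem_nhds hx)] with q hq
    have h2 : s q = e.symmₗ ℝ (pr q) (σ q) := by
      rw [Bundle.Trivialization.symmₗ_apply _ hq, Bundle.Trivialization.symm_apply_apply_mk _ hq]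
    rw [h2, hsum _ hq, map_sum]
    simp only [map_smul]
  -- the function `du` of the extension of `s p` in terms of the frame
  have h3 : (fun y => mvfderiv I u y (FiberBundle.extend E (s p) y)) =ᶠ[𝓝 (pr p)]
      fun y => ∑ i, L i (σ p) • mvfderiv I u y (F i y) := by
    filter_upwards [e.open_baseSet.mem_nhds hx] with y hy
    rw [extend_eq_symmₗ _ hy, hsum _ hy, map_sum]
    simp only [map_smul]
    rfl
  rw [mvfderiv_congr h1, mvfderiv_congr h3,
    (mdifferentiableAt_sum Finset.univ
      (f := fun i q => L i (σ q) • mvfderiv I u (pr q) (F i (pr q)))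
      fun i _ => (hLσ i).smul (hgp i)).2,
    (mdifferentiableAt_sum Finset.univ
      (f := fun i y => L i (σ p) • mvfderiv I u y (F i y))
      fun i _ => mdifferentiableAt_const.smul (hg i)).2,
    ← Bundle.Trivialization.symmₗ_apply (R := ℝ) _ hx, hsum _ hx, map_sum]
  simp only [sum_apply]
  rw [← Finset.sum_add_distrib]
  refine Finset.sum_congr rfl fun i _ => ?_
  rw [mvfderiv_fun_smul (hLσ i) (hgp i), mvfderiv_fun_smul mdifferentiableAt_const (hg i)]
  have h4 : mvfderiv J (fun q => mvfderiv I u (pr q) (F i (pr q))) p v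
      = mvfderiv I (fun y => mvfderiv I u y (F i y)) (pr p) (mfderiv J I pr p v) :=
    mvfderiv_comp_eq (hg i) hpr v
  have h5 : mvfderiv J (fun q => L i (σ q)) p v = L i (mvfderiv J σ p v) :=
    mvfderiv_clm_comp (L i) hσ v
  rw [add_apply, add_apply, smul_apply, smul_apply, ContinuousLinearMap.smulRight_apply,
    ContinuousLinearMap.smulRight_apply, mvfderiv_const, map_smul, h4, h5]
  simp only [zero_apply, zero_smul, add_zero]
  rw [add_comm]

end PullbackHessian

/-! ### The cochains of the star product on `P` for functions pulled back from `M` -/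

section CochainsOnP

variable {n : ℕ}
  {M : Type*} [TopologicalSpace M] [ChartedSpace (EuclideanSpace ℝ (Fin (2 * n))) M]
  [IsManifold (𝓡 (2 * n)) ∞ M]
  {S : Type*} [TopologicalSpace S] [ChartedSpace (EuclideanSpace ℝ (Fin (2 * n + 1))) S]
  [IsManifold (𝓡 (2 * n + 1)) ∞ S]
  {Ω : ∀ x : M, TangentSpace (𝓡 (2 * n)) x →L[ℝ] TangentSpace (𝓡 (2 * n)) x →L[ℝ] ℝ}
  {cov : CovariantDerivative (𝓡 (2 * n)) (EuclideanSpace ℝ (Fin (2 * n)))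
    (TangentSpace (𝓡 (2 * n)) : M → Type _)}
  {π : S → M}
  {α : ∀ q : S, TangentSpace (𝓡 (2 * n + 1)) q →L[ℝ] ℝ}

namespace IsContactReduction

variable (hπ : IsContactReduction Ω π α) (hΩ : IsSymplecticForm (𝓡 (2 * n)) Ω)
include hπ

theorem contMDiff_pr :
    ContMDiff (modelP n) (𝓡 (2 * n)) ∞ (fun q : S × ℝ => π q.1) :=
  hπ.smooth_proj.comp contMDiff_fst

theorem isSmoothFun_pullback {u : M → ℂ} (hu : IsSmoothFun (𝓡 (2 * n)) u) :
    IsSmoothFun (modelP n) (fun q : S × ℝ => u (π q.1)) :=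
  ContMDiff.comp hu hπ.contMDiff_pr

theorem mvfderiv_pullback {u : M → ℂ} (hu : IsSmoothFun (𝓡 (2 * n)) u) (p : S × ℝ)
    (v : TangentSpace (modelP n) p) :
    mvfderiv (modelP n) (fun q : S × ℝ => u (π q.1)) p v =
      mvfderiv (𝓡 (2 * n)) u (π p.1) (tangentPr π p v) :=
  mvfderiv_comp_eq ((hu _).mdifferentiableAt (by simp))
    (hπ.contMDiff_pr.mdifferentiableAt (by simp)) v

include hΩ

theorem tangentPr_combination (p : S × ℝ) (x : TangentSpace (𝓡 (2 * n)) (π p.1)) (a b : ℝ) :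
    tangentPr π p (horizontalLift π α p x + a • fieldS p + b • fieldXH α p) = x := by
  rw [tangentPr_add, tangentPr_add, tangentPr_smul, tangentPr_smul,
    hπ.tangentPr_horizontalLift hΩ, hπ.tangentPr_fieldS, hπ.tangentPr_fieldXH hΩ, smul_zero,
    smul_zero, add_zero, add_zero]

/-- The Hessian on `P` of a function pulled back from `M`. -/
theorem hess_connP {u : M → ℂ} (hu : IsSmoothFun (𝓡 (2 * n)) u) (p : S × ℝ)
    (v w : TangentSpace (modelP n) p) :
    hess (connP Ω cov π α) (fun q : S × ℝ => u (π q.1)) p v w =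
      hess (fun Y x v => cov Y x v) u (π p.1) (tangentPr π p v) (tangentPr π p w) -
      mvfderiv (𝓡 (2 * n)) u (π p.1)
        ((ds p v / 2) • tangentPr π p w + (ds p w / 2) • tangentPr π p v
          + coeffXH α p v • tauEndo Ω cov (π p.1) (tangentPr π p w)
          + coeffXH α p w • tauEndo Ω cov (π p.1) (tangentPr π p v)
          - (coeffXH α p w * coeffXH α p v) • vectorV Ω cov (π p.1)) := by
  let W : ∀ q : S × ℝ, TangentSpace (modelP n) q :=
    FiberBundle.extend (EuclideanSpace ℝ (Fin (2 * n + 1)) × ℝ) w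
  have hW : W p = w := FiberBundle.extend_apply_self _ w
  have hWd : MDifferentiableAt (modelP n) (modelP n).tangent
      (fun q => Bundle.TotalSpace.mk' (EuclideanSpace ℝ (Fin (2 * n + 1)) × ℝ) q (W q)) p :=
    FiberBundle.mdifferentiableAt_extend _ _ w
  have hs : MDifferentiableAt (modelP n) (𝓡 (2 * n)).tangent
      (fun q : S × ℝ => Bundle.TotalSpace.mk' (EuclideanSpace ℝ (Fin (2 * n)))
        (E := TangentSpace (𝓡 (2 * n))) (π q.1) (tangentPr π q (W q))) p :=
    MDifferentiableAt.comp p (((hπ.contMDiff_pr.contMDiff_tangentMap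
      (m := ∞) (by simp)).mdifferentiable (by simp)) _) hWd
  have hpr : MDifferentiableAt (modelP n) (𝓡 (2 * n)) (fun q : S × ℝ => π q.1) p :=
    hπ.contMDiff_pr.mdifferentiableAt (by simp)
  have key := mvfderiv_pullback_section hu (fun q : S × ℝ => tangentPr π q (W q)) hpr hs v
  unfold hess
  simp only [hπ.mvfderiv_pullback hu]
  have h1 : mvfderiv (modelP n) (fun q : S × ℝ => mvfderiv (𝓡 (2 * n)) u (π q.1)
      (tangentPr π q (FiberBundle.extend (EuclideanSpace ℝ (Fin (2 * n + 1)) × ℝ) w q))) p v = _ :=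
    key
  rw [h1]
  change _ - mvfderiv (𝓡 (2 * n)) u (π p.1) (tangentPr π p (connP Ω cov π α W p v)) = _
  rw [connP, hπ.tangentPr_combination hΩ, hW, pullbackCov, hW]
  simp only [map_add, map_sub]
  have h2 : mfderiv (modelP n) (𝓡 (2 * n)) (fun q : S × ℝ => π q.1) p v = tangentPr π p v := rfl
  rw [h2]
  ring

end IsContactReduction

end CochainsOnP

section CochainsOnP

variable {n : ℕ}
  {M : Type*} [TopologicalSpace M] [ChartedSpace (EuclideanSpace ℝ (Fin (2 * n))) M]
  [IsManifold (𝓡 (2 * n)) ∞ M]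
  {S : Type*} [TopologicalSpace S] [ChartedSpace (EuclideanSpace ℝ (Fin (2 * n + 1))) S]
  [IsManifold (𝓡 (2 * n + 1)) ∞ S]
  {Ω : ∀ x : M, TangentSpace (𝓡 (2 * n)) x →L[ℝ] TangentSpace (𝓡 (2 * n)) x →L[ℝ] ℝ}
  {cov : CovariantDerivative (𝓡 (2 * n)) (EuclideanSpace ℝ (Fin (2 * n)))
    (TangentSpace (𝓡 (2 * n)) : M → Type _)}
  {π : S → M}
  {α : ∀ q : S, TangentSpace (𝓡 (2 * n + 1)) q →L[ℝ] ℝ}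

/-- Half the symmetrized second covariant derivative as a bilinear form. -/
def symHess {E : Type*} [NormedAddCommGroup E] [NormedSpace ℝ E]
    {H : Type*} [TopologicalSpace H] {I : ModelWithCorners ℝ E H}
    {N : Type*} [TopologicalSpace N] [ChartedSpace H N] [IsManifold I ∞ N]
    {D : (∀ x : N, TangentSpace I x) → ∀ x : N, TangentSpace I x → TangentSpace I x}
    {f : N → ℂ} {x : N} (h : IsBilinearMap ℝ (hess D f x)) :
    TangentSpace I x →ₗ[ℝ] TangentSpace I x →ₗ[ℝ] ℂ :=
  (1 / 2 : ℂ) • (h.toLinearMap + h.toLinearMap.flip)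

theorem symHess_apply {E : Type*} [NormedAddCommGroup E] [NormedSpace ℝ E]
    {H : Type*} [TopologicalSpace H] {I : ModelWithCorners ℝ E H}
    {N : Type*} [TopologicalSpace N] [ChartedSpace H N] [IsManifold I ∞ N]
    {D : (∀ x : N, TangentSpace I x) → ∀ x : N, TangentSpace I x → TangentSpace I x}
    {f : N → ℂ} {x : N} (h : IsBilinearMap ℝ (hess D f x)) (v w : TangentSpace I x) :
    symHess h v w = (1 / 2) * (hess D f x v w + hess D f x w v) := rfl

namespace IsContactReduction

variable (hπ : IsContactReduction Ω π α) (hΩ : IsSymplecticForm (𝓡 (2 * n)) Ω)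
include hπ hΩ

/-- Contraction with the Poisson tensor of `P` in the frame `frameP`. -/
theorem sum_frameP {ι W : Type*} [Fintype ι] [AddCommGroup W] [Module ℝ W] (p : S × ℝ)
    (f : ι → TangentSpace (𝓡 (2 * n)) (π p.1))
    (c : ι → Module.Dual ℝ (TangentSpace (𝓡 (2 * n)) (π p.1)))
    (G : TangentSpace (modelP n) p →ₗ[ℝ] TangentSpace (modelP n) p →ₗ[ℝ] W) :
    ∑ j, G (frameP π α p f j) (sharp (fun v w => muForm α p v w) (coframeP α p c j)) =
      Real.exp (-p.2) • (∑ i, G (horizontalLift π α p (f i))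
          (horizontalLift π α p (sharp (fun v w => Ω (π p.1) v w) (c i)))
        + (G (fieldS p) (fieldXH α p) - G (fieldXH α p) (fieldS p))) := by
  rw [Fintype.sum_sum_type, Fin.sum_univ_two, smul_add, Finset.smul_sum, smul_sub,
    sub_eq_add_neg, ← smul_neg]
  change ∑ i, G (horizontalLift π α p (f i)) (sharp (fun v w => muForm α p v w)
      (c i ∘ₗ tangentPrMap π p))
    + (G (fieldS p) (sharp (fun v w => muForm α p v w) (dsMap n p))
      + G (fieldXH α p) (sharp (fun v w => muForm α p v w) (coeffXHMap α p))) = _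
  rw [hπ.sharp_ds hΩ, hπ.sharp_coeffXH hΩ, map_smul, map_neg, map_smul, smul_neg]
  congr 1
  exact Finset.sum_congr rfl fun i _ => by rw [hπ.sharp_comp_tangentPr hΩ, map_smul]

theorem crossPairing_one_muForm (p : S × ℝ) (a b : TangentSpace (modelP n) p →ₗ[ℝ] ℂ) :
    crossPairing (fun v w => muForm α p v w) 1 (fun w => a (w 0)) (fun w => b (w 0)) =
      ((Real.exp (-p.2) : ℝ) : ℂ) * (∑ i,
        a (horizontalLift π α p (Module.finBasis ℝ (TangentSpace (𝓡 (2 * n)) (π p.1)) i)) *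
          b (horizontalLift π α p (sharp (fun v w => Ω (π p.1) v w)
            ((Module.finBasis ℝ (TangentSpace (𝓡 (2 * n)) (π p.1))).coord i)))
        + (a (fieldS p) * b (fieldXH α p) - a (fieldXH α p) * b (fieldS p))) := by
  have h1 := (hπ.isLinearSymplectic_muForm hΩ p).crossPairing_one_eq
    (hπ.isCoordFrame_frameP hΩ p
      (Module.finBasis ℝ (TangentSpace (𝓡 (2 * n)) (π p.1))).isCoordFrame) a b
  have h2 := hπ.sum_frameP hΩ p (Module.finBasis ℝ (TangentSpace (𝓡 (2 * n)) (π p.1)))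
    (Module.finBasis ℝ (TangentSpace (𝓡 (2 * n)) (π p.1))).coord
    ((LinearMap.mul ℝ ℂ).compl₁₂ a b)
  rw [h1, ← Complex.real_smul]
  exact h2

/-- `{f, H - 1} = -X_H(f)`, as `X_H` is the Hamiltonian vector field of `H = e^s`. -/
theorem poissonBracket_pr_hMinusOne (f : S × ℝ → ℂ) (p : S × ℝ) :
    poissonBracket (modelP n) (fun p v w => muForm α p v w) f hMinusOne p =
      -mvfderiv (modelP n) f p (fieldXH α p) := by
  have hH (v : TangentSpace (modelP n) p) :
      mvfderiv (modelP n) (hMinusOne : S × ℝ → ℂ) p v = ((Real.exp p.2 * ds p v : ℝ) : ℂ) := by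
    have h1 : HasDerivAt (fun s : ℝ => ((Real.exp s - 1 : ℝ) : ℂ)) ((Real.exp p.2 : ℝ) : ℂ) p.2 :=
      ((Real.hasDerivAt_exp _).sub_const 1).ofReal_comp
    have h2 := mvfderiv_comp_eq (I := 𝓘(ℝ, ℝ)) (J := modelP n) (g := (Prod.snd : S × ℝ → ℝ))
      (f := fun s : ℝ => ((Real.exp s - 1 : ℝ) : ℂ)) (p := p)
      h1.differentiableAt.mdifferentiableAt mdifferentiableAt_snd v
    refine h2.trans ?_
    rw [mvfderiv, mfderiv_eq_fderiv]
    change fderiv ℝ _ p.2 (ds p v) = _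
    rw [h1.hasFDerivAt.fderiv]
    simp [mul_comm]
  refine (hπ.crossPairing_one_muForm hΩ p (mvfderiv (modelP n) f p).toLinearMap
    (mvfderiv (modelP n) (hMinusOne : S × ℝ → ℂ) p).toLinearMap).trans ?_
  have he : ((Real.exp (-p.2) : ℝ) : ℂ) * (Real.exp p.2 : ℝ) = 1 := by
    rw [← Complex.ofReal_mul, ← Real.exp_add]; simp
  simp only [ContinuousLinearMap.coe_coe, hH, ds_horizontalLift, ds_fieldXH, ds_fieldS, mul_zero,
    Complex.ofReal_zero, Finset.sum_const_zero, zero_add, mul_one, zero_sub, mul_neg]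
  linear_combination (-(mvfderiv (modelP n) f p (fieldXH α p))) * he

/-- `{pr^*u, pr^*v} = e^{-s} pr^*{u, v}`. -/
theorem poissonBracket_pr {u v : M → ℂ} (hu : IsSmoothFun (𝓡 (2 * n)) u)
    (hv : IsSmoothFun (𝓡 (2 * n)) v) (p : S × ℝ) :
    poissonBracket (modelP n) (fun p v w => muForm α p v w)
        (fun q : S × ℝ => u (π q.1)) (fun q : S × ℝ => v (π q.1)) p =
      ((Real.exp (-p.2) : ℝ) : ℂ) *
        poissonBracket (𝓡 (2 * n)) (fun x v w => Ω x v w) u v (π p.1) := by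
  unfold poissonBracket
  simp only [hπ.mvfderiv_pullback hu, hπ.mvfderiv_pullback hv]
  refine (hπ.crossPairing_one_muForm hΩ p
    ((mvfderiv (𝓡 (2 * n)) u (π p.1)).toLinearMap ∘ₗ tangentPrMap π p)
    ((mvfderiv (𝓡 (2 * n)) v (π p.1)).toLinearMap ∘ₗ tangentPrMap π p)).trans ?_
  refine congrArg _ (Eq.trans ?_ ((hΩ.isLinearSymplectic (π p.1)).crossPairing_one_eq
    (Module.finBasis ℝ (TangentSpace (𝓡 (2 * n)) (π p.1))).isCoordFrame
    (mvfderiv (𝓡 (2 * n)) u (π p.1)).toLinearMap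
    (mvfderiv (𝓡 (2 * n)) v (π p.1)).toLinearMap).symm)
  have e3 (w : TangentSpace (modelP n) p) : tangentPrMap π p w = tangentPr π p w := rfl
  simp only [LinearMap.comp_apply, e3, hπ.tangentPr_horizontalLift hΩ, hπ.tangentPr_fieldS,
    hπ.tangentPr_fieldXH hΩ, map_zero, mul_zero, sub_zero, add_zero]

variable (n) in
omit hπ hΩ in
/-- The bilinear form on `T_pP` that is the Hessian of a function pulled back from `M`, with `a`
the differential of the function, `A` its Hessian, `τ` an endomorphism and `V` a vector. -/
def hessFormP (π : S → M) (α : ∀ q : S, TangentSpace (𝓡 (2 * n + 1)) q →L[ℝ] ℝ) (p : S × ℝ)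
    (A : TangentSpace (𝓡 (2 * n)) (π p.1) →ₗ[ℝ] TangentSpace (𝓡 (2 * n)) (π p.1) →ₗ[ℝ] ℂ)
    (a : TangentSpace (𝓡 (2 * n)) (π p.1) →ₗ[ℝ] ℂ)
    (τ : TangentSpace (𝓡 (2 * n)) (π p.1) →ₗ[ℝ] TangentSpace (𝓡 (2 * n)) (π p.1))
    (V : TangentSpace (𝓡 (2 * n)) (π p.1)) :
    TangentSpace (modelP n) p →ₗ[ℝ] TangentSpace (modelP n) p →ₗ[ℝ] ℂ :=
  LinearMap.mk₂ ℝ (fun v w => A (tangentPr π p v) (tangentPr π p w) -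
      a ((ds p v / 2) • tangentPr π p w + (ds p w / 2) • tangentPr π p v
          + coeffXH α p v • τ (tangentPr π p w) + coeffXH α p w • τ (tangentPr π p v)
          - (coeffXH α p w * coeffXH α p v) • V))
    (fun v v' w => by
      simp only [tangentPr_add, ds_add, coeffXH_add, map_add, map_sub, map_smul,
        LinearMap.add_apply, Complex.real_smul]
      push_cast; ring)
    (fun r v w => by
      simp only [tangentPr_smul, ds_smul, coeffXH_smul, map_add, map_sub, map_smul,
        LinearMap.smul_apply, Complex.real_smul]
      push_cast; ring)
    (fun v w w' => by
      simp only [tangentPr_add, ds_add, coeffXH_add, map_add, map_sub, map_smul,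
        Complex.real_smul]
      push_cast; ring)
    (fun r v w => by
      simp only [tangentPr_smul, ds_smul, coeffXH_smul, map_add, map_sub, map_smul,
        Complex.real_smul]
      push_cast; ring)

/-- The contraction of two Hessians on `P` at a point of `ι(S)`: besides the contraction of the
Hessians on `M` only the terms pairing `S` with `X_H` in one slot survive. -/
theorem crossPairing_hessFormP (q : S)
    (A B : TangentSpace (𝓡 (2 * n)) (π q) →ₗ[ℝ] TangentSpace (𝓡 (2 * n)) (π q) →ₗ[ℝ] ℂ)
    (a b : TangentSpace (𝓡 (2 * n)) (π q) →ₗ[ℝ] ℂ)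
    (τ : TangentSpace (𝓡 (2 * n)) (π q) →ₗ[ℝ] TangentSpace (𝓡 (2 * n)) (π q))
    (V : TangentSpace (𝓡 (2 * n)) (π q)) :
    crossPairing (fun v w : TangentSpace (modelP n) (q, (0 : ℝ)) => muForm α (q, (0 : ℝ)) v w) 2
        (fun w => hessFormP n π α (q, 0) A a τ V (w 0) (w 1))
        (fun w => hessFormP n π α (q, 0) B b τ V (w 0) (w 1)) =
      crossPairing (fun v w => Ω (π q) v w) 2 (fun w => A (w 0) (w 1)) (fun w => B (w 0) (w 1))
      + ∑ i, a (Module.finBasis ℝ _ i) *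
          b (τ (sharp (fun v w => Ω (π q) v w) ((Module.finBasis ℝ _).coord i)))
      - ∑ i, a (τ (Module.finBasis ℝ _ i)) *
          b (sharp (fun v w => Ω (π q) v w) ((Module.finBasis ℝ _).coord i)) := by
  let p : S × ℝ := (q, 0)
  let e := Module.finBasis ℝ (TangentSpace (𝓡 (2 * n)) (π p.1))
  let A' := hessFormP n π α p A a τ V
  let B' := hessFormP n π α p B b τ V
  have hval (A a) (v w : TangentSpace (modelP n) p) : hessFormP n π α p A a τ V v w =
    A (tangentPr π p v) (tangentPr π p w) -
      a ((ds p v / 2) • tangentPr π p w + (ds p w / 2) • tangentPr π p v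
          + coeffXH α p v • τ (tangentPr π p w) + coeffXH α p w • τ (tangentPr π p v)
          - (coeffXH α p w * coeffXH α p v) • V) := rfl
  have hexp : Real.exp (-p.2) = 1 := by simp [p]
  have h1 (v w : TangentSpace (modelP n) p) := hπ.sum_frameP hΩ p e e.coord
    ((LinearMap.mul ℝ ℂ).compl₁₂ (A' v) (B' w))
  have h2 (v w : TangentSpace (modelP n) p) := hπ.sum_frameP hΩ p e e.coord
    ((LinearMap.mul ℝ ℂ).compl₁₂ (A'.flip v) (B'.flip w))
  simp only [hexp, one_smul, LinearMap.compl₁₂_apply, LinearMap.mul_apply',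
    LinearMap.flip_apply] at h1 h2
  have h3 := (hπ.isLinearSymplectic_muForm hΩ p).crossPairing_two_eq
      (hπ.isCoordFrame_frameP hΩ p e.isCoordFrame) A' B'
  refine h3.trans ?_
  rw [IsLinearSymplectic.crossPairing_two_finBasis A B]
  simp_rw [h1]
  rw [Finset.sum_add_distrib, Finset.sum_sub_distrib, Finset.sum_comm]
  simp_rw [h2]
  simp only [A', B', hval, hπ.tangentPr_horizontalLift hΩ, ds_horizontalLift,
    hπ.coeffXH_horizontalLift hΩ, hπ.tangentPr_fieldS, ds_fieldS, coeffXH_fieldS,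
    hπ.tangentPr_fieldXH hΩ, ds_fieldXH, hπ.coeffXH_fieldXH, map_zero, LinearMap.zero_apply,
    zero_div, zero_smul, smul_zero, add_zero, zero_add, sub_zero, zero_sub, one_smul, mul_zero,
    zero_mul, mul_one, map_smul, map_neg, neg_mul, mul_neg, neg_neg, Complex.real_smul]
  simp only [Finset.sum_add_distrib, Finset.sum_sub_distrib]
  rw [Finset.sum_comm]
  simp only [add_assoc, add_sub_assoc]
  congr 1
  simp only [← Finset.sum_add_distrib, ← Finset.sum_sub_distrib]
  refine Finset.sum_congr rfl fun i _ => ?_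
  push_cast
  ring

end IsContactReduction

end CochainsOnP

section CochainsOnP

variable {n : ℕ}
  {M : Type*} [TopologicalSpace M] [ChartedSpace (EuclideanSpace ℝ (Fin (2 * n))) M]
  [IsManifold (𝓡 (2 * n)) ∞ M]
  {S : Type*} [TopologicalSpace S] [ChartedSpace (EuclideanSpace ℝ (Fin (2 * n + 1))) S]
  [IsManifold (𝓡 (2 * n + 1)) ∞ S]
  {Ω : ∀ x : M, TangentSpace (𝓡 (2 * n)) x →L[ℝ] TangentSpace (𝓡 (2 * n)) x →L[ℝ] ℝ}
  {cov : CovariantDerivative (𝓡 (2 * n)) (EuclideanSpace ℝ (Fin (2 * n)))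
    (TangentSpace (𝓡 (2 * n)) : M → Type _)}
  {π : S → M}
  {α : ∀ q : S, TangentSpace (𝓡 (2 * n + 1)) q →L[ℝ] ℝ}

namespace IsContactReduction

variable (hπ : IsContactReduction Ω π α) (hΩ : IsSymplecticForm (𝓡 (2 * n)) Ω)
include hπ hΩ

/-- The second cochain of the star product on `P`, for functions pulled back from `M`, restricted
to `ι(S)`: the terms with `S` and `X_H` contribute twice the contraction of `t` with `Λ ⊗ Λ`,
because `t` is symmetric. -/
theorem weylCochain_two_pr {u v : M → ℂ} (hu : IsSmoothFun (𝓡 (2 * n)) u)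
    (hv : IsSmoothFun (𝓡 (2 * n)) v) (q : S)
    (ρ : TangentSpace (𝓡 (2 * n)) (π q) →ₗ[ℝ] TangentSpace (𝓡 (2 * n)) (π q))
    (hρ : ∀ x, ricciEndo Ω cov (π q) x = ρ x)
    (hRic : ∀ x y, ricciTensor cov (π q) x y = Ω (π q) x (ρ y))
    (hsymm : ∀ x y, ricciTensor cov (π q) x y = ricciTensor cov (π q) y x) :
    weylCochain (I := modelP n) (fun p v w => muForm α p v w) (connP Ω cov π α) 2
        (fun p : S × ℝ => u (π p.1)) (fun p : S × ℝ => v (π p.1)) (q, 0) =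
      weylCochain (fun x v w => Ω x v w) (fun Y x v => cov Y x v) 2 u v (π q)
        + (2 / ((n : ℂ) + 1)) * sharpPairing (fun v w => Ω (π q) v w)
            (fun v w => ricciTensor cov (π q) v w)
            (fun x => mvfderiv (𝓡 (2 * n)) u (π q) x)
            (fun x => mvfderiv (𝓡 (2 * n)) v (π q) x) := by
  let p : S × ℝ := (q, 0)
  have hbu := isBilinearMap_hess cov hu (π q)
  have hbv := isBilinearMap_hess cov hv (π q)
  let a := (mvfderiv (𝓡 (2 * n)) u (π q)).toLinearMap
  let b := (mvfderiv (𝓡 (2 * n)) v (π q)).toLinearMap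
  let τ := (1 / ((n : ℝ) + 1)) • ρ
  have hform {f : M → ℂ} (hf : IsSmoothFun (𝓡 (2 * n)) f)
      (w : Fin 2 → TangentSpace (modelP n) p) :
      1 / 2 * (hess (connP Ω cov π α) (fun p : S × ℝ => f (π p.1)) p (w 0) (w 1)
        + hess (connP Ω cov π α) (fun p : S × ℝ => f (π p.1)) p (w 1) (w 0)) =
      hessFormP n π α p (symHess (isBilinearMap_hess cov hf (π q)))
        (mvfderiv (𝓡 (2 * n)) f (π q)).toLinearMap τ (vectorV Ω cov (π q)) (w 0) (w 1) := by
    rw [hπ.hess_connP hΩ hf, hπ.hess_connP hΩ hf, hessFormP, LinearMap.mk₂_apply, symHess_apply]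
    simp only [tauEndo, hρ, map_add, map_sub, map_smul, ContinuousLinearMap.coe_coe, τ,
      LinearMap.smul_apply, p, mul_comm (coeffXH α (q, (0 : ℝ)) (w 1))]
    ring
  have h1 := hπ.crossPairing_hessFormP hΩ q (symHess hbu) (symHess hbv) a b τ
    (vectorV Ω cov (π q))
  have hT := (hΩ.isLinearSymplectic (π q)).sharpPairing_eq
    (Module.finBasis ℝ (TangentSpace (𝓡 (2 * n)) (π q))).isCoordFrame ρ hRic a b
  have hT' := (hΩ.isLinearSymplectic (π q)).sharpPairing_eq_of_symm
    (Module.finBasis ℝ (TangentSpace (𝓡 (2 * n)) (π q))).isCoordFrame ρ hRic hsymm a b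
  rw [weylCochain_two, weylCochain_two]
  have hfu := funext (hform hu)
  have hfv := funext (hform hv)
  refine (congrArg₂ (crossPairing _ 2) hfu hfv).trans (h1.trans ?_)
  rw [add_sub_assoc]
  congr 1
  have e1 : sharpPairing (fun v w => Ω (π q) v w) (fun v w => ricciTensor cov (π q) v w)
            (fun x => mvfderiv (𝓡 (2 * n)) u (π q) x)
            (fun x => mvfderiv (𝓡 (2 * n)) v (π q) x) =
      sharpPairing (fun v w => Ω (π q) v w) (fun v w => ricciTensor cov (π q) v w) a b := rfl
  rw [e1]
  have e2 : (2 / ((n : ℂ) + 1)) =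
      ((1 / ((n : ℝ) + 1) : ℝ) : ℂ) + ((1 / ((n : ℝ) + 1) : ℝ) : ℂ) := by
    push_cast; ring
  rw [e2, add_mul]
  nth_rewrite 1 [hT']
  nth_rewrite 1 [hT]
  rw [mul_neg, ← sub_eq_add_neg, Finset.mul_sum, Finset.mul_sum]
  congr 1 <;> refine Finset.sum_congr rfl fun i _ => ?_ <;>
    simp only [τ, LinearMap.smul_apply, map_smul, Complex.real_smul] <;> ring

end IsContactReduction

end CochainsOnP

/-! ### Products of smooth complex-valued functions -/

section SmoothFunctions

variable {E : Type*} [NormedAddCommGroup E] [NormedSpace ℝ E]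
  {H : Type*} [TopologicalSpace H] {I : ModelWithCorners ℝ E H}
  {N : Type*} [TopologicalSpace N] [ChartedSpace H N]

theorem IsSmoothFun.mul {f g : N → ℂ} (hf : IsSmoothFun I f) (hg : IsSmoothFun I g) :
    IsSmoothFun I (fun x => f x * g x) :=
  (contDiff_mul (𝕜 := ℝ) (𝔸 := ℂ)).contMDiff.comp (hf.prodMk_space hg)

theorem mvfderiv_mul_apply {f g : N → ℂ} {x : N} (hf : MDifferentiableAt I 𝓘(ℝ, ℂ) f x)
    (hg : MDifferentiableAt I 𝓘(ℝ, ℂ) g x) (v : TangentSpace I x) :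
    mvfderiv I (fun y => f y * g y) x v = f x * mvfderiv I g x v + g x * mvfderiv I f x v := by
  have h := hf.hasMFDerivAt.mul hg.hasMFDerivAt
  have h2 := congr($(h.mfderiv) v)
  refine h2.trans ?_
  simp only [mvfderiv]
  rfl

end SmoothFunctions

/-! ### The quantum restriction up to the second order -/

section FormalSeries

variable {N N' : Type*}

theorem mapSeries_C (T : (N → ℂ) → N' → ℂ) (hT : T 0 = 0) (u : N → ℂ) :
    mapSeries T (PowerSeries.C u) = PowerSeries.C (T u) := by
  ext1 k
  rw [mapSeries, PowerSeries.coeff_mk, PowerSeries.coeff_C, PowerSeries.coeff_C]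
  split_ifs <;> simp [hT]

variable {C : ℕ → (N → ℂ) → (N → ℂ) → N → ℂ}

theorem coeff_starProduct_C (hC : ∀ r f, C r f 0 = 0) (f : PowerSeries (N → ℂ)) (g : N → ℂ)
    (k : ℕ) : PowerSeries.coeff k (starProduct C f (PowerSeries.C g)) =
      ∑ rm ∈ Finset.HasAntidiagonal.antidiagonal k,
        ((1 / (rm.1.factorial : ℂ)) * (1 / 2) ^ rm.1) • C rm.1 (PowerSeries.coeff rm.2 f) g := by
  rw [starProduct, PowerSeries.coeff_mk]
  refine Finset.sum_congr rfl fun rm _ => ?_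
  rw [seriesExt, PowerSeries.coeff_mk, Finset.sum_eq_single (rm.2, 0)]
  · rw [PowerSeries.coeff_C, if_pos rfl]
  · rintro ⟨a, b⟩ hab hne
    rw [Finset.HasAntidiagonal.mem_antidiagonal] at hab
    have hb : b ≠ 0 := by
      rintro rfl
      exact hne (by rw [← hab, add_zero])
    rw [PowerSeries.coeff_C, if_neg hb, hC]
  · intro h
    exact absurd (Finset.HasAntidiagonal.mem_antidiagonal.2 (add_zero _)) h

theorem coeff_starProduct_C_C (hC : ∀ r f, C r f 0 = 0) (hC' : ∀ r f, C r 0 f = 0)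
    (f g : N → ℂ) (k : ℕ) :
    PowerSeries.coeff k (starProduct C (PowerSeries.C f) (PowerSeries.C g)) =
      ((1 / (k.factorial : ℂ)) * (1 / 2) ^ k) • C k f g := by
  rw [coeff_starProduct_C hC, Finset.sum_eq_single (k, 0)]
  · rw [PowerSeries.coeff_C, if_pos rfl]
  · rintro ⟨a, b⟩ hab hne
    rw [Finset.HasAntidiagonal.mem_antidiagonal] at hab
    have hb : b ≠ 0 := by
      rintro rfl
      exact hne (by rw [← hab, add_zero])
    rw [PowerSeries.coeff_C, if_neg hb, hC', smul_zero]
  · intro h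
    exact absurd (Finset.HasAntidiagonal.mem_antidiagonal.2 (add_zero _)) h

/-- If the homotopy `h` kills the leading coefficient of `F` and the first cochain vanishes on
`(h F₁, g)`, then `(id + (⋆ g - · g) h)⁻¹` does not change the coefficients of `F` of order at most
two. -/
theorem coeff_geometricInverse_of_le_two (hC0 : ∀ f g, C 0 f g = f * g)
    (hC : ∀ r f, C r f 0 = 0) (hC' : ∀ r f, C r 0 f = 0) (h : (N → ℂ) → N → ℂ) (hh : h 0 = 0)
    (g : N → ℂ) (F : PowerSeries (N → ℂ)) (hF0 : h (PowerSeries.coeff 0 F) = 0)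
    (hF1 : C 1 (h (PowerSeries.coeff 1 F)) g = 0) {k : ℕ} (hk : k ≤ 2) :
    PowerSeries.coeff k (geometricInverse (fun G =>
      starProduct C (mapSeries h G) (PowerSeries.C g)
        - mapSeries (fun f => f * g) (mapSeries h G)) F) = PowerSeries.coeff k F := by
  set A : PowerSeries (N → ℂ) → PowerSeries (N → ℂ) := fun G =>
    starProduct C (mapSeries h G) (PowerSeries.C g)
      - mapSeries (fun f => f * g) (mapSeries h G) with hA
  have key (G : PowerSeries (N → ℂ)) (h0 : h (PowerSeries.coeff 0 G) = 0)
      (h1 : C 1 (h (PowerSeries.coeff 1 G)) g = 0) (k : ℕ) (hk : k ≤ 2) :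
      PowerSeries.coeff k (-A G) = 0 := by
    rw [hA, map_neg, map_sub, coeff_starProduct_C hC]
    have hm (j : ℕ) : PowerSeries.coeff j (mapSeries h G) = h (PowerSeries.coeff j G) :=
      PowerSeries.coeff_mk _ _
    have hm2 (X : PowerSeries (N → ℂ)) (j : ℕ) :
        PowerSeries.coeff j (mapSeries (fun f => f * g) X) = PowerSeries.coeff j X * g :=
      PowerSeries.coeff_mk _ _
    rw [hm2, hm]
    interval_cases k <;>
      simp [Finset.Nat.antidiagonal_succ, hm, hC0, h0, h1, hC',
        -PowerSeries.coeff_zero_eq_constantCoeff]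
  -- already the first term of the series vanishes up to order two, and so do all later ones
  have hiter (m : ℕ) : ∀ k ≤ 2, PowerSeries.coeff k ((fun G => -A G)^[m + 1] F) = 0 := by
    induction m with
    | zero => exact key F hF0 hF1
    | succ m ih =>
      rw [Function.iterate_succ_apply']
      exact key _ (by rw [ih 0 (by norm_num), hh]) (by rw [ih 1 (by norm_num), hh, hC'])
  rw [geometricInverse, PowerSeries.coeff_mk, Finset.sum_range_succ']
  rw [Finset.sum_eq_zero fun m _ => hiter m k hk, zero_add]
  rfl

end FormalSeries

section QuantumRestriction

variable {n : ℕ}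
  {M : Type*} [TopologicalSpace M] [ChartedSpace (EuclideanSpace ℝ (Fin (2 * n))) M]
  [IsManifold (𝓡 (2 * n)) ∞ M]
  {S : Type*} [TopologicalSpace S] [ChartedSpace (EuclideanSpace ℝ (Fin (2 * n + 1))) S]
  [IsManifold (𝓡 (2 * n + 1)) ∞ S]
  {Ω : ∀ x : M, TangentSpace (𝓡 (2 * n)) x →L[ℝ] TangentSpace (𝓡 (2 * n)) x →L[ℝ] ℝ}
  (cov : CovariantDerivative (𝓡 (2 * n)) (EuclideanSpace ℝ (Fin (2 * n)))
    (TangentSpace (𝓡 (2 * n)) : M → Type _))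
  {π : S → M}
  {α : ∀ q : S, TangentSpace (𝓡 (2 * n + 1)) q →L[ℝ] ℝ}

namespace IsContactReduction

variable (hπ : IsContactReduction Ω π α) (hΩ : IsSymplecticForm (𝓡 (2 * n)) Ω)

/-- The homotopy kills the functions that do not depend on `s`. No regularity is needed: where such
a function is not differentiable, its derivative is zero by convention. -/
theorem _root_.classicalHomotopy_fst (f : S → ℂ) :
    classicalHomotopy (n := n) (fun p : S × ℝ => f p.1) = 0 := by
  ext p
  rw [classicalHomotopy]
  split_ifs with hp
  · by_cases hd : MDifferentiableAt (modelP n) 𝓘(ℝ, ℂ) (fun p : S × ℝ => f p.1) p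
    · have h := mvfderiv_comp_eq (J := 𝓘(ℝ, ℝ)) (g := fun t : ℝ => (p.1, t)) (p := p.2) hd
        (mdifferentiableAt_const.prodMk mdifferentiableAt_id) (1 : ℝ)
      refine h.symm.trans ?_
      change mvfderiv 𝓘(ℝ, ℝ) (fun _ : ℝ => f p.1) p.2 1 = 0
      rw [mvfderiv_const]; rfl
    · rw [mvfderiv, mfderiv_zero_of_not_mdifferentiableAt hd]
      simp
  · simp

theorem _root_.classicalHomotopy_zero : classicalHomotopy (n := n) (0 : S × ℝ → ℂ) = 0 :=
  classicalHomotopy_fst (0 : S → ℂ)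

include hπ

/-- The homotopy applied to `c e^{-s} pr^*w` gives `-c e^{-s} pr^*w`. -/
theorem classicalHomotopy_exp_mul {w : M → ℂ} (hw : IsSmoothFun (𝓡 (2 * n)) w) (c : ℂ) :
    classicalHomotopy (n := n)
      (fun p : S × ℝ => c * (((Real.exp (-p.2) : ℝ) : ℂ) * w (π p.1))) =
      fun p : S × ℝ => (-c) * (((Real.exp (-p.2) : ℝ) : ℂ) * w (π p.1)) := by
  have hexp : ContDiff ℝ ∞ (fun s : ℝ => ((Real.exp (-s) : ℝ) : ℂ)) :=
    Complex.ofRealCLM.contDiff.comp (Real.contDiff_exp.comp contDiff_neg)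
  ext p
  rw [classicalHomotopy]
  split_ifs with hp
  · have hd : ContMDiff (modelP n) 𝓘(ℝ, ℂ) ∞
        (fun p : S × ℝ => c * (((Real.exp (-p.2) : ℝ) : ℂ) * w (π p.1))) :=
      IsSmoothFun.mul contMDiff_const
        (IsSmoothFun.mul (hexp.contMDiff.comp contMDiff_snd) (hπ.isSmoothFun_pullback hw))
    have h := mvfderiv_comp_eq (J := 𝓘(ℝ, ℝ)) (g := fun t : ℝ => (p.1, t)) (p := p.2)
      (hd.mdifferentiableAt (x := (p.1, p.2)) (by simp))
      (mdifferentiableAt_const.prodMk mdifferentiableAt_id) (1 : ℝ)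
    refine h.symm.trans ?_
    have h1 : HasDerivAt (fun s : ℝ => c * (((Real.exp (-s) : ℝ) : ℂ) * w (π p.1)))
        (c * (((Real.exp (-p.2) * -1 : ℝ) : ℂ) * w (π p.1))) p.2 :=
      (((((hasDerivAt_id p.2).neg).exp).ofReal_comp.mul_const _).const_mul c)
    rw [mvfderiv, mfderiv_eq_fderiv]
    change fderiv ℝ (fun s : ℝ => c * (((Real.exp (-s) : ℝ) : ℂ) * w (π p.1))) p.2 1 = _
    rw [h1.hasFDerivAt.fderiv]
    simp
  · have h1 : (hMinusOne p : ℂ) ≠ 0 := by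
      rw [hMinusOne, Complex.ofReal_ne_zero, sub_ne_zero, Ne, Real.exp_eq_one_iff]
      exact hp
    rw [div_eq_iff h1, hMinusOne]
    have he : ((Real.exp (-p.2) : ℝ) : ℂ) * ((Real.exp p.2 : ℝ) : ℂ) = 1 := by
      rw [← Complex.ofReal_mul, ← Real.exp_add]; simp
    simp only [neg_zero, Real.exp_zero, Complex.ofReal_one, Complex.ofReal_sub]
    linear_combination (c * w (π p.1)) * he

include hΩ

/-- The function `c e^{-s} pr^*w` is constant along `X_H`, so it Poisson commutes with `H - 1`. -/
theorem poissonBracket_exp_mul_hMinusOne {w : M → ℂ} (hw : IsSmoothFun (𝓡 (2 * n)) w) (c : ℂ) :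
    poissonBracket (modelP n) (fun p v w => muForm α p v w)
      (fun p : S × ℝ => c * (((Real.exp (-p.2) : ℝ) : ℂ) * w (π p.1))) hMinusOne = 0 := by
  have hexp : ContDiff ℝ ∞ (fun s : ℝ => c * ((Real.exp (-s) : ℝ) : ℂ)) :=
    contDiff_const.mul (Complex.ofRealCLM.contDiff.comp (Real.contDiff_exp.comp contDiff_neg))
  ext p
  rw [hπ.poissonBracket_pr_hMinusOne hΩ]
  have h1 : MDifferentiableAt (modelP n) 𝓘(ℝ, ℂ)
      (fun p : S × ℝ => c * ((Real.exp (-p.2) : ℝ) : ℂ)) p :=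
    (hexp.contMDiff.comp contMDiff_snd).mdifferentiableAt (by simp)
  have h2 : MDifferentiableAt (modelP n) 𝓘(ℝ, ℂ) (fun p : S × ℝ => w (π p.1)) p :=
    (hπ.isSmoothFun_pullback hw).mdifferentiableAt (by simp)
  have e1 : mvfderiv (modelP n) (fun p : S × ℝ => c * ((Real.exp (-p.2) : ℝ) : ℂ)) p
      (fieldXH α p) = 0 := by
    have h := mvfderiv_comp_eq (I := 𝓘(ℝ, ℝ)) (J := modelP n) (g := (Prod.snd : S × ℝ → ℝ))
      (f := fun s : ℝ => c * ((Real.exp (-s) : ℝ) : ℂ)) (p := p)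
      (hexp.contMDiff.mdifferentiableAt (by simp)) mdifferentiableAt_snd (fieldXH α p)
    refine h.trans ?_
    have h3 : mfderiv (modelP n) 𝓘(ℝ, ℝ) (Prod.snd : S × ℝ → ℝ) p (fieldXH α p) = 0 :=
      ds_fieldXH p
    rw [h3, map_zero]
  have e2 : mvfderiv (modelP n) (fun p : S × ℝ => w (π p.1)) p (fieldXH α p) = 0 := by
    rw [hπ.mvfderiv_pullback hw, hπ.tangentPr_fieldXH hΩ, map_zero]
  have hm := mvfderiv_mul_apply h1 h2 (fieldXH α p)
  rw [e1, e2] at hm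
  simp only [← mul_assoc]
  rw [hm]
  simp

/-- The coefficients of order at most two of the quantum restriction of `pr^*u ⋆ pr^*v`: the
quantum corrections to the restriction only show up in higher order. -/
theorem coeff_restrictedProduct {u v : M → ℂ} (hu : IsSmoothFun (𝓡 (2 * n)) u)
    (hv : IsSmoothFun (𝓡 (2 * n)) v)
    (hw : IsSmoothFun (𝓡 (2 * n)) (poissonBracket (𝓡 (2 * n)) (fun x v w => Ω x v w) u v))
    {k : ℕ} (hk : k ≤ 2) :
    PowerSeries.coeff k
        (restrictedProduct Ω cov π α (PowerSeries.C u) (PowerSeries.C v)) =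
      fun q => ((1 / (k.factorial : ℂ)) * (1 / 2) ^ k) *
        weylCochain (I := modelP n) (fun p v w => muForm α p v w) (connP Ω cov π α) k
          (fun p : S × ℝ => u (π p.1)) (fun p : S × ℝ => v (π p.1)) (q, 0) := by
  set C := weylCochain (I := modelP n) (fun p v w => muForm α p v w) (connP Ω cov π α) with hCdef
  have hF (j : ℕ) : PowerSeries.coeff j (moyalP Ω cov π α
      (mapSeries (fun f p => f (π p.1)) (PowerSeries.C u))
      (mapSeries (fun f p => f (π p.1)) (PowerSeries.C v))) =
      ((1 / (j.factorial : ℂ)) * (1 / 2) ^ j) •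
        C j (fun p : S × ℝ => u (π p.1)) (fun p : S × ℝ => v (π p.1)) := by
    rw [mapSeries_C _ (by rfl), mapSeries_C _ (by rfl), moyalP]
    exact coeff_starProduct_C_C (fun r f => weylCochain_zero_right r f)
      (fun r f => weylCochain_zero_left r f) _ _ _
  rw [restrictedProduct, quantumRestriction, mapSeries, PowerSeries.coeff_mk]
  ext q
  have key := coeff_geometricInverse_of_le_two (C := C) (fun f g => weylCochain_zero f g)
    (fun r f => weylCochain_zero_right r f) (fun r f => weylCochain_zero_left r f)
    (classicalHomotopy (n := n)) classicalHomotopy_zero hMinusOne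
    (moyalP Ω cov π α
      (mapSeries (fun f p => f (π p.1)) (PowerSeries.C u))
      (mapSeries (fun f p => f (π p.1)) (PowerSeries.C v))) ?_ ?_ hk
  · refine (congrFun key (q, 0)).trans ?_
    rw [hF]; rfl
  · rw [hF, hCdef, weylCochain_zero]
    simp only [Nat.factorial_zero, Nat.cast_one, div_one, pow_zero, mul_one, one_smul]
    exact classicalHomotopy_fst (fun q => u (π q) * v (π q))
  · have h1 : PowerSeries.coeff 1 (moyalP Ω cov π α
      (mapSeries (fun f p => f (π p.1)) (PowerSeries.C u))
      (mapSeries (fun f p => f (π p.1)) (PowerSeries.C v))) =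
        fun p : S × ℝ => (1 / 2) * (((Real.exp (-p.2) : ℝ) : ℂ) *
          poissonBracket (𝓡 (2 * n)) (fun x v w => Ω x v w) u v (π p.1)) := by
      rw [hF, hCdef, weylCochain_one]
      ext p
      rw [Pi.smul_apply, hπ.poissonBracket_pr hΩ hu hv]
      simp
    rw [h1, hπ.classicalHomotopy_exp_mul hw, hCdef, weylCochain_one,
      hπ.poissonBracket_exp_mul_hMinusOne hΩ hw]

end IsContactReduction

end QuantumRestriction

/-! ### The curvature as a tensor -/

section Curvature

open scoped Topology

variable {E : Type*} [NormedAddCommGroup E] [NormedSpace ℝ E] [FiniteDimensional ℝ E]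
  {H : Type*} [TopologicalSpace H] {I : ModelWithCorners ℝ E H}
  {N : Type*} [TopologicalSpace N] [ChartedSpace H N]

section Fields

variable [IsManifold I ∞ N]

variable (I) in
/-- A vector field which is smooth in a neighbourhood of the point `x`. -/
def IsSmoothFieldNear (X : ∀ y : N, TangentSpace I y) (x : N) : Prop :=
  ∀ᶠ y in 𝓝 x, ContMDiffAt I I.tangent ∞ (fun z => Bundle.TotalSpace.mk' E z (X z)) y

namespace IsSmoothFieldNear

variable {X Y Z : ∀ y : N, TangentSpace I y} {x : N}

theorem contMDiffAt (hX : IsSmoothFieldNear I X x) :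
    ContMDiffAt I I.tangent ∞ (fun z => Bundle.TotalSpace.mk' E z (X z)) x :=
  hX.self_of_nhds

theorem mdifferentiableAt (hX : IsSmoothFieldNear I X x) :
    MDifferentiableAt I I.tangent (fun z => Bundle.TotalSpace.mk' E z (X z)) x :=
  hX.contMDiffAt.mdifferentiableAt (by simp)

theorem eventually (hX : IsSmoothFieldNear I X x) :
    ∀ᶠ y in 𝓝 x, IsSmoothFieldNear I X y :=
  eventually_eventually_nhds.2 hX

theorem extend (v : TangentSpace I x) :
    IsSmoothFieldNear I (FiberBundle.extend E v : ∀ y : N, TangentSpace I y) x := by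
  obtain ⟨s, hs, h⟩ := FiberBundle.exists_contMDiffOn_extend (k := ∞) I E v
  filter_upwards [eventually_mem_nhds_iff.2 hs] with y hy
  exact h.contMDiffAt hy

theorem sub (hX : IsSmoothFieldNear I X x) (hY : IsSmoothFieldNear I Y x) :
    IsSmoothFieldNear I (X - Y) x := by
  filter_upwards [hX, hY] with y h1 h2
  exact h1.sub_section h2

theorem congr (hX : IsSmoothFieldNear I X x) (h : ∀ᶠ y in 𝓝 x, Y y = X y) :
    IsSmoothFieldNear I Y x := by
  filter_upwards [hX, eventually_eventually_nhds.2 h] with y h1 h2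
  refine h1.congr_of_eventuallyEq ?_
  filter_upwards [h2] with z hz
  rw [hz]

/-- A vector field that is smooth near `x` agrees near `x` with a smooth vector field. -/
theorem exists_contMDiff [T2Space N] (hX : IsSmoothFieldNear I X x) :
    ∃ X' : ∀ y : N, TangentSpace I y,
      ContMDiff I I.tangent ∞ (fun y => Bundle.TotalSpace.mk' E y (X' y)) ∧
        ∀ᶠ y in 𝓝 x, X' y = X y := by
  obtain ⟨u, hu, huo, hxu⟩ := eventually_nhds_iff.1 hX
  obtain ⟨f, -, hf⟩ := (SmoothBumpFunction.nhds_basis_tsupport (I := I) x).mem_iff.1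
    (huo.mem_nhds hxu)
  refine ⟨(f : N → ℝ) • X, ?_, ?_⟩
  · exact ContMDiffOn.smul_section_of_tsupport f.contMDiff.contMDiffOn huo hf
      fun y hy => (hu y hy).contMDiffWithinAt
  · filter_upwards [f.eventuallyEq_one] with y hy
    simp [hy]

end IsSmoothFieldNear

variable {cov : CovariantDerivative I E (TangentSpace I : N → Type _)}
  {X Y Z : ∀ y : N, TangentSpace I y} {x : N}

theorem CovariantDerivative.congr_of_eventuallyEq
    (hX : MDifferentiableAt I I.tangent (fun z => Bundle.TotalSpace.mk' E z (X z)) x)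
    (hY : MDifferentiableAt I I.tangent (fun z => Bundle.TotalSpace.mk' E z (Y z)) x)
    (h : ∀ᶠ y in 𝓝 x, X y = Y y) : cov X x = cov Y x :=
  cov.isCovariantDerivativeOnUniv.congr_of_eventuallyEq hX hY Filter.univ_mem h

theorem IsSmoothFieldNear.eventually_cov_eq (hX : IsSmoothFieldNear I X x)
    (h : ∀ᶠ y in 𝓝 x, Y y = X y) : ∀ᶠ y in 𝓝 x, cov Y y = cov X y := by
  filter_upwards [hX.eventually, (hX.congr h).eventually, eventually_eventually_nhds.2 h]
    with y h1 h2 h3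
  exact CovariantDerivative.congr_of_eventuallyEq h2.mdifferentiableAt h1.mdifferentiableAt h3

variable [T2Space N] (hcov : cov.ContMDiffCovariantDerivative ∞)

include hcov

/-- Smoothness of a connection, stated for globally smooth vector fields, holds for fields that are
smooth near a point, by multiplication with a bump function. -/
theorem contMDiffAt_cov (hX : IsSmoothFieldNear I X x) :
    ContMDiffAt I (I.prod 𝓘(ℝ, E →L[ℝ] E)) ∞
      (fun y => Bundle.TotalSpace.mk' (E →L[ℝ] E)
        (E := fun y : N => TangentSpace I y →L[ℝ] TangentSpace I y) y (cov X y)) x := by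
  obtain ⟨X', hX', h⟩ := hX.exists_contMDiff
  have h1 := hcov.contMDiff.contMDiff (σ := X') (by simpa using hX'.contMDiffOn)
  refine (h1.contMDiffAt Filter.univ_mem).congr_of_eventuallyEq ?_
  filter_upwards [hX.eventually_cov_eq (cov := cov) h] with y hy
  rw [← hy]

theorem IsSmoothFieldNear.cov_apply (hY : IsSmoothFieldNear I Y x) (hX : IsSmoothFieldNear I X x) :
    IsSmoothFieldNear I (fun y => cov Y y (X y)) x := by
  filter_upwards [hX, hY.eventually] with y h1 h2
  exact (contMDiffAt_cov hcov h2).clm_bundle_apply h1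

theorem mdifferentiableAt_cov_apply (hY : IsSmoothFieldNear I Y x)
    (hX : MDifferentiableAt I I.tangent (fun z => Bundle.TotalSpace.mk' E z (X z)) x) :
    MDifferentiableAt I I.tangent (fun z => Bundle.TotalSpace.mk' E z (cov Y z (X z))) x :=
  ((contMDiffAt_cov hcov hY).mdifferentiableAt (by simp)).clm_bundle_apply hX

omit hcov

/-- The curvature operator `R(X, Y)Z = ∇_X ∇_Y Z - ∇_Y ∇_X Z - ∇_{[X, Y]} Z` on vector fields. -/
def curvatureOperator (cov : CovariantDerivative I E (TangentSpace I : N → Type _))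
    (X Y Z : ∀ y : N, TangentSpace I y) (x : N) : TangentSpace I x :=
  cov (fun y => cov Z y (Y y)) x (X x) - cov (fun y => cov Z y (X y)) x (Y x)
    - cov Z x (VectorField.mlieBracket I X Y x)

theorem curvatureOperator_swap (X Y Z : ∀ y : N, TangentSpace I y) (x : N) :
    curvatureOperator cov X Y Z x = -curvatureOperator cov Y X Z x := by
  rw [curvatureOperator, curvatureOperator, VectorField.mlieBracket_swap_apply, map_neg]
  abel

theorem curvatureTensor_eq_curvatureOperator (x : N) (u v w : TangentSpace I x) :
    curvatureTensor cov x u v w = curvatureOperator cov (FiberBundle.extend E u)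
      (FiberBundle.extend E v) (FiberBundle.extend E w) x := by
  simp only [curvatureTensor, curvatureOperator, FiberBundle.extend_apply_self]

include hcov

/-- In its first argument the curvature operator is tensorial on merely differentiable fields. -/
theorem tensorialAt_curvatureOperator (Y : ∀ y : N, TangentSpace I y)
    (hZ : IsSmoothFieldNear I Z x) :
    TensorialAt I E (fun X => curvatureOperator cov X Y Z x) x where
  smul {f X} hf hX := by
    have h1 := mdifferentiableAt_cov_apply hcov hZ hX
    have e : (fun y => cov Z y ((f • X) y)) = f • fun y => cov Z y (X y) := by
      ext y; simp
    rw [curvatureOperator, e, cov.isCovariantDerivativeOnUniv.leibniz h1 hf,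
      VectorField.mlieBracket_smul_left hf hX, curvatureOperator]
    simp
    module
  add {X X'} hX hX' := by
    have h1 := mdifferentiableAt_cov_apply hcov hZ hX
    have h2 := mdifferentiableAt_cov_apply hcov hZ hX'
    have e : (fun y => cov Z y ((X + X') y)) =
        (fun y => cov Z y (X y)) + fun y => cov Z y (X' y) := by
      ext y; simp
    rw [curvatureOperator, e, cov.isCovariantDerivativeOnUniv.add h1 h2,
      VectorField.mlieBracket_add_left hX hX', curvatureOperator, curvatureOperator]
    simp
    module

variable (htor : ∀ (X Y : ∀ x : N, TangentSpace I x) (x : N),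
    MDifferentiableAt I I.tangent (fun y => Bundle.TotalSpace.mk' E y (X y)) x →
    MDifferentiableAt I I.tangent (fun y => Bundle.TotalSpace.mk' E y (Y y)) x →
    cov Y x (X x) - cov X x (Y x) = VectorField.mlieBracket I X Y x)

include htor

/-- For a torsion-free connection the Lie bracket is a difference of covariant derivatives; this is
the source of its smoothness. -/
theorem eventually_mlieBracket_eq (hX : IsSmoothFieldNear I X x) (hY : IsSmoothFieldNear I Y x) :
    ∀ᶠ y in 𝓝 x, VectorField.mlieBracket I X Y y =
      ((fun z => cov Y z (X z)) - fun z => cov X z (Y z)) y := by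
  filter_upwards [hX.eventually, hY.eventually] with y h1 h2
  exact (htor X Y y h1.mdifferentiableAt h2.mdifferentiableAt).symm

theorem IsSmoothFieldNear.mlieBracket (hX : IsSmoothFieldNear I X x)
    (hY : IsSmoothFieldNear I Y x) : IsSmoothFieldNear I (VectorField.mlieBracket I X Y) x :=
  ((hY.cov_apply hcov hX).sub (hX.cov_apply hcov hY)).congr
    (eventually_mlieBracket_eq hcov htor hX hY)

/-- For a torsion-free connection, `∇_X ∇_Y Z - ∇_X ∇_Z Y = ∇_{[Y, Z]} X + [X, [Y, Z]]`. -/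
theorem cov_cov_sub_cov_cov (hX : IsSmoothFieldNear I X x)
    (hY : IsSmoothFieldNear I Y x) (hZ : IsSmoothFieldNear I Z x) :
    cov (fun y => cov Z y (Y y)) x (X x) - cov (fun y => cov Y y (Z y)) x (X x) =
      cov X x (VectorField.mlieBracket I Y Z x) +
        VectorField.mlieBracket I X (VectorField.mlieBracket I Y Z) x := by
  have h1 := hZ.cov_apply hcov hY
  have h2 := hY.cov_apply hcov hZ
  have h3 := hY.mlieBracket hcov htor hZ
  have h4 := CovariantDerivative.congr_of_eventuallyEq (cov := cov) h3.mdifferentiableAt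
    (h1.sub h2).mdifferentiableAt (eventually_mlieBracket_eq hcov htor hY hZ)
  have h5 := cov.isCovariantDerivativeOnUniv.add (h1.sub h2).mdifferentiableAt
    h2.mdifferentiableAt
  rw [sub_add_cancel] at h5
  rw [← htor X _ x hX.mdifferentiableAt h3.mdifferentiableAt, h4]
  have h6 : cov (fun y => cov Z y (Y y)) x = _ := h5
  rw [h6, add_apply]
  abel

/-- The first Bianchi identity, a consequence of the Jacobi identity. -/
theorem curvatureOperator_cyclic (hX : IsSmoothFieldNear I X x)
    (hY : IsSmoothFieldNear I Y x) (hZ : IsSmoothFieldNear I Z x) :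
    curvatureOperator cov X Y Z x + curvatureOperator cov Y Z X x
      + curvatureOperator cov Z X Y x = 0 := by
  have h1 := cov_cov_sub_cov_cov hcov htor hX hY hZ
  have h2 := cov_cov_sub_cov_cov hcov htor hY hZ hX
  have h3 := cov_cov_sub_cov_cov hcov htor hZ hX hY
  have hs {W : ∀ y : N, TangentSpace I y} (hW : IsSmoothFieldNear I W x) :
      ContMDiffAt I I.tangent (minSmoothness ℝ 2)
        (fun y => Bundle.TotalSpace.mk' E y (W y)) x :=
    hW.contMDiffAt.of_le (by simpa using WithTop.coe_le_coe.2 (le_top : (2 : ℕ∞) ≤ ⊤))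
  have : IsManifold I (minSmoothness ℝ 3) N :=
    IsManifold.of_le (n := ∞) (by simpa using WithTop.coe_le_coe.2 (le_top : (3 : ℕ∞) ≤ ⊤))
  have hJ := VectorField.leibniz_identity_mlieBracket_apply (hs hX) (hs hY) (hs hZ)
  rw [VectorField.mlieBracket_swap_apply (V := VectorField.mlieBracket I X Y),
    VectorField.mlieBracket_swap (V := X) (W := Z)] at hJ
  have hn : VectorField.mlieBracket I Y (-VectorField.mlieBracket I Z X) x =
      -VectorField.mlieBracket I Y (VectorField.mlieBracket I Z X) x := by
    have := VectorField.mlieBracket_const_smul_right (I := I) (V := Y) (c := (-1 : ℝ))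
      (hZ.mlieBracket hcov htor hX).mdifferentiableAt
    simpa using this
  rw [hn] at hJ
  simp only [curvatureOperator]
  linear_combination (norm := module) h1 + h2 + h3 + hJ

end Fields

end Curvature

/-! ### The Ricci tensor -/

section RicciTensor

open scoped Topology

variable {E : Type*} [NormedAddCommGroup E] [NormedSpace ℝ E] [FiniteDimensional ℝ E]
  {H : Type*} [TopologicalSpace H] {I : ModelWithCorners ℝ E H}
  {N : Type*} [TopologicalSpace N] [ChartedSpace H N] [IsManifold I ∞ N] [T2Space N]
  {Ω : ∀ x : N, TangentSpace I x →L[ℝ] TangentSpace I x →L[ℝ] ℝ}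
  {cov : CovariantDerivative I E (TangentSpace I : N → Type _)}

namespace IsSymplecticConnection

variable (hcov : IsSymplecticConnection I Ω cov)

include hcov

/-- The first Bianchi identity at a point. -/
theorem curvatureTensor_cyclic (x : N) (u v w : TangentSpace I x) :
    curvatureTensor cov x u v w + curvatureTensor cov x v w u
      + curvatureTensor cov x w u v = 0 := by
  simp only [curvatureTensor_eq_curvatureOperator]
  exact curvatureOperator_cyclic hcov.smooth hcov.torsionFree (.extend u) (.extend v) (.extend w)

theorem curvatureTensor_swap (x : N) (u v w : TangentSpace I x) :
    curvatureTensor cov x u v w = -curvatureTensor cov x v u w := by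
  simp only [curvatureTensor_eq_curvatureOperator]
  exact curvatureOperator_swap _ _ _ _

/-- By the first Bianchi identity, the curvature operator is tensorial in the third argument as
well, hence computes the curvature tensor. -/
theorem curvatureOperator_eq {X Y Z : ∀ y : N, TangentSpace I y} {x : N}
    (hX : IsSmoothFieldNear I X x) (hY : IsSmoothFieldNear I Y x) (hZ : IsSmoothFieldNear I Z x) :
    curvatureOperator cov X Y Z x = curvatureTensor cov x (X x) (Y x) (Z x) := by
  have h1 {X Y Z : ∀ y : N, TangentSpace I y}
      (hX : IsSmoothFieldNear I X x) (hZ : IsSmoothFieldNear I Z x) :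
      curvatureOperator cov X Y Z x =
        curvatureOperator cov (FiberBundle.extend E (X x)) Y Z x :=
    (tensorialAt_curvatureOperator hcov.smooth Y hZ).pointwise hX.mdifferentiableAt
      (IsSmoothFieldNear.extend (X x)).mdifferentiableAt (by simp)
  have h2 {X Y Z : ∀ y : N, TangentSpace I y}
      (hY : IsSmoothFieldNear I Y x) (hZ : IsSmoothFieldNear I Z x) :
      curvatureOperator cov X Y Z x =
        curvatureOperator cov X (FiberBundle.extend E (Y x)) Z x := by
    rw [curvatureOperator_swap, h1 hY hZ, ← curvatureOperator_swap]
  have h3 {X Y Z : ∀ y : N, TangentSpace I y} (hX : IsSmoothFieldNear I X x)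
      (hY : IsSmoothFieldNear I Y x) (hZ : IsSmoothFieldNear I Z x) :
      curvatureOperator cov X Y Z x =
        -curvatureOperator cov Y Z X x - curvatureOperator cov Z X Y x := by
    have h := curvatureOperator_cyclic hcov.smooth hcov.torsionFree hX hY hZ
    rw [add_assoc] at h
    rw [eq_neg_of_add_eq_zero_left h]
    abel
  have hX' := IsSmoothFieldNear.extend (I := I) (X x)
  have hY' := IsSmoothFieldNear.extend (I := I) (Y x)
  rw [h1 hX hZ, h2 hY hZ, h3 hX' hY' hZ, h2 hZ hX', h1 hZ hY', ← h3 hX' hY' (.extend (Z x)),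
    curvatureTensor_eq_curvatureOperator]

theorem isLinearMap_curvatureTensor_left (x : N) (v w : TangentSpace I x) :
    IsLinearMap ℝ (fun u => curvatureTensor cov x u v w) := by
  have h := tensorialAt_curvatureOperator hcov.smooth (FiberBundle.extend E v)
    (IsSmoothFieldNear.extend (I := I) w)
  have e (u : TangentSpace I x) : curvatureTensor cov x u v w = TensorialAt.mkHom _ x h u :=
    curvatureTensor_eq_curvatureOperator x u v w
  constructor <;> intros <;> simp only [e, map_add, map_smul]

theorem isLinearMap_curvatureTensor_middle (x : N) (u w : TangentSpace I x) :
    IsLinearMap ℝ (fun v => curvatureTensor cov x u v w) := by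
  have h := hcov.isLinearMap_curvatureTensor_left x u w
  constructor
  · intro v v'
    rw [hcov.curvatureTensor_swap, hcov.curvatureTensor_swap x u v,
      hcov.curvatureTensor_swap x u v', h.map_add, neg_add]
  · intro c v
    rw [hcov.curvatureTensor_swap, hcov.curvatureTensor_swap x u v, h.map_smul, smul_neg]

theorem isLinearMap_curvatureTensor_right (x : N) (u v : TangentSpace I x) :
    IsLinearMap ℝ (fun w => curvatureTensor cov x u v w) := by
  have h1 := hcov.isLinearMap_curvatureTensor_left x u v
  have h2 := hcov.isLinearMap_curvatureTensor_middle x v u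
  have e (w : TangentSpace I x) : curvatureTensor cov x u v w =
      -curvatureTensor cov x v w u - curvatureTensor cov x w u v := by
    have h := hcov.curvatureTensor_cyclic x u v w
    rw [add_assoc] at h
    rw [eq_neg_of_add_eq_zero_left h]
    abel
  constructor
  · intro w w'
    simp only [e, h1.map_add, h2.map_add]
    abel
  · intro c w
    simp only [e, h1.map_smul, h2.map_smul, smul_sub, smul_neg]

theorem isBilinearMap_ricciTensor (x : N) : IsBilinearMap ℝ (ricciTensor cov x) := by
  constructor <;> intros <;>
    simp only [ricciTensor, (hcov.isLinearMap_curvatureTensor_left x _ _).map_add,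
      (hcov.isLinearMap_curvatureTensor_left x _ _).map_smul,
      (hcov.isLinearMap_curvatureTensor_right x _ _).map_add,
      (hcov.isLinearMap_curvatureTensor_right x _ _).map_smul, map_add, map_smul,
      Finset.sum_add_distrib, Finset.smul_sum]

/-- The Ricci tensor is the trace of the curvature in any frame. -/
theorem ricciTensor_eq_sum {x : N} {ι : Type*} [Fintype ι] {f : ι → TangentSpace I x}
    {c : ι → Module.Dual ℝ (TangentSpace I x)} (h : IsCoordFrame f c) (u w : TangentSpace I x) :
    ricciTensor cov x u w = ∑ i, c i (curvatureTensor cov x u (f i) w) :=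
  (Module.finBasis ℝ (TangentSpace I x)).isCoordFrame.sum_apply_eq h
    (hcov.isLinearMap_curvatureTensor_middle x u w).mk'

variable (hΩ : IsSymplecticForm I Ω)

include hΩ

theorem ricciTensor_eq_ricciEndo (x : N) (u v : TangentSpace I x) :
    ricciTensor cov x u v = Ω x u (ricciEndo Ω cov x v) := by
  have hB := hcov.isBilinearMap_ricciTensor x
  obtain ⟨z, hz⟩ := (hΩ.isLinearSymplectic x).exists_sharp (-hB.toLinearMap.flip v)
  refine Classical.epsilon_spec (p := fun z => ∀ w, ricciTensor cov x w v = Ω x w z)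
    ⟨z, fun w => ?_⟩ u
  have h1 := hz w
  rw [(hΩ.isLinearSymplectic x).swap] at h1
  exact (neg_injective h1).symm

/-- The Ricci endomorphism as a linear map. -/
def ricciEndoMap (x : N) : TangentSpace I x →ₗ[ℝ] TangentSpace I x where
  toFun := ricciEndo Ω cov x
  map_add' v w := (hΩ.isLinearSymplectic x).eq_of_forall_right fun u => by
    rw [map_add, ← hcov.ricciTensor_eq_ricciEndo hΩ, ← hcov.ricciTensor_eq_ricciEndo hΩ,
      ← hcov.ricciTensor_eq_ricciEndo hΩ, (hcov.isBilinearMap_ricciTensor x).add_right]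
  map_smul' c v := (hΩ.isLinearSymplectic x).eq_of_forall_right fun u => by
    rw [RingHom.id_apply, map_smul, ← hcov.ricciTensor_eq_ricciEndo hΩ,
      ← hcov.ricciTensor_eq_ricciEndo hΩ, (hcov.isBilinearMap_ricciTensor x).smul_right]

/-- The first Bianchi identity for a curvature of Ricci type says
`∑_cyc (Ric(Z, Y) - Ric(Y, Z)) X = 0`; in dimension at least three one can choose `X` outside the
span of `Y` and `Z`. -/
theorem ricciTensor_symm {n : ℕ} (hRic : IsRicciType Ω cov n) (hE : 2 < Module.finrank ℝ E) (x : N)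
    (v w : TangentSpace I x) : ricciTensor cov x v w = ricciTensor cov x w v := by
  classical
  have hspan : Submodule.span ℝ {v, w} ≠ ⊤ := by
    intro h
    have h1 : Module.finrank ℝ (Submodule.span ℝ ({v, w} : Set (TangentSpace I x))) ≤ 2 :=
      (finrank_span_le_card _).trans (by simpa using Finset.card_le_two (a := v) (b := w))
    rw [h, finrank_top] at h1
    exact absurd h1 (not_le.2 hE)
  obtain ⟨u, -, hu⟩ := SetLike.exists_of_lt (lt_top_iff_ne_top.2 hspan)
  have key : (ricciTensor cov x w v - ricciTensor cov x v w) • u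
      + (ricciTensor cov x u w - ricciTensor cov x w u) • v
      + (ricciTensor cov x v u - ricciTensor cov x u v) • w = 0 := by
    have h := hcov.curvatureTensor_cyclic x u v w
    rw [hRic, hRic, hRic, ← smul_add, ← smul_add] at h
    have hn : -(1 / (2 * ((n : ℝ) + 1))) ≠ 0 := by
      rw [neg_ne_zero]; positivity
    have h2 := (smul_eq_zero.1 h).resolve_left hn
    have hsw (a b : TangentSpace I x) : Ω x a b = -Ω x b a := (hΩ.isLinearSymplectic x).swap a b
    simp only [hcov.ricciTensor_eq_ricciEndo hΩ]
    rw [hsw (ricciEndo Ω cov x u), hsw (ricciEndo Ω cov x v), hsw (ricciEndo Ω cov x w),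
      hsw (ricciEndo Ω cov x u), hsw (ricciEndo Ω cov x v), hsw (ricciEndo Ω cov x w),
      hsw v u, hsw w v, hsw w u] at h2
    rw [← h2]
    module
  by_contra hne
  have hc : ricciTensor cov x w v - ricciTensor cov x v w ≠ 0 := sub_ne_zero.2 (Ne.symm hne)
  apply hu
  rw [Submodule.mem_span_pair]
  refine ⟨-(ricciTensor cov x w v - ricciTensor cov x v w)⁻¹ *
    (ricciTensor cov x u w - ricciTensor cov x w u),
    -(ricciTensor cov x w v - ricciTensor cov x v w)⁻¹ *
      (ricciTensor cov x v u - ricciTensor cov x u v), ?_⟩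
  have h3 := congr((ricciTensor cov x w v - ricciTensor cov x v w)⁻¹ • $key)
  rw [smul_add, smul_add, inv_smul_smul₀ hc, smul_zero, add_assoc] at h3
  refine Eq.trans ?_ (eq_neg_of_add_eq_zero_left h3).symm
  module

end IsSymplecticConnection

end RicciTensor

/-! ### Smoothness of the Poisson bracket and of the Ricci term -/

section Gram

variable {V : Type*} [AddCommGroup V] [Module ℝ V] [Module.Finite ℝ V] {β : V → V → ℝ}
  {ι : Type*} [Fintype ι] [DecidableEq ι]

/-- The matrix of a bilinear form in a family of vectors. -/
def gramMatrix (β : V → V → ℝ) (f : ι → V) : Matrix ι ι ℝ := Matrix.of fun i j => β (f i) (f j)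

namespace IsLinearSymplectic

variable (hβ : IsLinearSymplectic β) (b : Module.Basis ι ℝ V)

include hβ

theorem poissonTensor_mul_gramMatrix :
    (Matrix.of fun i j => poissonTensor β (b.coord i) (b.coord j)) * gramMatrix β b = 1 := by
  ext i k
  have h := hβ.sharp_apply (b.coord i) (b k)
  rw [sharp_eq_sum b.isCoordFrame] at h
  have e : β (∑ j, poissonTensor β (b.coord i) (b.coord j) • b j) (b k) =
      ∑ j, poissonTensor β (b.coord i) (b.coord j) * β (b j) (b k) := by
    change hβ.bilin.toLinearMap.flip (b k) _ = _
    simp only [map_sum, map_smul]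
    rfl
  rw [e] at h
  rw [Matrix.mul_apply]
  refine h.trans ?_
  simp [Matrix.one_apply, Finsupp.single_apply, eq_comm]

/-- The inverse of the Gram matrix is the matrix of the Poisson tensor in the dual basis. -/
theorem inv_gramMatrix (i j : ι) :
    (gramMatrix β b)⁻¹ i j = poissonTensor β (b.coord i) (b.coord j) := by
  rw [Matrix.inv_eq_left_inv (hβ.poissonTensor_mul_gramMatrix b)]
  rfl

theorem det_gramMatrix_ne_zero : (gramMatrix β b).det ≠ 0 :=
  (Matrix.isUnit_det_of_left_inverse (hβ.poissonTensor_mul_gramMatrix b)).ne_zero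

theorem sharp_coord (i : ι) :
    sharp β (b.coord i) = ∑ j, (gramMatrix β b)⁻¹ i j • b j := by
  rw [sharp_eq_sum b.isCoordFrame]
  simp only [hβ.inv_gramMatrix b]

theorem coord_eq (i : ι) (w : V) :
    b.coord i w = ∑ j, (gramMatrix β b)⁻¹ i j * β (b j) w := by
  rw [← hβ.sharp_apply (b.coord i) w, hβ.sharp_coord b]
  change hβ.bilin.toLinearMap.flip w _ = _
  simp only [map_sum, map_smul]
  rfl

end IsLinearSymplectic

theorem contDiff_matrix_det : ContDiff ℝ ∞ (fun G : ι → ι → ℝ => (Matrix.of G).det) := by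
  simp_rw [Matrix.det_apply]
  refine ContDiff.sum fun σ _ => ContDiff.const_smul _ (contDiff_prod fun i _ => ?_)
  exact (contDiff_apply_apply ℝ ℝ (σ i) i)

/-- The entries of the inverse matrix are smooth functions on the invertible matrices. -/
theorem contDiffAt_matrix_inv (i j : ι) {G : ι → ι → ℝ} (hG : (Matrix.of G).det ≠ 0) :
    ContDiffAt ℝ ∞ (fun G : ι → ι → ℝ => (Matrix.of G)⁻¹ i j) G := by
  simp_rw [Matrix.inv_def, Ring.inverse_eq_inv', Matrix.smul_apply, Matrix.adjugate_apply,
    smul_eq_mul]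
  refine (contDiff_matrix_det.contDiffAt.inv hG).mul ?_
  have h : ContDiff ℝ ∞ (fun G : ι → ι → ℝ =>
      (fun k l => (Matrix.of G).updateRow j (Pi.single i 1) k l)) := by
    refine contDiff_pi.2 fun k => contDiff_pi.2 fun l => ?_
    by_cases hk : k = j
    · subst hk
      simp only [Matrix.updateRow_self]
      exact contDiff_const
    · simp only [Matrix.updateRow_ne hk]
      exact contDiff_apply_apply ℝ ℝ k l
  exact (contDiff_matrix_det.comp h).contDiffAt

end Gram

section LocalFrames

open scoped Topology

variable {E : Type*} [NormedAddCommGroup E] [NormedSpace ℝ E] [FiniteDimensional ℝ E]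
  {H : Type*} [TopologicalSpace H] {I : ModelWithCorners ℝ E H}
  {N : Type*} [TopologicalSpace N] [ChartedSpace H N] [IsManifold I ∞ N]
  {Ω : ∀ x : N, TangentSpace I x →L[ℝ] TangentSpace I x →L[ℝ] ℝ}

variable (I) in
/-- Around every point there is a smooth frame of the tangent bundle. -/
theorem exists_smooth_frame (x : N) :
    ∃ f : Fin (Module.finrank ℝ E) → ∀ y : N, TangentSpace I y,
      (∀ i, IsSmoothFieldNear I (f i) x) ∧
        ∀ᶠ y in 𝓝 x, ∃ b : Module.Basis (Fin (Module.finrank ℝ E)) ℝ (TangentSpace I y),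
          ∀ i, f i y = b i := by
  let e := trivializationAt E (TangentSpace I : N → Type _) x
  have hx : ∀ᶠ y in 𝓝 x, y ∈ e.baseSet :=
    e.open_baseSet.mem_nhds (FiberBundle.mem_baseSet_trivializationAt' x)
  refine ⟨e.localFrame (Module.finBasis ℝ E), fun i => ?_, ?_⟩
  · filter_upwards [hx] with y hy
    exact contMDiffAt_localFrame_of_mem ∞ e (Module.finBasis ℝ E) i hy
  · filter_upwards [hx] with y hy
    exact ⟨e.basisAt (Module.finBasis ℝ E) hy, fun i => e.localFrame_apply_of_mem_baseSet _ hy⟩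

namespace IsSymplecticForm

variable (hΩ : IsSymplecticForm I Ω)

include hΩ

theorem contMDiffAt_apply {X Y : ∀ y : N, TangentSpace I y} {x : N}
    (hX : IsSmoothFieldNear I X x) (hY : IsSmoothFieldNear I Y x) :
    ContMDiffAt I 𝓘(ℝ, ℝ) ∞ (fun y => Ω y (X y) (Y y)) x := by
  have h : ContMDiffAt I (I.prod 𝓘(ℝ, ℝ)) ∞
      (fun y => Bundle.TotalSpace.mk' ℝ (E := Bundle.Trivial N ℝ) y (Ω y (X y) (Y y))) x :=
    ContMDiffAt.clm_bundle_apply₂ (F₁ := E) (F₂ := E) (F₃ := ℝ)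
      (E₃ := Bundle.Trivial N ℝ) hΩ.smooth.contMDiffAt hX.contMDiffAt hY.contMDiffAt
  simp only [Bundle.contMDiffAt_totalSpace] at h
  exact h.2

theorem contMDiffAt_inv_gramMatrix {ι : Type*} [Fintype ι] [DecidableEq ι]
    {f : ι → ∀ y : N, TangentSpace I y} {x : N} (hf : ∀ i, IsSmoothFieldNear I (f i) x)
    (b : Module.Basis ι ℝ (TangentSpace I x)) (hb : ∀ i, f i x = b i) (i j : ι) :
    ContMDiffAt I 𝓘(ℝ, ℝ) ∞
      (fun y => (gramMatrix (fun v w => Ω y v w) (fun k => f k y))⁻¹ i j) x := by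
  have h1 : ContMDiffAt I 𝓘(ℝ, ι → ι → ℝ) ∞ (fun y k l => Ω y (f k y) (f l y)) x :=
    contMDiffAt_pi_space.2 fun k => contMDiffAt_pi_space.2 fun l =>
      hΩ.contMDiffAt_apply (hf k) (hf l)
  have h2 := (hΩ.isLinearSymplectic x).det_gramMatrix_ne_zero b
  have h3 : (fun k => f k x) = b := funext hb
  rw [← h3] at h2
  exact (contDiffAt_matrix_inv i j h2).contMDiffAt.comp x h1

/-- The Poisson bracket of smooth functions is smooth. -/
theorem isSmoothFun_poissonBracket {u v : N → ℂ} (hu : IsSmoothFun I u) (hv : IsSmoothFun I v) :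
    IsSmoothFun I (poissonBracket I (fun x v w => Ω x v w) u v) := by
  intro x
  obtain ⟨f, hf, hb⟩ := exists_smooth_frame I x
  obtain ⟨b₀, hb₀⟩ := hb.self_of_nhds
  have h : ContMDiffAt I 𝓘(ℝ, ℂ) ∞ (fun y => ∑ i, ∑ j,
      (gramMatrix (fun v w => Ω y v w) (fun k => f k y))⁻¹ i j •
        (mvfderiv I u y (f i y) * mvfderiv I v y (f j y))) x :=
    contMDiffAt_finsetSum fun i _ => contMDiffAt_finsetSum fun j _ =>
      (hΩ.contMDiffAt_inv_gramMatrix hf b₀ hb₀ i j).smul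
        ((contDiff_mul (𝕜 := ℝ) (𝔸 := ℂ)).contMDiff.contMDiffAt.comp x
          ((contMDiffAt_mvfderiv_apply hu (hf i).contMDiffAt).prodMk_space
            (contMDiffAt_mvfderiv_apply hv (hf j).contMDiffAt)))
  refine h.congr_of_eventuallyEq ?_
  filter_upwards [hb] with y ⟨b, hb⟩
  have hβ := hΩ.isLinearSymplectic y
  have h3 : (fun k => f k y) = b := funext hb
  refine (hβ.crossPairing_one_eq b.isCoordFrame (mvfderiv I u y).toLinearMap
    (mvfderiv I v y).toLinearMap).trans ?_
  simp only [hβ.sharp_coord b, map_sum, map_smul, Finset.mul_sum, hb,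
    ContinuousLinearMap.coe_coe, mul_smul_comm]

end IsSymplecticForm

namespace IsSymplecticConnection

variable [T2Space N] {cov : CovariantDerivative I E (TangentSpace I : N → Type _)}
  (hcov : IsSymplecticConnection I Ω cov) (hΩ : IsSymplecticForm I Ω)

include hcov

theorem isSmoothFieldNear_curvatureOperator {X Y Z : ∀ y : N, TangentSpace I y} {x : N}
    (hX : IsSmoothFieldNear I X x) (hY : IsSmoothFieldNear I Y x) (hZ : IsSmoothFieldNear I Z x) :
    IsSmoothFieldNear I (curvatureOperator cov X Y Z) x :=
  (((hZ.cov_apply hcov.smooth hY).cov_apply hcov.smooth hX).sub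
    ((hZ.cov_apply hcov.smooth hX).cov_apply hcov.smooth hY)).sub
    (hZ.cov_apply hcov.smooth (hX.mlieBracket hcov.smooth hcov.torsionFree hY))

include hΩ

/-- The trace defining the Ricci tensor is taken in a local frame, with the dual frame expressed
through the inverse Gram matrix. -/
theorem contMDiffAt_ricciTensor {X Y : ∀ y : N, TangentSpace I y} {x : N}
    (hX : IsSmoothFieldNear I X x) (hY : IsSmoothFieldNear I Y x) :
    ContMDiffAt I 𝓘(ℝ, ℝ) ∞ (fun y => ricciTensor cov y (X y) (Y y)) x := by
  obtain ⟨f, hf, hb⟩ := exists_smooth_frame I x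
  obtain ⟨b₀, hb₀⟩ := hb.self_of_nhds
  have h : ContMDiffAt I 𝓘(ℝ, ℝ) ∞ (fun y => ∑ i, ∑ j,
      (gramMatrix (fun v w => Ω y v w) (fun k => f k y))⁻¹ i j •
        Ω y (f j y) (curvatureOperator cov X (f i) Y y)) x :=
    contMDiffAt_finsetSum fun i _ => contMDiffAt_finsetSum fun j _ =>
      (hΩ.contMDiffAt_inv_gramMatrix hf b₀ hb₀ i j).smul
        (hΩ.contMDiffAt_apply (hf j) (hcov.isSmoothFieldNear_curvatureOperator hX (hf i) hY))
  refine h.congr_of_eventuallyEq ?_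
  have hfe : ∀ᶠ y in 𝓝 x, ∀ i, IsSmoothFieldNear I (f i) y :=
    Filter.eventually_all.2 fun i => (hf i).eventually
  filter_upwards [hb, hfe, hX.eventually, hY.eventually] with y ⟨b, hb⟩ h1 h2 h3
  have h4 : (fun k => f k y) = b := funext hb
  rw [hcov.ricciTensor_eq_sum b.isCoordFrame]
  simp only [(hΩ.isLinearSymplectic y).coord_eq b,
    hcov.curvatureOperator_eq h2 (h1 _) h3, hb, smul_eq_mul]

/-- The contraction of the Ricci tensor with the differentials of smooth functions is smooth. -/
theorem isSmoothFun_sharpPairing_ricciTensor {u v : N → ℂ} (hu : IsSmoothFun I u)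
    (hv : IsSmoothFun I v) :
    IsSmoothFun I (fun x => sharpPairing (fun v w => Ω x v w) (fun v w => ricciTensor cov x v w)
      (fun w => mvfderiv I u x w) (fun w => mvfderiv I v x w)) := by
  intro x
  obtain ⟨f, hf, hb⟩ := exists_smooth_frame I x
  obtain ⟨b₀, hb₀⟩ := hb.self_of_nhds
  have h : ContMDiffAt I 𝓘(ℝ, ℂ) ∞ (fun y => ∑ i, ∑ j, ∑ m, ∑ k,
      (-((gramMatrix (fun v w => Ω y v w) (fun k => f k y))⁻¹ m k *
        (ricciTensor cov y (f k y) (f i y) *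
          (gramMatrix (fun v w => Ω y v w) (fun k => f k y))⁻¹ i j))) •
        (mvfderiv I u y (f m y) * mvfderiv I v y (f j y))) x :=
    contMDiffAt_finsetSum fun i _ => contMDiffAt_finsetSum fun j _ =>
      contMDiffAt_finsetSum fun m _ => contMDiffAt_finsetSum fun k _ =>
      ((((hΩ.contMDiffAt_inv_gramMatrix hf b₀ hb₀ m k).smul
        ((hcov.contMDiffAt_ricciTensor hΩ (hf k) (hf i)).smul
          (hΩ.contMDiffAt_inv_gramMatrix hf b₀ hb₀ i j)))).neg).smul
        ((contDiff_mul (𝕜 := ℝ) (𝔸 := ℂ)).contMDiff.contMDiffAt.comp x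
          ((contMDiffAt_mvfderiv_apply hu (hf m).contMDiffAt).prodMk_space
            (contMDiffAt_mvfderiv_apply hv (hf j).contMDiffAt)))
  refine h.congr_of_eventuallyEq ?_
  filter_upwards [hb] with y ⟨b, hb⟩
  have hβ := hΩ.isLinearSymplectic y
  have h3 : (fun k => f k y) = b := funext hb
  refine (hβ.sharpPairing_eq b.isCoordFrame (hcov.ricciEndoMap hΩ y)
    (fun v w => hcov.ricciTensor_eq_ricciEndo hΩ y v w) (mvfderiv I u y).toLinearMap
    (mvfderiv I v y).toLinearMap).trans ?_
  have hρ (i) : hcov.ricciEndoMap hΩ y (b i) = ∑ m, ∑ k,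
      ((gramMatrix (fun v w => Ω y v w) b)⁻¹ m k * ricciTensor cov y (b k) (b i)) • b m := by
    conv_lhs => rw [← b.sum_repr (hcov.ricciEndoMap hΩ y (b i))]
    refine Finset.sum_congr rfl fun m _ => ?_
    rw [← Finset.sum_smul]
    congr 1
    refine (hβ.coord_eq b m _).trans (Finset.sum_congr rfl fun k _ => ?_)
    rw [hcov.ricciTensor_eq_ricciEndo hΩ]
    rfl
  simp only [hβ.sharp_coord b, hρ, map_sum, map_smul, Finset.mul_sum, Finset.sum_mul, hb,
    ContinuousLinearMap.coe_coe, mul_smul_comm, smul_mul_assoc, ← Finset.sum_neg_distrib,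
    Finset.smul_sum]
  refine Finset.sum_congr rfl fun i _ => Finset.sum_congr rfl fun j _ =>
    Finset.sum_congr rfl fun m _ => Finset.sum_congr rfl fun k _ => ?_
  module

end IsSymplecticConnection

end LocalFrames

/-! ### Differential operators of order at most one -/

section DiffOp

variable {E : Type*} [NormedAddCommGroup E] [NormedSpace ℝ E]
  {H : Type*} [TopologicalSpace H] {I : ModelWithCorners ℝ E H}
  {N : Type*} [TopologicalSpace N] [ChartedSpace H N]

theorem IsSmoothFun.mdifferentiableAt {f : N → ℂ} (hf : IsSmoothFun I f) (x : N) :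
    MDifferentiableAt I 𝓘(ℝ, ℂ) f x :=
  ContMDiffAt.mdifferentiableAt (ContMDiff.contMDiffAt hf) (by simp)

theorem isSmoothFun_const (c : ℂ) : IsSmoothFun I (fun _ : N => c) := contMDiff_const

theorem IsSmoothFun.const_mul {f : N → ℂ} (hf : IsSmoothFun I f) (c : ℂ) :
    IsSmoothFun I (fun x => c * f x) :=
  (isSmoothFun_const c).mul hf

theorem mvfderiv_const_mul_apply {f : N → ℂ} {x : N} (hf : MDifferentiableAt I 𝓘(ℝ, ℂ) f x) (c : ℂ)
    (v : TangentSpace I x) :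
    mvfderiv I (fun y => c * f y) x v = c * mvfderiv I f x v := by
  rw [mvfderiv_mul_apply mdifferentiableAt_const hf, mvfderiv_const]
  simp

/-- An operator that agrees on smooth functions with a derivation of the algebra of smooth
functions is a differential operator of order at most one. -/
theorem IsDiffOp.one_of_derivation {D D' : (N → ℂ) → N → ℂ}
    (hD : ∀ u, IsSmoothFun I u → D u = D' u)
    (smooth : ∀ u, IsSmoothFun I u → IsSmoothFun I (D' u))
    (add : ∀ u v, IsSmoothFun I u → IsSmoothFun I v → D' (u + v) = D' u + D' v)
    (smul : ∀ (c : ℂ) u, IsSmoothFun I u → D' (c • u) = c • D' u)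
    (leibniz : ∀ f u, IsSmoothFun I f → IsSmoothFun I u → D' (f * u) = f * D' u + u * D' f) :
    IsDiffOp I 1 D := by
  have hadd {u v : N → ℂ} (hu : IsSmoothFun I u) (hv : IsSmoothFun I v) : IsSmoothFun I (u + v) :=
    ContMDiff.add hu hv
  have hsmul {u : N → ℂ} (c : ℂ) (hu : IsSmoothFun I u) : IsSmoothFun I (c • u) := hu.const_mul c
  have hmul {u v : N → ℂ} (hu : IsSmoothFun I u) (hv : IsSmoothFun I v) : IsSmoothFun I (u * v) :=
    hu.mul hv
  have hcomm (f : N → ℂ) (hf : IsSmoothFun I f) (u : N → ℂ) (hu : IsSmoothFun I u) :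
      D (f * u) - f * D u = u * D' f := by
    rw [hD _ (hmul hf hu), hD _ hu, leibniz f u hf hu, add_sub_cancel_left]
  refine ⟨⟨fun u hu => ?_, fun u v hu hv => ?_, fun c u hu => ?_⟩, fun f hf =>
    ⟨⟨fun u hu => ?_, fun u v hu hv => ?_, fun c u hu => ?_⟩, fun g u hg hu => ?_⟩⟩
  · rw [hD u hu]
    exact smooth u hu
  · rw [hD _ (hadd hu hv), hD _ hu, hD _ hv, add u v hu hv]
  · rw [hD _ (hsmul c hu), hD _ hu, smul c u hu]
  · rw [hcomm f hf u hu]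
    exact hmul hu (smooth f hf)
  · rw [hcomm f hf _ (hadd hu hv), hcomm f hf u hu, hcomm f hf v hv, add_mul]
  · rw [hcomm f hf _ (hsmul c hu), hcomm f hf u hu, smul_mul_assoc]
  · dsimp only
    rw [hcomm f hf _ (hmul hg hu), hcomm f hf u hu, mul_assoc]

/-- For an operator of order at most one, the double commutator with multiplications vanishes on
constants. -/
theorem IsDiffOp.apply_mul {D : (N → ℂ) → N → ℂ} (hD : IsDiffOp I 1 D) {f g : N → ℂ}
    (hf : IsSmoothFun I f) (hg : IsSmoothFun I g) :
    D (f * g) = f * D g + g * D f - f * g * D 1 := by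
  have h := (hD.2 f hf).2 g 1 hg (isSmoothFun_const 1)
  simp only [mul_one] at h
  rw [sub_eq_iff_eq_add.1 h]
  ring

variable [IsManifold I ∞ N] [FiniteDimensional ℝ E]
  {Ω : ∀ x : N, TangentSpace I x →L[ℝ] TangentSpace I x →L[ℝ] ℝ}
  {cov : CovariantDerivative I E (TangentSpace I : N → Type _)}

/-- The Ricci term of the second cochain is a biderivation. -/
theorem IsSymplecticConnection.isBidiffOp_ricci [T2Space N]
    (hcov : IsSymplecticConnection I Ω cov) (hΩ : IsSymplecticForm I Ω) (c : ℂ)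
    {B : (N → ℂ) → (N → ℂ) → N → ℂ}
    (hB : ∀ u v, IsSmoothFun I u → IsSmoothFun I v → B u v = fun x =>
      c * sharpPairing (fun v w => Ω x v w) (fun v w => ricciTensor cov x v w)
        (fun w => mvfderiv I u x w) (fun w => mvfderiv I v x w)) :
    IsBidiffOp I 1 B := by
  constructor
  · intro v hv
    refine IsDiffOp.one_of_derivation (fun u hu => hB u v hu hv)
      (fun u hu => (hcov.isSmoothFun_sharpPairing_ricciTensor hΩ hu hv).const_mul c) ?_ ?_ ?_
    · intro u u' hu hu'
      ext x
      simp only [sharpPairing, Pi.add_apply, Finset.mul_sum,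
        mvfderiv_add (hu.mdifferentiableAt x) (hu'.mdifferentiableAt x),
        add_apply, mul_add, add_mul, Finset.sum_add_distrib]
    · intro r u hu
      ext x
      have e : r • u = fun y => r * u y := rfl
      simp only [sharpPairing, Pi.smul_apply, smul_eq_mul, Finset.mul_sum, e,
        mvfderiv_const_mul_apply (hu.mdifferentiableAt x)]
      refine Finset.sum_congr rfl fun i _ => Finset.sum_congr rfl fun j _ => ?_
      ring
    · intro f u hf hu
      ext x
      have e : f * u = fun y => f y * u y := rfl
      simp only [sharpPairing, Pi.add_apply, Pi.mul_apply, Finset.mul_sum, e,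
        mvfderiv_mul_apply (hf.mdifferentiableAt x) (hu.mdifferentiableAt x),
        ← Finset.sum_add_distrib]
      refine Finset.sum_congr rfl fun i _ => Finset.sum_congr rfl fun j _ => ?_
      ring
  · intro v hv
    refine IsDiffOp.one_of_derivation (fun u hu => hB v u hv hu)
      (fun u hu => (hcov.isSmoothFun_sharpPairing_ricciTensor hΩ hv hu).const_mul c) ?_ ?_ ?_
    · intro u u' hu hu'
      ext x
      simp only [sharpPairing, Pi.add_apply, Finset.mul_sum,
        mvfderiv_add (hu.mdifferentiableAt x) (hu'.mdifferentiableAt x),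
        add_apply, mul_add, Finset.sum_add_distrib]
    · intro r u hu
      ext x
      have e : r • u = fun y => r * u y := rfl
      simp only [sharpPairing, Pi.smul_apply, smul_eq_mul, Finset.mul_sum, e,
        mvfderiv_const_mul_apply (hu.mdifferentiableAt x)]
      refine Finset.sum_congr rfl fun i _ => Finset.sum_congr rfl fun j _ => ?_
      ring
    · intro f u hf hu
      ext x
      have e : f * u = fun y => f y * u y := rfl
      simp only [sharpPairing, Pi.add_apply, Pi.mul_apply, Finset.mul_sum, e,
        mvfderiv_mul_apply (hf.mdifferentiableAt x) (hu.mdifferentiableAt x),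
        ← Finset.sum_add_distrib]
      refine Finset.sum_congr rfl fun i _ => Finset.sum_congr rfl fun j _ => ?_
      ring

/-! ### The connection is determined by the second cochain -/

open scoped Topology

/-- Every covector is the differential of a smooth function. -/
theorem exists_isSmoothFun_mvfderiv_eq [T2Space N] (x : N) (a : Module.Dual ℝ (TangentSpace I x)) :
    ∃ f : N → ℂ, IsSmoothFun I f ∧ ∀ v, mvfderiv I f x v = (a v : ℂ) := by
  have hL := isInvertible_mfderiv_extChartAt (I := I) (mem_extChartAt_source (I := I) x)
  obtain ⟨L₀, hL⟩ := hL
  let L : TangentSpace I x ≃L[ℝ] E := L₀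
  let a' : E →ₗ[ℝ] ℝ := a ∘ₗ L.symm.toLinearEquiv.toLinearMap
  let ℓ : E →L[ℝ] ℂ := Complex.ofRealCLM ∘L LinearMap.toContinuousLinearMap a'
  obtain ⟨φ⟩ := (inferInstance : Nonempty (SmoothBumpFunction I x))
  refine ⟨fun y => φ y • ℓ (extChartAt I x y), φ.contMDiff_smul
    (ℓ.contDiff.contMDiff.comp_contMDiffOn contMDiffOn_extChartAt), fun v => ?_⟩
  have h1 : (fun y => φ y • ℓ (extChartAt I x y)) =ᶠ[𝓝 x] fun y => ℓ (extChartAt I x y) := by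
    filter_upwards [φ.eventuallyEq_one] with y hy
    rw [hy, Pi.one_apply, one_smul]
  rw [mvfderiv_congr h1, mvfderiv_clm_comp ℓ
    ((contMDiffAt_extChartAt (n := 1)).mdifferentiableAt one_ne_zero)]
  have h2 : mvfderiv I (extChartAt I x) x v = L v := congr($hL.symm v)
  rw [h2]
  have h3 : a' (L v) = a v := congrArg a (L.symm_apply_apply v)
  exact congrArg Complex.ofReal h3

/-- The Leibniz rule for the Hessian. -/
theorem hess_mul {f g : N → ℂ} (hf : IsSmoothFun I f) (hg : IsSmoothFun I g) (x : N)
    (v w : TangentSpace I x) :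
    hess (fun Y x v => cov Y x v) (fun y => f y * g y) x v w =
      f x * hess (fun Y x v => cov Y x v) g x v w + g x * hess (fun Y x v => cov Y x v) f x v w
        + (mvfderiv I f x v * mvfderiv I g x w + mvfderiv I g x v * mvfderiv I f x w) := by
  have hW := (IsSmoothFieldNear.extend (I := I) w).mdifferentiableAt
  have h1 := mdifferentiableAt_mvfderiv_apply hf hW
  have h2 := mdifferentiableAt_mvfderiv_apply hg hW
  have hmul {a b : N → ℂ} (ha : MDifferentiableAt I 𝓘(ℝ, ℂ) a x)
      (hb : MDifferentiableAt I 𝓘(ℝ, ℂ) b x) :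
      MDifferentiableAt I 𝓘(ℝ, ℂ) (fun y => a y * b y) x :=
    (ha.hasMFDerivAt.mul hb.hasMFDerivAt).mdifferentiableAt
  simp only [hess, mvfderiv_mul_apply (hf.mdifferentiableAt _) (hg.mdifferentiableAt _)]
  rw [mvfderiv_fun_add (hmul (hf.mdifferentiableAt x) h2) (hmul (hg.mdifferentiableAt x) h1),
    add_apply, mvfderiv_mul_apply (hf.mdifferentiableAt x) h2,
    mvfderiv_mul_apply (hg.mdifferentiableAt x) h1]
  simp only [FiberBundle.extend_apply_self]
  ring

/-- The symbol of the second cochain in its second argument is the symmetrized Hessian of the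
first argument, evaluated on Hamiltonian vectors. -/
theorem weylCochain_two_mul (cov : CovariantDerivative I E (TangentSpace I : N → Type _))
    (hΩ : IsSymplecticForm I Ω) {u f g : N → ℂ} (hu : IsSmoothFun I u)
    (hf : IsSmoothFun I f) (hg : IsSmoothFun I g) {x : N} {a b : Module.Dual ℝ (TangentSpace I x)}
    (ha : ∀ v, mvfderiv I f x v = (a v : ℂ)) (hb : ∀ v, mvfderiv I g x v = (b v : ℂ)) :
    weylCochain (fun x v w => Ω x v w) (fun Y x v => cov Y x v) 2 u (f * g) x =
      f x * weylCochain (fun x v w => Ω x v w) (fun Y x v => cov Y x v) 2 u g x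
        + g x * weylCochain (fun x v w => Ω x v w) (fun Y x v => cov Y x v) 2 u f x
        + 2 * symHess (isBilinearMap_hess cov hu x) (sharp (fun v w => Ω x v w) a)
            (sharp (fun v w => Ω x v w) b) := by
  have hβ := hΩ.isLinearSymplectic x
  let A := symHess (isBilinearMap_hess cov hu x)
  have hA (v w) : A v w = A w v := by
    simp only [A, symHess_apply]; ring
  let e := Module.finBasis ℝ (TangentSpace I x)
  have hW {h : N → ℂ} (hh : IsSmoothFun I h) :
      weylCochain (fun x v w => Ω x v w) (fun Y x v => cov Y x v) 2 u h x =
        ∑ i, ∑ k, A (e i) (e k) * symHess (isBilinearMap_hess cov hh x)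
          (sharp (fun v w => Ω x v w) (e.coord i)) (sharp (fun v w => Ω x v w) (e.coord k)) := by
    rw [weylCochain_two]
    exact IsLinearSymplectic.crossPairing_two_finBasis A (symHess (isBilinearMap_hess cov hh x))
  -- the components of a Hamiltonian vector are the negatives of those of its covector
  -- evaluated on the dual basis, and the two signs cancel
  have hexp (c d : Module.Dual ℝ (TangentSpace I x)) :
      A (sharp (fun v w => Ω x v w) c) (sharp (fun v w => Ω x v w) d) =
        ∑ i, ∑ k, A (e i) (e k) * ((c (sharp (fun v w => Ω x v w) (e.coord i)) : ℂ) *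
          (d (sharp (fun v w => Ω x v w) (e.coord k)) : ℂ)) := by
    have h1 (c : Module.Dual ℝ (TangentSpace I x)) : sharp (fun v w => Ω x v w) c =
        ∑ i, (-c (sharp (fun v w => Ω x v w) (e.coord i))) • e i := by
      conv_lhs => rw [← e.sum_repr (sharp (fun v w => Ω x v w) c)]
      refine Finset.sum_congr rfl fun i _ => ?_
      congr 1
      rw [hβ.apply_sharp_swap, neg_neg]
      rfl
    rw [h1 c, h1 d]
    simp only [map_sum, LinearMap.sum_apply, map_smul, LinearMap.smul_apply, Complex.real_smul,
      Complex.ofReal_neg]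
    simp only [Finset.mul_sum]
    rw [Finset.sum_comm]
    refine Finset.sum_congr rfl fun i _ => Finset.sum_congr rfl fun k _ => ?_
    ring
  have hfg : IsSmoothFun I (f * g) := hf.mul hg
  have e2 : 2 * A (sharp (fun v w => Ω x v w) a) (sharp (fun v w => Ω x v w) b) =
      A (sharp (fun v w => Ω x v w) a) (sharp (fun v w => Ω x v w) b)
        + A (sharp (fun v w => Ω x v w) b) (sharp (fun v w => Ω x v w) a) := by
    rw [hA (sharp (fun v w => Ω x v w) b)]; ring
  change _ = _ + 2 * A _ _
  rw [e2, hexp, hexp, hW hfg, hW hf, hW hg]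
  simp only [Finset.mul_sum, ← Finset.sum_add_distrib]
  refine Finset.sum_congr rfl fun i _ => Finset.sum_congr rfl fun k _ => ?_
  have hp (v w : TangentSpace I x) : hess (fun Y x v => cov Y x v) (f * g) x v w = _ :=
    hess_mul (cov := cov) hf hg x v w
  simp only [symHess_apply, hp, ha, hb]
  ring

/-- The second cochain vanishes on constants. -/
theorem weylCochain_two_one (D : (∀ x : N, TangentSpace I x) → ∀ x : N,
    TangentSpace I x → TangentSpace I x) (β : ∀ x : N, TangentSpace I x → TangentSpace I x → ℝ)
    (u : N → ℂ) : weylCochain β D 2 u 1 = 0 := by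
  ext x
  have h (y : N) : mvfderiv I (1 : N → ℂ) y = 0 := mvfderiv_const 1
  rw [weylCochain_two]
  simp [hess, h, crossPairing, mvfderiv_const]

/-- A star product with given second cochain determines at most one symplectic connection: for two
such connections, the symmetrized Hessians agree on all Hamiltonian vectors, hence agree, and the
difference of two torsion-free connections is symmetric. -/
theorem IsConnectionOfStarProduct.unique [T2Space N] (hΩ : IsSymplecticForm I Ω)
    {C : ℕ → (N → ℂ) → (N → ℂ) → N → ℂ}
    {cov' : CovariantDerivative I E (TangentSpace I : N → Type _)}
    (h : IsConnectionOfStarProduct I Ω C cov) (h' : IsConnectionOfStarProduct I Ω C cov')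
    {Y : ∀ x : N, TangentSpace I x} {x : N}
    (hY : MDifferentiableAt I I.tangent (fun y => Bundle.TotalSpace.mk' E y (Y y)) x) :
    cov' Y x = cov Y x := by
  have hβ := hΩ.isLinearSymplectic x
  have key {u : N → ℂ} (hu : IsSmoothFun I u) (v w : TangentSpace I x) :
      symHess (isBilinearMap_hess cov' hu x) v w = symHess (isBilinearMap_hess cov hu x) v w := by
    let a : Module.Dual ℝ (TangentSpace I x) := hβ.bilin.toLinearMap v
    let b : Module.Dual ℝ (TangentSpace I x) := hβ.bilin.toLinearMap w
    have ha : sharp (fun v w => Ω x v w) a = v := hβ.sharp_eq fun _ => rfl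
    have hb : sharp (fun v w => Ω x v w) b = w := hβ.sharp_eq fun _ => rfl
    obtain ⟨f, hf, hfa⟩ := exists_isSmoothFun_mvfderiv_eq (I := I) x a
    obtain ⟨g, hg, hgb⟩ := exists_isSmoothFun_mvfderiv_eq (I := I) x b
    have h1 := congrFun ((h.second.2 u hu).apply_mul hf hg) x
    have h2 := congrFun ((h'.second.2 u hu).apply_mul hf hg) x
    simp only [Pi.sub_apply, Pi.add_apply, Pi.mul_apply, weylCochain_two_one, Pi.zero_apply,
      weylCochain_two_mul cov hΩ hu hf hg hfa hgb] at h1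
    simp only [Pi.sub_apply, Pi.add_apply, Pi.mul_apply, weylCochain_two_one, Pi.zero_apply,
      weylCochain_two_mul cov' hΩ hu hf hg hfa hgb] at h2
    rw [ha, hb] at h1 h2
    linear_combination (1 / 2) * (h1 - h2)
  have hdiff (v w : TangentSpace I x) :
      cov' (FiberBundle.extend E w) x v = cov (FiberBundle.extend E w) x v := by
    have hv := IsSmoothFieldNear.extend (I := I) v
    have hw := IsSmoothFieldNear.extend (I := I) w
    have t1 := h.symplectic.torsionFree _ _ x hv.mdifferentiableAt hw.mdifferentiableAt
    have t2 := h'.symplectic.torsionFree _ _ x hv.mdifferentiableAt hw.mdifferentiableAt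
    simp only [FiberBundle.extend_apply_self] at t1 t2
    have hs : cov' (FiberBundle.extend E w) x v - cov (FiberBundle.extend E w) x v =
        cov' (FiberBundle.extend E v) x w - cov (FiberBundle.extend E v) x w := by
      rw [sub_eq_sub_iff_sub_eq_sub, t2, t1]
    rw [← sub_eq_zero]
    refine (Module.forall_dual_apply_eq_zero_iff ℝ _).1 fun a => ?_
    obtain ⟨u, hu, hua⟩ := exists_isSmoothFun_mvfderiv_eq (I := I) x a
    have hk := key hu v w
    simp only [symHess_apply, hess, hua] at hk
    have h3 : a (cov' (FiberBundle.extend E w) x v) - a (cov (FiberBundle.extend E w) x v) =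
        a (cov' (FiberBundle.extend E v) x w) - a (cov (FiberBundle.extend E v) x w) := by
      rw [← map_sub, hs, map_sub]
    have h4 : (a (cov' (FiberBundle.extend E w) x v) : ℂ) + a (cov' (FiberBundle.extend E v) x w) =
        a (cov (FiberBundle.extend E w) x v) + a (cov (FiberBundle.extend E v) x w) := by
      linear_combination -2 * hk
    norm_cast at h4
    rw [map_sub]
    linarith
  have hc := cov'.isCovariantDerivativeOnUniv
  have hc' := cov.isCovariantDerivativeOnUniv
  have h1 := IsCovariantDerivativeOn.difference_apply hc hc' (x := x) trivial hY
  have h2 := IsCovariantDerivativeOn.difference_apply hc hc' (x := x) trivial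
    (IsSmoothFieldNear.extend (I := I) (Y x)).mdifferentiableAt
  rw [FiberBundle.extend_apply_self, h1] at h2
  rw [← sub_eq_zero]
  refine h2.trans ?_
  ext v
  exact sub_eq_zero.2 (hdiff v (Y x))

end DiffOp

/-! ### The cochains of the reduced product -/

section ReducedProduct

variable {n : ℕ}
  {M : Type*} [TopologicalSpace M] [T2Space M]
  [ChartedSpace (EuclideanSpace ℝ (Fin (2 * n))) M] [IsManifold (𝓡 (2 * n)) ∞ M]
  {S : Type*} [TopologicalSpace S] [ChartedSpace (EuclideanSpace ℝ (Fin (2 * n + 1))) S]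
  [IsManifold (𝓡 (2 * n + 1)) ∞ S]
  (Ω : ∀ x : M, TangentSpace (𝓡 (2 * n)) x →L[ℝ] TangentSpace (𝓡 (2 * n)) x →L[ℝ] ℝ)
  (cov : CovariantDerivative (𝓡 (2 * n)) (EuclideanSpace ℝ (Fin (2 * n)))
    (TangentSpace (𝓡 (2 * n)) : M → Type _))

/-- The explicit cochains `uv`, `{u, v}` and `⟨Λ ⊗ Λ, ½𝖣²u ⊗ ½𝖣²v⟩ + (2/(n+1)) ⟨Ric^♯, du ⊗ dv⟩` of
order at most two on `M`; the indices above two are irrelevant and repeat the second one. -/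
def lowOrderCochain : ℕ → (M → ℂ) → (M → ℂ) → M → ℂ
  | 0, u, v => u * v
  | 1, u, v => poissonBracket (𝓡 (2 * n)) (fun x v w => Ω x v w) u v
  | _, u, v => fun x => weylCochain (fun x v w => Ω x v w) (fun Y x v => cov Y x v) 2 u v x
      + (2 / ((n : ℂ) + 1)) *
        sharpPairing (fun v w => Ω x v w) (fun v w => ricciTensor cov x v w)
          (fun w => mvfderiv (𝓡 (2 * n)) u x w) (fun w => mvfderiv (𝓡 (2 * n)) v x w)

variable {Ω cov}
  {π : S → M} {α : ∀ q : S, TangentSpace (𝓡 (2 * n + 1)) q →L[ℝ] ℝ}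

namespace IsContactReduction

variable (hπ : IsContactReduction Ω π α) (hn : 2 ≤ n) (hΩ : IsSymplecticForm (𝓡 (2 * n)) Ω)
  (hcov : IsSymplecticConnection (𝓡 (2 * n)) Ω cov) (hRic : IsRicciType Ω cov n)

include hπ hn hΩ hcov hRic

/-- The coefficients of order at most two of the restricted product are pullbacks along `π`. -/
theorem coeff_restrictedProduct_eq_comp {u v : M → ℂ} (hu : IsSmoothFun (𝓡 (2 * n)) u)
    (hv : IsSmoothFun (𝓡 (2 * n)) v) {k : ℕ} (hk : k ≤ 2) :
    PowerSeries.coeff k (restrictedProduct Ω cov π α (PowerSeries.C u) (PowerSeries.C v)) =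
      (((1 / (k.factorial : ℂ)) * (1 / 2) ^ k) • lowOrderCochain Ω cov k u v) ∘ π := by
  rw [hπ.coeff_restrictedProduct cov hΩ hu hv (hΩ.isSmoothFun_poissonBracket hu hv) hk]
  ext q
  change _ = _ * lowOrderCochain Ω cov k u v (π q)
  congr 1
  interval_cases k
  · rw [weylCochain_zero]; rfl
  · rw [weylCochain_one, hπ.poissonBracket_pr hΩ hu hv]
    simp [lowOrderCochain]
  · exact hπ.weylCochain_two_pr hΩ hu hv q (hcov.ricciEndoMap hΩ (π q)) (fun _ => rfl)
      (fun x y => hcov.ricciTensor_eq_ricciEndo hΩ (π q) x y)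
      (hcov.ricciTensor_symm hΩ hRic (by rw [finrank_euclideanSpace_fin]; omega) (π q))

theorem coeff_reducedProduct {u v : M → ℂ} (hu : IsSmoothFun (𝓡 (2 * n)) u)
    (hv : IsSmoothFun (𝓡 (2 * n)) v) {k : ℕ} (hk : k ≤ 2) :
    PowerSeries.coeff k (reducedProduct Ω cov π α (PowerSeries.C u) (PowerSeries.C v)) =
      ((1 / (k.factorial : ℂ)) * (1 / 2) ^ k) • lowOrderCochain Ω cov k u v := by
  have h := hπ.coeff_restrictedProduct_eq_comp hn hΩ hcov hRic hu hv hk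
  rw [reducedProduct, PowerSeries.coeff_mk]
  refine hπ.surjective.injective_comp_right (Eq.trans ?_ h)
  exact Classical.epsilon_spec (p := fun w : M → ℂ => w ∘ π =
    PowerSeries.coeff k (restrictedProduct Ω cov π α (PowerSeries.C u) (PowerSeries.C v)))
    ⟨_, h.symm⟩

theorem reducedCochain_eq {u v : M → ℂ} (hu : IsSmoothFun (𝓡 (2 * n)) u)
    (hv : IsSmoothFun (𝓡 (2 * n)) v) {k : ℕ} (hk : k ≤ 2) :
    reducedCochain Ω cov π α k u v = lowOrderCochain Ω cov k u v := by
  rw [reducedCochain, hπ.coeff_reducedProduct hn hΩ hcov hRic hu hv hk, smul_smul]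
  have hf : (k.factorial : ℂ) ≠ 0 := Nat.cast_ne_zero.2 k.factorial_ne_zero
  have e : (k.factorial : ℂ) * 2 ^ k * (1 / (k.factorial : ℂ) * (1 / 2) ^ k) = 1 := by
    rw [one_div_pow]
    field_simp
  rw [e, one_smul]

theorem isConnectionOfStarProduct :
    IsConnectionOfStarProduct (𝓡 (2 * n)) Ω (reducedCochain Ω cov π α) cov where
  symplectic := hcov
  zeroth _ _ hu hv := hπ.reducedCochain_eq hn hΩ hcov hRic hu hv (by norm_num)
  first _ _ hu hv := hπ.reducedCochain_eq hn hΩ hcov hRic hu hv (by norm_num)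
  second := hcov.isBidiffOp_ricci hΩ (2 / ((n : ℂ) + 1)) fun u v hu hv => by
    rw [hπ.reducedCochain_eq hn hΩ hcov hRic hu hv le_rfl]
    exact add_sub_cancel_left _ _

end IsContactReduction

end ReducedProduct

end

theorem mainTheorem2 (n : ℕ) (hn : 2 ≤ n)
    {M : Type*} [TopologicalSpace M] [T2Space M] [SecondCountableTopology M]
    [ChartedSpace (EuclideanSpace ℝ (Fin (2 * n))) M] [IsManifold (𝓡 (2 * n)) ∞ M]
    {S : Type*} [TopologicalSpace S] [T2Space S] [SecondCountableTopology S]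
    [ChartedSpace (EuclideanSpace ℝ (Fin (2 * n + 1))) S] [IsManifold (𝓡 (2 * n + 1)) ∞ S]
    (Ω : ∀ x : M, TangentSpace (𝓡 (2 * n)) x →L[ℝ] TangentSpace (𝓡 (2 * n)) x →L[ℝ] ℝ)
    (cov : CovariantDerivative (𝓡 (2 * n)) (EuclideanSpace ℝ (Fin (2 * n)))
      (TangentSpace (𝓡 (2 * n)) : M → Type _))
    (hΩ : IsSymplecticForm (𝓡 (2 * n)) Ω)
    (hcov : IsSymplecticConnection (𝓡 (2 * n)) Ω cov)
    (hRic : IsRicciType Ω cov n)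
    (π : S → M) (α : ∀ q : S, TangentSpace (𝓡 (2 * n + 1)) q →L[ℝ] ℝ)
    (hπ : IsContactReduction Ω π α) :
    -- the reduced product is well defined up to the second order
    (∀ u v : M → ℂ, IsSmoothFun (𝓡 (2 * n)) u → IsSmoothFun (𝓡 (2 * n)) v → ∀ k ≤ 2,
      PowerSeries.coeff k
          (reducedProduct Ω cov π α (PowerSeries.C u) (PowerSeries.C v)) ∘ π
        = PowerSeries.coeff k
          (restrictedProduct Ω cov π α (PowerSeries.C u) (PowerSeries.C v))) ∧
    -- the formula for the second cochain
    (∀ u v : PowerSeries (M → ℂ),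
      IsSmoothSeries (𝓡 (2 * n)) u → IsSmoothSeries (𝓡 (2 * n)) v →
      seriesExt (reducedCochain Ω cov π α 2) u v
        = seriesExt (fun f g x =>
            weylCochain (fun x v w => Ω x v w) (fun Y x v => cov Y x v) 2 f g x
              + (2 / ((n : ℂ) + 1)) *
                sharpPairing (fun v w => Ω x v w) (fun v w => ricciTensor cov x v w)
                  (fun v => mvfderiv (𝓡 (2 * n)) f x v)
                  (fun v => mvfderiv (𝓡 (2 * n)) g x v)) u v) ∧
    -- the symplectic connection determined by the reduced product is the given one
    IsConnectionOfStarProduct (𝓡 (2 * n)) Ω (reducedCochain Ω cov π α) cov ∧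
    (∀ cov' : CovariantDerivative (𝓡 (2 * n)) (EuclideanSpace ℝ (Fin (2 * n)))
        (TangentSpace (𝓡 (2 * n)) : M → Type _),
      IsConnectionOfStarProduct (𝓡 (2 * n)) Ω (reducedCochain Ω cov π α) cov' →
      ∀ (Y : ∀ x : M, TangentSpace (𝓡 (2 * n)) x) (x : M),
        MDifferentiableAt (𝓡 (2 * n)) (𝓡 (2 * n)).tangent
          (fun y => Bundle.TotalSpace.mk' (EuclideanSpace ℝ (Fin (2 * n))) y (Y y)) x →
        cov' Y x = cov Y x) := by
  refine ⟨fun u v hu hv k hk => ?_, fun u v hu hv => ?_,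
    hπ.isConnectionOfStarProduct hn hΩ hcov hRic, fun cov' h' Y x hY =>
    IsConnectionOfStarProduct.unique hΩ (hπ.isConnectionOfStarProduct hn hΩ hcov hRic) h' hY⟩
  · rw [hπ.coeff_reducedProduct hn hΩ hcov hRic hu hv hk,
      hπ.coeff_restrictedProduct_eq_comp hn hΩ hcov hRic hu hv hk]
  · ext1 k
    rw [seriesExt, seriesExt, PowerSeries.coeff_mk, PowerSeries.coeff_mk]
    refine Finset.sum_congr rfl fun ab _ => ?_
    exact hπ.reducedCochain_eq hn hΩ hcov hRic (hu ab.1) (hv ab.2) le_rfl
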